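/- Let $n\ge 1$, let $B_n$ be the open unit ball of $\mathbb C^n$ with inner product $\langle z,w\rangle=\sum_j z_j\overline{w_j}$, and let $\sigma$ be the normalized rotation-invariant measure on $\partial B_n$. For $1\le p<\infty$ let $H^p$ be the Hardy space of all holomorphic $f:B_n\to\mathbb C$ with $$\|f\|_p=\sup_{0<r<1}\Big(\int_{\partial B_n}|f(r\xi)|^p\,d\sigma(\xi)\Big)^{1/p}<\infty .$$ Let $\psi:B_n\to\mathbb C$ and $\varphi:B_n\to B_n$ be holomorphic, put $W_{\psi,\varphi}f=\psi\cdot(f\circ\varphi)$, and write $\psi^*,\varphi^*$ for the radial limits $\psi^*(\xi)=\lim_{r\to1^-}\psi(r\xi)$, $\varphi^*(\xi)=\lim_{r\to1^-}\varphi(r\xi)$, $\xi\in\partial B_n$. Let $1<p\le q<\infty$ and assume that $W_{\psi,\varphi}$ is a bounded operator from $H^p$ to $H^q$. (Then $\psi=W_{\psi,\varphi}1\in H^q$, so these limits exist $\sigma$-almost everywhere.) Let $\mu_{\psi,\varphi,q}$ be the measure on $\overline{B}_n$ given by $$\mu_{\psi,\varphi,q}(A)=\int_{(\varphi^*)^{-1}(A)}|\psi^*|^q\,d\sigma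 .$$ Then $W_{\psi,\varphi}:H^p\to H^q$ is compact if and only if $$\lim_{|w|\to1^-}\int_{\overline{B}_n}\frac{(1-|w|^2)^{nq/p}}{|1-\langle z,w\rangle|^{2nq/p}}\,d\mu_{\psi,\varphi,q}(z)=0 .$$ -/

import Mathlib

open Set Filter Topology MeasureTheory
open scoped ENNReal

noncomputable section

namespace WeightedComp

/-- Complex `n`-space with its Hermitian norm. -/
abbrev Cn (n : ℕ) : Type := EuclideanSpace ℂ (Fin n)

/-- The open unit ball of complex `n`-space. -/
abbrev unitBall (n : ℕ) : Set (Cn n) := Metric.ball (0 : Cn n) 1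

/-- The unit sphere of complex `n`-space, as a type. -/
abbrev unitSphere (n : ℕ) : Type := Metric.sphere (0 : Cn n) 1

/-- The surface measure of the unit sphere, normalized to total mass one: the rotation invariant
probability measure on the sphere. -/
def sigma (n : ℕ) : Measure (unitSphere n) :=
  ((volume : Measure (Cn n)).toSphere univ)⁻¹ • (volume : Measure (Cn n)).toSphere

/-- The Hardy norm `sup_{0<r<1} (∫ |f(rξ)|^p dσ(ξ))^{1/p}`, with values in `[0, ∞]`. -/
def hardyENorm {n : ℕ} (p : ℝ) (f : Cn n → ℂ) : ℝ≥0∞ :=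
  ⨆ r ∈ Ioo (0 : ℝ) 1,
    eLpNorm (fun ξ : unitSphere n => f (r • (ξ : Cn n))) (ENNReal.ofReal p) (sigma n)

lemma smul_mem_unitBall {n : ℕ} {r : ℝ} (hr : r ∈ Ioo (0 : ℝ) 1) (ξ : unitSphere n) :
    r • (ξ : Cn n) ∈ unitBall n := by
  have h : ‖(ξ : Cn n)‖ = 1 := norm_eq_of_mem_sphere ξ
  rw [mem_ball_zero_iff, norm_smul, h, mul_one, Real.norm_eq_abs, abs_of_pos hr.1]
  exact hr.2

lemma continuous_dilate {n : ℕ} {f : Cn n → ℂ} (hf : DifferentiableOn ℂ f (unitBall n))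
    {r : ℝ} (hr : r ∈ Ioo (0 : ℝ) 1) :
    Continuous (fun ξ : unitSphere n => f (r • (ξ : Cn n))) :=
  hf.continuousOn.comp_continuous (by fun_prop) (smul_mem_unitBall hr)

lemma aesm_dilate {n : ℕ} {f : Cn n → ℂ} (hf : DifferentiableOn ℂ f (unitBall n))
    {r : ℝ} (hr : r ∈ Ioo (0 : ℝ) 1) :
    AEStronglyMeasurable (fun ξ : unitSphere n => f (r • (ξ : Cn n))) (sigma n) :=
  (continuous_dilate hf hr).aestronglyMeasurable

lemma hardyENorm_smul {n : ℕ} (p : ℝ) (c : ℂ) (f : Cn n → ℂ) :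
    hardyENorm p (c • f) = ‖c‖ₑ * hardyENorm p f := by
  simp only [hardyENorm, ENNReal.mul_iSup]
  refine iSup_congr fun r => iSup_congr fun _ => ?_
  exact eLpNorm_const_smul c (fun ξ : unitSphere n => f (r • (ξ : Cn n))) _ _

/-- The holomorphic functions on the unit ball with finite Hardy norm, as a space of functions. A
function on the ball is represented by its extension by zero, so that elements are equal exactly
when they agree on the ball. -/
def hardySubmodule (n : ℕ) (p : ℝ) : Submodule ℂ (Cn n → ℂ) where
  carrier := {f | DifferentiableOn ℂ f (unitBall n) ∧ (∀ z ∉ unitBall n, f z = 0) ∧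
    hardyENorm p f < ∞}
  zero_mem' := by
    refine ⟨differentiableOn_const 0, fun _ _ => rfl, ?_⟩
    have h := hardyENorm_smul p (0 : ℂ) (0 : Cn n → ℂ)
    simp only [smul_zero, enorm_zero, zero_mul] at h
    rw [h]
    exact ENNReal.zero_lt_top
  add_mem' := by
    rintro f g ⟨hf, hf0, hfp⟩ ⟨hg, hg0, hgp⟩
    refine ⟨hf.add hg, fun z hz => by simp [hf0 z hz, hg0 z hz], ?_⟩
    refine lt_of_le_of_lt (b := ENNReal.LpAddConst (ENNReal.ofReal p) *
      (hardyENorm p f + hardyENorm p g)) ?_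
      (ENNReal.mul_lt_top (ENNReal.LpAddConst_lt_top _) (ENNReal.add_lt_top.2 ⟨hfp, hgp⟩))
    refine iSup₂_le fun r hr => ?_
    refine (eLpNorm_add_le' (aesm_dilate hf hr) (aesm_dilate hg hr) _).trans ?_
    gcongr
    · exact le_iSup₂_of_le r hr le_rfl
    · exact le_iSup₂_of_le r hr le_rfl
  smul_mem' := by
    rintro c f ⟨hf, hf0, hfp⟩
    refine ⟨hf.const_smul c, fun z hz => by simp [hf0 z hz], ?_⟩
    rw [hardyENorm_smul]
    exact ENNReal.mul_lt_top enorm_lt_top hfp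

lemma hardyENorm_add_le {n : ℕ} {p : ℝ} (hp : 1 ≤ p) {f g : Cn n → ℂ}
    (hf : DifferentiableOn ℂ f (unitBall n)) (hg : DifferentiableOn ℂ g (unitBall n)) :
    hardyENorm p (f + g) ≤ hardyENorm p f + hardyENorm p g := by
  refine iSup₂_le fun r hr => ?_
  refine (eLpNorm_add_le (aesm_dilate hf hr) (aesm_dilate hg hr)
    (by simpa using hp)).trans ?_
  gcongr
  · exact le_iSup₂_of_le r hr le_rfl
  · exact le_iSup₂_of_le r hr le_rfl

lemma eq_zero_of_hardyENorm_eq_zero {n : ℕ} [NeZero n] {p : ℝ} (hp : 1 ≤ p) {f : Cn n → ℂ}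
    (hf : DifferentiableOn ℂ f (unitBall n)) (h : hardyENorm p f = 0) :
    ∀ z ∈ unitBall n, f z = 0 := by
  have key : ∀ r ∈ Ioo (0 : ℝ) 1, ∀ ξ : unitSphere n, f (r • (ξ : Cn n)) = 0 := by
    intro r hr
    have h1 : eLpNorm (fun ξ : unitSphere n => f (r • (ξ : Cn n))) (ENNReal.ofReal p)
        (sigma n) = 0 :=
      le_antisymm (h ▸ le_iSup₂_of_le r hr le_rfl) (zero_le)
    rw [eLpNorm_eq_zero_iff (aesm_dilate hf hr) (by simp; linarith)] at h1
    have h2 : (fun ξ : unitSphere n => f (r • (ξ : Cn n)))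
        =ᵐ[(volume : Measure (Cn n)).toSphere] 0 := by
      refine Measure.AbsolutelyContinuous.ae_eq ?_ h1
      refine Measure.absolutelyContinuous_smul ?_
      exact ENNReal.inv_ne_zero.2 (measure_ne_top _ _)
    have h3 := Continuous.ae_eq_iff_eq (volume : Measure (Cn n)).toSphere
      (continuous_dilate hf hr) continuous_zero |>.1 h2
    exact fun ξ => congrFun h3 ξ
  have key' : ∀ z ∈ unitBall n, z ≠ 0 → f z = 0 := by
    intro z hz hz0
    have hn : 0 < ‖z‖ := norm_pos_iff.2 hz0
    have := key ‖z‖ ⟨hn, mem_ball_zero_iff.1 hz⟩ ⟨‖z‖⁻¹ • z, by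
      rw [mem_sphere_zero_iff_norm, norm_smul, norm_inv, norm_norm, inv_mul_cancel₀ hn.ne']⟩
    simpa [smul_smul, mul_inv_cancel₀ hn.ne'] using this
  intro z hz
  by_cases hz0 : z = 0
  · subst hz0
    have hc : ContinuousAt f 0 :=
      hf.continuousOn.continuousAt (Metric.isOpen_ball.mem_nhds hz)
    have hl : Tendsto f (𝓝[≠] (0 : Cn n)) (𝓝 (f 0)) := hc.tendsto.mono_left nhdsWithin_le_nhds
    have hm : Tendsto f (𝓝[≠] (0 : Cn n)) (𝓝 0) := by
      refine tendsto_const_nhds.congr' ?_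
      filter_upwards [self_mem_nhdsWithin,
        nhdsWithin_le_nhds (Metric.isOpen_ball.mem_nhds hz)] with w hw0 hw
      exact (key' w hw hw0).symm
    exact tendsto_nhds_unique hl hm
  · exact key' z hz hz0

/-- The Hardy space `H^p` of the unit ball. This is a type of its own, so that it carries only the
topology of the Hardy norm below, not that of pointwise convergence. -/
def HardySpace (n : ℕ) (p : ℝ) : Type := hardySubmodule n p

/-- The function (extended by zero) that an element of `H^p` is. -/
def HardySpace.toFun {n : ℕ} {p : ℝ} (f : HardySpace n p) : Cn n → ℂ := f.1

instance hardyAddCommGroup (n : ℕ) (p : ℝ) : AddCommGroup (HardySpace n p) :=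
  inferInstanceAs (AddCommGroup (hardySubmodule n p))

instance hardyModule (n : ℕ) (p : ℝ) : Module ℂ (HardySpace n p) :=
  inferInstanceAs (Module ℂ (hardySubmodule n p))

/-- The Hardy norm makes `H^p` a normed space for `p ≥ 1`. -/
instance hardyNormedAddCommGroup (n : ℕ) [NeZero n] (p : ℝ) [hp : Fact (1 ≤ p)] :
    NormedAddCommGroup (HardySpace n p) :=
  AddGroupNorm.toNormedAddCommGroup
    { toFun := fun f => (hardyENorm p f.toFun).toReal
      map_zero' := by
        have h := hardyENorm_smul p (0 : ℂ) (0 : Cn n → ℂ)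
        simp only [smul_zero, enorm_zero, zero_mul] at h
        change (hardyENorm p (0 : Cn n → ℂ)).toReal = 0
        rw [h, ENNReal.toReal_zero]
      add_le' := fun f g => by
        refine le_of_le_of_eq ?_ (ENNReal.toReal_add f.2.2.2.ne g.2.2.2.ne)
        exact ENNReal.toReal_mono (ENNReal.add_ne_top.2 ⟨f.2.2.2.ne, g.2.2.2.ne⟩)
          (hardyENorm_add_le hp.out f.2.1 g.2.1)
      neg' := fun f => by
        have h := hardyENorm_smul p (-1 : ℂ) f.toFun
        simp only [neg_smul, one_smul, enorm_neg, enorm_one, one_mul] at h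
        change (hardyENorm p (-f.toFun)).toReal = _
        rw [h]
      eq_zero_of_map_eq_zero' := fun f hf => by
        have h0 : hardyENorm p f.toFun = 0 :=
          ((ENNReal.toReal_eq_zero_iff _).1 hf).resolve_right f.2.2.2.ne
        refine Subtype.ext (funext fun z => ?_)
        by_cases hz : z ∈ unitBall n
        · exact eq_zero_of_hardyENorm_eq_zero hp.out f.2.1 h0 z hz
        · exact f.2.2.1 z hz }

lemma HardySpace.norm_def {n : ℕ} [NeZero n] {p : ℝ} [Fact (1 ≤ p)] (f : HardySpace n p) :
    ‖f‖ = (hardyENorm p f.toFun).toReal := rfl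

instance hardyNormedSpace (n : ℕ) [NeZero n] (p : ℝ) [Fact (1 ≤ p)] :
    NormedSpace ℂ (HardySpace n p) where
  norm_smul_le c f := by
    rw [HardySpace.norm_def, HardySpace.norm_def, ← toReal_enorm c, ← ENNReal.toReal_mul,
      ← hardyENorm_smul]
    exact le_rfl

/-- The weighted composition `z ↦ ψ(z) f(φ(z))` on the unit ball (extended by zero). -/
def weightedComp {n : ℕ} (ψ : Cn n → ℂ) (φ : Cn n → Cn n) (f : Cn n → ℂ) : Cn n → ℂ :=
  (unitBall n).indicator fun z => ψ z * f (φ z)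

/-- The radial limit `f*(ξ) = lim_{r → 1⁻} f(rξ)` (an arbitrary value where there is no limit). -/
def radialLimit {n : ℕ} {F : Type*} [TopologicalSpace F] [Nonempty F] (f : Cn n → F)
    (ξ : unitSphere n) : F :=
  limUnder (𝓝[<] (1 : ℝ)) fun r => f (r • (ξ : Cn n))

/-- The measure `μ(A) = ∫_{(φ*)⁻¹(A)} |ψ*|^q dσ`, i.e. the image of `|ψ*|^q dσ` under the radial
limit map of `φ`; it is carried by the closed unit ball. -/
def pullMeasure {n : ℕ} (ψ : Cn n → ℂ) (φ : Cn n → Cn n) (q : ℝ) : Measure (Cn n) :=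
  ((sigma n).withDensity fun ξ => ‖radialLimit ψ ξ‖ₑ ^ q).map (radialLimit φ)

end WeightedComp

end

noncomputable section

open scoped Pointwise

namespace WeightedComp

/-! Write P(w,z) = ((1-|w|²)/|1-⟨z,w⟩|²)^n and k_w(z) = (1-|w|²)^(n/p)/(1-⟨z,w⟩)^(2n/p), so that
|k_w|^p = P(w,·). For w in the ball, P(w,·) is the Poisson kernel; it has mean one on the sphere,
hence the k_w lie in the unit ball of H^p. The integral in the theorem equals ∫|ψ* k_w(φ*)|^q dσ,
and since q > 1 this is ‖W k_w‖_q^q.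

Necessity. As |w| → 1 the k_w tend to zero pointwise on the ball. Compactness makes W k_w converge
in norm along any ultrafilter, and point evaluations are continuous, so the limit can only be 0.

Sufficiency is a vanishing Carleson measure argument. For R < 1 the measure |ψ(R·)|^q σ is
transported by φ(R·) into the open ball. Its test integrals are the q-means of W k_w at radius R, so
they are bounded by the boundary test integrals, uniformly in R; no boundary function of f∘φ is ever
needed. Smallness for |w| near 1 bounds the mass of all nonisotropic tents inside a thin shell s₀ ≤
|z| < 1, and the Carleson embedding (`carleson_embedding`, `vanishing_embedding`) makes the shell
contribute at most a small multiple of ‖f‖_p^q. Off the shell only the size of f on a compact ball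
counts, and Montel's theorem makes that small for differences f - g along an ultrafilter.

The analytic base is built from Cauchy's formula on the sphere, obtained from explicit moments and
rotation averaging. It yields `poisson_formula`, monotone integral means and point evaluation
bounds. A Vitali covering by nonisotropic caps gives `weak_type`, which serves twice: with m = σ for
the radial maximal function, and with a Carleson measure for the embedding. Boundary values come
from uniform convexity of |·|^q: the dilates of f in H^q are Cauchy in mean, which together with the
weak type bound gives radial limits almost everywhere. -/

instance sigma_isProbabilityMeasure (n : ℕ) [NeZero n] : IsProbabilityMeasure (sigma n) := by
  constructor
  have h : (volume : Measure (Cn n)).toSphere univ ≠ 0 := by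
    rw [Ne, Measure.measure_univ_eq_zero]
    exact Measure.toSphere_ne_zero _
  rw [sigma, Measure.smul_apply, smul_eq_mul, ENNReal.inv_mul_cancel h (measure_ne_top _ _)]

/-! ### Unitary invariance of the surface measure -/

/-- The action of a linear isometry on the unit sphere. -/
def sphereMap {n : ℕ} (U : Cn n ≃ₗᵢ[ℂ] Cn n) (ξ : unitSphere n) : unitSphere n :=
  ⟨U ξ, by rw [mem_sphere_zero_iff_norm, U.norm_map]; exact norm_eq_of_mem_sphere ξ⟩

lemma continuous_sphereMap {n : ℕ} (U : Cn n ≃ₗᵢ[ℂ] Cn n) : Continuous (sphereMap U) :=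
  (U.continuous.comp continuous_subtype_val).subtype_mk _

/-- A complex linear isometry as a real linear isometry. -/
def realIsometry {n : ℕ} (U : Cn n ≃ₗᵢ[ℂ] Cn n) : Cn n ≃ₗᵢ[ℝ] Cn n :=
  { U.toLinearEquiv.restrictScalars ℝ with norm_map' := U.norm_map }

/-- The surface measure of s is a multiple of the volume of the cone over s; a unitary map carries
cones to cones and preserves volume. -/
lemma measurePreserving_sphereMap {n : ℕ} (U : Cn n ≃ₗᵢ[ℂ] Cn n) :
    MeasurePreserving (sphereMap U) (sigma n) (sigma n) := by
  refine ⟨(continuous_sphereMap U).measurable, ?_⟩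
  rw [sigma, Measure.map_smul]
  congr 1
  refine Measure.ext fun s hs => ?_
  have hU : MeasurePreserving (U : Cn n → Cn n) volume volume :=
    LinearIsometryEquiv.measurePreserving (realIsometry U)
  have hsmul : ∀ (r : ℝ) (z : Cn n), U (r • z) = r • U z := (realIsometry U).map_smul
  rw [Measure.map_apply (continuous_sphereMap U).measurable hs, Measure.toSphere_apply' _ hs,
    Measure.toSphere_apply' _ ((continuous_sphereMap U).measurable hs)]
  congr 1
  have : (U : Cn n → Cn n) ⁻¹' (Ioo (0 : ℝ) 1 • (Subtype.val '' s)) =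
      Ioo (0 : ℝ) 1 • (Subtype.val '' (sphereMap U ⁻¹' s)) := by
    ext z
    simp only [mem_preimage, Set.mem_smul, mem_image]
    constructor
    · rintro ⟨r, hr, _, ⟨ξ, hξ, rfl⟩, h⟩
      refine ⟨r, hr, U.symm ξ, ⟨sphereMap U.symm ξ, ?_, rfl⟩, ?_⟩
      · have : sphereMap U (sphereMap U.symm ξ) = ξ := Subtype.ext (U.apply_symm_apply _)
        rwa [this]
      · apply U.injective
        rw [← h, hsmul, U.apply_symm_apply]
    · rintro ⟨r, hr, _, ⟨ξ, hξ, rfl⟩, rfl⟩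
      exact ⟨r, hr, U ξ, ⟨sphereMap U ξ, hξ, rfl⟩, (hsmul r _).symm⟩
  rw [← this]
  exact hU.measure_preimage_emb U.toHomeomorph.measurableEmbedding _

lemma integral_sphereMap {n : ℕ} (U : Cn n ≃ₗᵢ[ℂ] Cn n) {E : Type*} [NormedAddCommGroup E]
    [NormedSpace ℝ E] (f : unitSphere n → E) :
    ∫ ξ, f (sphereMap U ξ) ∂(sigma n) = ∫ ξ, f ξ ∂(sigma n) := by
  refine (measurePreserving_sphereMap U).integral_comp ?_ f
  refine (continuous_sphereMap U).measurableEmbedding fun x y h => ?_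
  exact Subtype.ext (U.injective (congrArg Subtype.val h))

/-- A unitary map taking one given unit vector to another one. -/
lemma exists_isometry_map {n : ℕ} {e e' : Cn n} (he : ‖e‖ = 1) (he' : ‖e'‖ = 1) :
    ∃ U : Cn n ≃ₗᵢ[ℂ] Cn n, U e = e' := by
  have hn : 0 < n := by
    rcases Nat.eq_zero_or_pos n with h | h
    · subst h
      simp [Subsingleton.elim e 0] at he
    · exact h
  have key : ∀ v : Cn n, ‖v‖ = 1 → ∃ b : OrthonormalBasis (Fin n) ℂ (Cn n), b ⟨0, hn⟩ = v := by
    intro v hv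
    have ho : Orthonormal ℂ (({⟨0, hn⟩} : Set (Fin n)).domRestrict fun _ => v) := by
      constructor
      · intro i; exact hv
      · intro i j hij
        exact absurd (Subsingleton.elim i j) hij
    obtain ⟨b, hb⟩ := ho.exists_orthonormalBasis_extension_of_card_eq (by simp)
    exact ⟨b, hb _ rfl⟩
  obtain ⟨b, hb⟩ := key e he
  obtain ⟨b', hb'⟩ := key e' he'
  refine ⟨b.equiv b' (Equiv.refl _), ?_⟩
  rw [← hb, b.equiv_apply_basis]
  simpa using hb'

/-! ### Moments of a coordinate on the sphere -/

/-- Polar coordinates. Two integrands with the same radial profile share the second factor, so the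
ratio of their integrals is a ratio of sphere integrals. -/
lemma integral_eq_sphere_mul_radial {n : ℕ} (a : unitSphere n → ℝ) (b : ℝ → ℝ) (F : Cn n → ℝ)
    (hF : ∀ (ξ : unitSphere n) (r : ℝ), 0 < r → F (r • (ξ : Cn n)) = a ξ * b r) [NeZero n] :
    ∫ z, F z = (∫ ξ, a ξ ∂(volume : Measure (Cn n)).toSphere) *
      ∫ r : Ioi (0 : ℝ), b r ∂(Measure.volumeIoiPow (Module.finrank ℝ (Cn n) - 1)) := by
  calc ∫ z, F z = ∫ z : ({(0)}ᶜ : Set (Cn n)), F z.1 ∂(volume.comap Subtype.val) := by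
        rw [integral_subtype_comap (measurableSet_singleton _).compl F,
          restrict_compl_singleton]
    _ = ∫ x, a x.1 * b x.2 ∂(volume : Measure (Cn n)).toSphere.prod
          (.volumeIoiPow (Module.finrank ℝ (Cn n) - 1)) := by
        rw [← (volume : Measure (Cn n)).measurePreserving_homeomorphUnitSphereProd.integral_comp
          (Homeomorph.measurableEmbedding _)]
        refine integral_congr_ae (Eventually.of_forall fun z => ?_)
        have hz : 0 < ‖(z : Cn n)‖ := norm_pos_iff.2 z.2
        have := hF (homeomorphUnitSphereProd (Cn n) z).1 (homeomorphUnitSphereProd (Cn n) z).2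
          (homeomorphUnitSphereProd (Cn n) z).2.2
        simp only
        rw [← this]
        congr 1
        simp [smul_smul, hz.ne']
    _ = _ := integral_prod_mul a (fun r : Ioi (0 : ℝ) => b r)

/-- Uniqueness of Haar measure gives the constant. Its value need not be known: a Gaussian integral
calibrates it later. -/
lemma exists_volume_eq (n : ℕ) : ∃ c : ℝ, ∀ F : Cn n → ℝ,
    ∫ z, F z = c * ∫ x : Fin n → ℂ, F (WithLp.toLp 2 x) := by
  let L : Cn n ≃L[ℝ] (Fin n → ℂ) := PiLp.continuousLinearEquiv 2 ℝ (fun _ : Fin n => ℂ)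
  let ν : Measure (Fin n → ℂ) := (volume : Measure (Cn n)).map L
  have : ν.IsAddHaarMeasure :=
    L.isAddHaarMeasure_map (volume : Measure (Cn n))
  have h := Measure.isAddLeftInvariant_eq_smul ν (volume : Measure (Fin n → ℂ))
  refine ⟨(ν.addHaarScalarFactor (volume : Measure (Fin n → ℂ)) : ℝ), fun F => ?_⟩
  have h1 : ∫ z, F z = ∫ x, F (L.symm x) ∂ν := by
    refine ((L.toHomeomorph.measurableEmbedding.integral_map _).trans ?_).symm
    exact integral_congr_ae (Eventually.of_forall fun z => congrArg F (L.symm_apply_apply z))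
  rw [h1]
  refine (congrArg (fun m => ∫ x, F (L.symm x) ∂m) h).trans ?_
  rw [integral_smul_nnreal_measure]
  rfl

lemma integral_complex_gaussian (k : ℕ) :
    ∫ x : ℂ, ‖x‖ ^ (2 * k) * Real.exp (-‖x‖ ^ 2) = Real.pi * k.factorial := by
  have h := Complex.integral_rpow_mul_exp_neg_rpow (p := 2) (q := 2 * k) (by norm_num)
    (by have : (0 : ℝ) ≤ k := k.cast_nonneg
        linarith)
  have h2 : ((2 * k + 2) / 2 : ℝ) = k + 1 := by ring
  rw [h2, Real.Gamma_nat_eq_factorial] at h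
  convert h using 1
  · refine integral_congr_ae (Eventually.of_forall fun x => ?_)
    simp only
    norm_cast
  · ring

lemma integral_norm_gaussian (n k : ℕ) [NeZero n] :
    ∫ z : Cn n, ‖z‖ ^ (2 * k) * Real.exp (-‖z‖ ^ 2) =
      Module.finrank ℝ (Cn n) • (volume : Measure (Cn n)).real (Metric.ball 0 1) *
        ((n - 1 + k).factorial / 2) := by
  have hn : 1 ≤ n := NeZero.one_le
  have hd : Module.finrank ℝ (Cn n) = 2 * n := by
    rw [← Module.finrank_mul_finrank ℝ ℂ (Cn n)]
    simp
  rw [integral_fun_norm_addHaar volume (fun r : ℝ => r ^ (2 * k) * Real.exp (-r ^ 2)), smul_eq_mul,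
    ← smul_mul_assoc]
  congr 1
  have h := integral_rpow_mul_exp_neg_rpow (p := 2) (q := (2 * n - 1 + 2 * k : ℕ)) (by norm_num)
    (by have : (0 : ℝ) ≤ (2 * n - 1 + 2 * k : ℕ) := Nat.cast_nonneg _
        linarith)
  have h2 : (((2 * n - 1 + 2 * k : ℕ) : ℝ) + 1) / 2 = ((n - 1 + k : ℕ) : ℝ) + 1 := by
    have : 2 * n - 1 + 2 * k + 1 = 2 * (n - 1 + k + 1) := by omega
    have h3 : (((2 * n - 1 + 2 * k : ℕ) : ℝ) + 1) = 2 * (((n - 1 + k : ℕ) : ℝ) + 1) := by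
      exact_mod_cast this
    rw [h3]; ring
  rw [h2, Real.Gamma_nat_eq_factorial] at h
  rw [hd]
  calc _ = ∫ x in Ioi (0 : ℝ), x ^ (((2 * n - 1 + 2 * k : ℕ)) : ℝ) * Real.exp (-x ^ (2 : ℝ)) := by
        refine integral_congr_ae (Eventually.of_forall fun x => ?_)
        simp only [smul_eq_mul]
        rw [← mul_assoc, ← pow_add]
        norm_cast
    _ = _ := by rw [h]; ring

lemma integral_coord_gaussian (n k : ℕ) [NeZero n] :
    ∫ x : Fin n → ℂ, ‖x 0‖ ^ (2 * k) * Real.exp (-‖(WithLp.toLp 2 x : Cn n)‖ ^ 2) =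
      Real.pi ^ n * k.factorial := by
  have h1 : ∀ x : Fin n → ℂ, ‖x 0‖ ^ (2 * k) * Real.exp (-‖(WithLp.toLp 2 x : Cn n)‖ ^ 2) =
      ∏ i, ((if i = 0 then ‖x i‖ ^ (2 * k) else 1) * Real.exp (-‖x i‖ ^ 2)) := by
    intro x
    rw [Finset.prod_mul_distrib, ← Real.exp_sum, EuclideanSpace.norm_sq_eq]
    simp
  simp_rw [h1]
  rw [integral_fintype_prod_volume_eq_prod
    (f := fun i (v : ℂ) => (if i = 0 then ‖v‖ ^ (2 * k) else 1) * Real.exp (-‖v‖ ^ 2))]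
  have h2 : ∀ i : Fin n, ∫ v : ℂ, (if i = 0 then ‖v‖ ^ (2 * k) else 1) * Real.exp (-‖v‖ ^ 2) =
      Real.pi * (if i = 0 then (k.factorial : ℝ) else 1) := by
    intro i
    split_ifs with hi
    · exact integral_complex_gaussian k
    · simpa using integral_complex_gaussian 0
  simp_rw [h2]
  rw [Finset.prod_mul_distrib]
  simp

/-- The Gaussian trick: |z₀|^(2k) e^(-|z|²) and |z|^(2k) e^(-|z|²) have the same radial part. The
first integral factors over coordinates and the second is one-dimensional, so their quotient is the
moment. -/
lemma integral_coord_pow (n k : ℕ) [NeZero n] :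
    ∫ ξ : unitSphere n, ‖(ξ : Cn n) 0‖ ^ (2 * k) ∂(sigma n) =
      ((n - 1 + k).choose (n - 1) : ℝ)⁻¹ := by
  obtain ⟨c, hc⟩ := exists_volume_eq n
  set J := ∫ r : Ioi (0 : ℝ), (r : ℝ) ^ (2 * k) * Real.exp (-(r : ℝ) ^ 2)
    ∂(Measure.volumeIoiPow (Module.finrank ℝ (Cn n) - 1)) with hJ
  set V := Module.finrank ℝ (Cn n) • (volume : Measure (Cn n)).real (Metric.ball 0 1) with hV
  have hVpos : 0 < V := by
    have h1 : 0 < (volume : Measure (Cn n)).real (Metric.ball 0 1) :=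
      ENNReal.toReal_pos (Metric.measure_ball_pos _ _ one_pos).ne' measure_ball_lt_top.ne
    exact smul_pos Module.finrank_pos h1
  have hVS : (volume : Measure (Cn n)).toSphere.real univ = V := by
    rw [Measure.toSphere_real_apply_univ, hV, nsmul_eq_mul]
  have e1 := integral_eq_sphere_mul_radial (n := n) (fun ξ => ‖(ξ : Cn n) 0‖ ^ (2 * k))
    (fun r => r ^ (2 * k) * Real.exp (-r ^ 2))
    (fun z => ‖z 0‖ ^ (2 * k) * Real.exp (-‖z‖ ^ 2)) (by
      intro ξ r hr
      have : ‖(ξ : Cn n)‖ = 1 := norm_eq_of_mem_sphere ξ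
      simp [norm_smul, abs_of_pos hr, this, mul_pow]
      ring)
  have e2 := integral_eq_sphere_mul_radial (n := n) (fun ξ => 1)
    (fun r => r ^ (2 * k) * Real.exp (-r ^ 2))
    (fun z => ‖z‖ ^ (2 * k) * Real.exp (-‖z‖ ^ 2)) (by
      intro ξ r hr
      have : ‖(ξ : Cn n)‖ = 1 := norm_eq_of_mem_sphere ξ
      simp [norm_smul, abs_of_pos hr, this])
  rw [integral_norm_gaussian, ← hJ, integral_const, smul_eq_mul, mul_one, hVS] at e2
  have hJv : J = (n - 1 + k).factorial / 2 := (mul_left_cancel₀ hVpos.ne' e2).symm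
  rw [hc, ← hJ] at e1
  simp only [integral_coord_gaussian] at e1
  -- The case k = 0 evaluates the same integral in both ways and determines the unknown constant c.
  have e3 := integral_norm_gaussian n 0
  have e4 := hc (fun z => ‖z‖ ^ (2 * 0) * Real.exp (-‖z‖ ^ 2))
  have e5 := integral_coord_gaussian n 0
  simp only [mul_zero, pow_zero, one_mul, add_zero, Nat.factorial_zero, Nat.cast_one,
    mul_one] at e3 e4 e5
  rw [e3, e5] at e4
  have hs : ∫ ξ : unitSphere n, ‖(ξ : Cn n) 0‖ ^ (2 * k) ∂(sigma n) =
      V⁻¹ * ∫ ξ : unitSphere n, ‖(ξ : Cn n) 0‖ ^ (2 * k) ∂(volume : Measure (Cn n)).toSphere := by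
    rw [sigma, integral_smul_measure, smul_eq_mul, ENNReal.toReal_inv, ← hVS]
    rfl
  rw [hs, Nat.choose_eq_factorial_div_factorial (by omega),
    Nat.cast_div (Nat.factorial_mul_factorial_dvd_factorial (by omega)) (by positivity)]
  have hk : n - 1 + k - (n - 1) = k := by omega
  rw [hk]
  have hJ0 : J ≠ 0 := by rw [hJv]; positivity
  set A := ∫ ξ : unitSphere n, ‖(ξ : Cn n) 0‖ ^ (2 * k) ∂(volume : Measure (Cn n)).toSphere
  have hA : V * ((n - 1).factorial / 2) * k.factorial = A * ((n - 1 + k).factorial / 2) := by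
    rw [← hJv, ← e1, hV, e4]; ring
  have : ((n - 1 + k).factorial : ℝ) ≠ 0 := by positivity
  have h3 : ((n - 1).factorial : ℝ) ≠ 0 := by positivity
  have h4 : (k.factorial : ℝ) ≠ 0 := by positivity
  push_cast
  field_simp
  linarith

lemma integral_inner_pow {n : ℕ} [NeZero n] (k : ℕ) {e : Cn n} (he : ‖e‖ = 1) :
    ∫ ξ : unitSphere n, ‖inner ℂ e (ξ : Cn n)‖ ^ (2 * k) ∂(sigma n) =
      ((n - 1 + k).choose (n - 1) : ℝ)⁻¹ := by
  obtain ⟨U, hU⟩ := exists_isometry_map he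
    (show ‖(EuclideanSpace.single 0 1 : Cn n)‖ = 1 by simp)
  rw [← integral_coord_pow n k,
    ← integral_sphereMap U fun ξ : unitSphere n => ‖(ξ : Cn n) 0‖ ^ (2 * k)]
  refine integral_congr_ae (Eventually.of_forall fun ξ => ?_)
  simp only
  have : inner ℂ e (ξ : Cn n) = (sphereMap U ξ : Cn n) 0 := by
    rw [← U.inner_map_map, hU, EuclideanSpace.inner_single_left]
    simp [sphereMap]
  rw [this]

/-! ### Cauchy's formula on the sphere -/

/-- The linear isometry which fixes a unit vector `e` and multiplies the orthogonal complement of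
`e` by the unimodular number `c`. -/
def complementRotation {n : ℕ} (e : Cn n) (he : ‖e‖ = 1) (c : ℂ) (hc : ‖c‖ = 1) :
    Cn n ≃ₗᵢ[ℂ] Cn n :=
  LinearIsometry.toLinearIsometryEquiv
    { toFun := fun z => inner ℂ e z • e + c • (z - inner ℂ e z • e)
      map_add' := fun x y => by
        rw [inner_add_right]
        module
      map_smul' := fun a x => by
        rw [inner_smul_right, RingHom.id_apply]
        module
      norm_map' := fun z => by
        change ‖inner ℂ e z • e + c • (z - inner ℂ e z • e)‖ = ‖z‖
        have hee : inner ℂ e e = (1 : ℂ) := by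
          rw [inner_self_eq_norm_sq_to_K, he]; simp
        have h0 : inner ℂ e (z - inner ℂ e z • e) = 0 := by
          rw [inner_sub_right, inner_smul_right, hee]; simp
        have h1 : inner ℂ (inner ℂ e z • e) (c • (z - inner ℂ e z • e)) = 0 := by
          rw [inner_smul_left, inner_smul_right, h0]; simp
        have h2 : inner ℂ (inner ℂ e z • e) (z - inner ℂ e z • e) = 0 := by
          rw [inner_smul_left, h0]; simp
        have e1 := norm_add_sq_eq_norm_sq_add_norm_sq_of_inner_eq_zero _ _ h1
        have e2 := norm_add_sq_eq_norm_sq_add_norm_sq_of_inner_eq_zero _ _ h2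
        rw [add_sub_cancel] at e2
        rw [norm_smul c, hc, one_mul] at e1
        rw [← e2] at e1
        exact (mul_self_inj (norm_nonneg _) (norm_nonneg _)).1 e1 } rfl

lemma complementRotation_apply {n : ℕ} (e : Cn n) (he : ‖e‖ = 1) (c : ℂ) (hc : ‖c‖ = 1)
    (z : Cn n) :
    complementRotation e he c hc z = inner ℂ e z • e + c • (z - inner ℂ e z • e) := rfl

lemma inner_complementRotation {n : ℕ} (e : Cn n) (he : ‖e‖ = 1) (c : ℂ) (hc : ‖c‖ = 1)
    (z : Cn n) : inner ℂ e (complementRotation e he c hc z) = inner ℂ e z := by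
  have hee : inner ℂ e e = (1 : ℂ) := by
    rw [inner_self_eq_norm_sq_to_K, he]; simp
  rw [complementRotation_apply, inner_add_right, inner_smul_right, inner_smul_right,
    inner_sub_right, inner_smul_right, hee]
  simp

/-- Multiplication by a unimodular number. -/
def scalarRotation (n : ℕ) (c : ℂ) (hc : ‖c‖ = 1) : Cn n ≃ₗᵢ[ℂ] Cn n :=
  LinearIsometry.toLinearIsometryEquiv
    { toFun := fun z => c • z
      map_add' := fun x y => smul_add _ _ _
      map_smul' := fun a x => smul_comm _ _ _
      norm_map' := fun z => by
        change ‖c • z‖ = ‖z‖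
        rw [norm_smul, hc, one_mul] } rfl

lemma norm_inner_sphere_le {n : ℕ} (e : Cn n) (ξ : unitSphere n) :
    ‖inner ℂ e (ξ : Cn n)‖ ≤ ‖e‖ := by
  have h := norm_inner_le_norm (𝕜 := ℂ) e (ξ : Cn n)
  rwa [norm_eq_of_mem_sphere ξ, mul_one] at h

lemma Continuous.integrable_sigma {n : ℕ} [NeZero n] {E : Type*} [NormedAddCommGroup E]
    {f : unitSphere n → E} (hf : Continuous f) : Integrable f (sigma n) := by
  rw [← integrableOn_univ]
  exact hf.continuousOn.integrableOn_compact isCompact_univ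

lemma integral_inner_pow_mul_conj {n : ℕ} [NeZero n] {e : Cn n} (he : ‖e‖ = 1) (k j : ℕ) :
    ∫ ξ : unitSphere n, (inner ℂ e (ξ : Cn n)) ^ k * (inner ℂ (ξ : Cn n) e) ^ j ∂(sigma n) =
      if j = k then ((n - 1 + k).choose (n - 1) : ℂ)⁻¹ else 0 := by
  split_ifs with h
  · subst h
    have h1 := integral_inner_pow j he
    have h2 : ∀ ξ : unitSphere n, (inner ℂ e (ξ : Cn n)) ^ j * (inner ℂ (ξ : Cn n) e) ^ j =
        ((‖inner ℂ e (ξ : Cn n)‖ ^ (2 * j) : ℝ) : ℂ) := by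
      intro ξ
      rw [← mul_pow, ← inner_conj_symm (ξ : Cn n) e, Complex.mul_conj, pow_mul,
        Complex.normSq_eq_norm_sq]
      push_cast
      rfl
    simp_rw [h2]
    rw [integral_complex_ofReal, h1]
    push_cast
    rfl
  -- The scalar rotation by c multiplies the integrand by c^k · conj(c)^j = e^(iπ) = -1, so the
  -- integral equals its own negative.
  · set c : ℂ := Complex.exp ((Real.pi / ((k : ℝ) - j) : ℝ) * Complex.I) with hc
    have hkj : ((k : ℂ) - j) ≠ 0 := sub_ne_zero.2 fun hh => h (by exact_mod_cast hh.symm)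
    have hc1 : ‖c‖ = 1 := Complex.norm_exp_ofReal_mul_I _
    have hcc : c ^ k * (starRingEnd ℂ c) ^ j = -1 := by
      rw [hc, ← Complex.exp_conj, ← Complex.exp_nat_mul, ← Complex.exp_nat_mul, ← Complex.exp_add,
        ← Complex.exp_pi_mul_I]
      congr 1
      rw [map_mul, Complex.conj_I, Complex.conj_ofReal]
      push_cast
      field_simp
      ring
    have h1 := integral_sphereMap (scalarRotation n c hc1)
      (fun ξ : unitSphere n => (inner ℂ e (ξ : Cn n)) ^ k * (inner ℂ (ξ : Cn n) e) ^ j)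
    have h2 : ∀ ξ : unitSphere n,
        (inner ℂ e (sphereMap (scalarRotation n c hc1) ξ : Cn n)) ^ k *
          (inner ℂ (sphereMap (scalarRotation n c hc1) ξ : Cn n) e) ^ j =
        -((inner ℂ e (ξ : Cn n)) ^ k * (inner ℂ (ξ : Cn n) e) ^ j) := by
      intro ξ
      have : (sphereMap (scalarRotation n c hc1) ξ : Cn n) = c • (ξ : Cn n) := rfl
      rw [this, inner_smul_left, inner_smul_right, mul_pow, mul_pow]
      linear_combination (inner ℂ e (ξ : Cn n)) ^ k * (inner ℂ (ξ : Cn n) e) ^ j * hcc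
    simp_rw [h2] at h1
    rw [integral_neg] at h1
    exact self_eq_neg.1 h1.symm

lemma one_sub_ne_zero_of_norm_lt {a : ℂ} (h : ‖a‖ < 1) : 1 - a ≠ 0 := by
  intro h0
  rw [← sub_eq_zero.1 h0] at h
  simp at h

lemma norm_smul_inner_lt {n : ℕ} {e : Cn n} (he : ‖e‖ = 1) {t : ℝ} (ht0 : 0 ≤ t) (ht : t < 1)
    (ξ : unitSphere n) : ‖(t : ℂ) * inner ℂ (ξ : Cn n) e‖ < 1 := by
  have h := norm_inner_sphere_le e ξ
  rw [norm_inner_symm, he] at h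
  rw [norm_mul, Complex.norm_real, Real.norm_of_nonneg ht0]
  nlinarith [norm_nonneg (inner ℂ (ξ : Cn n) e)]

/-- In the binomial series of the kernel, orthogonality leaves only the term j = k, whose
coefficient is the inverse of the moment. This is Cauchy's formula for monomials in one direction.
-/
lemma integral_inner_pow_mul_cauchy {n : ℕ} [NeZero n] {e : Cn n} (he : ‖e‖ = 1) {t : ℝ}
    (ht0 : 0 ≤ t) (ht : t < 1) (k : ℕ) :
    ∫ ξ : unitSphere n, (inner ℂ e (ξ : Cn n)) ^ k *
      (1 / (1 - t * inner ℂ (ξ : Cn n) e) ^ n) ∂(sigma n) = (t : ℂ) ^ k := by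
  have hn : n - 1 + 1 = n := Nat.sub_add_cancel NeZero.one_le
  have h1 : HasSum (fun j : ℕ => ∫ ξ : unitSphere n, (inner ℂ e (ξ : Cn n)) ^ k *
      (((j + (n - 1)).choose (n - 1) : ℂ) * (t * inner ℂ (ξ : Cn n) e) ^ j) ∂(sigma n))
      (∫ ξ : unitSphere n, (inner ℂ e (ξ : Cn n)) ^ k *
      (1 / (1 - t * inner ℂ (ξ : Cn n) e) ^ n) ∂(sigma n)) := by
    refine hasSum_integral_of_dominated_convergence
      (fun j _ => ((j + (n - 1)).choose (n - 1) : ℝ) * t ^ j) ?_ ?_ ?_ ?_ ?_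
    · intro j
      exact Continuous.aestronglyMeasurable (by fun_prop)
    · intro j
      refine Eventually.of_forall fun ξ => ?_
      have hb := norm_inner_sphere_le e ξ
      rw [he] at hb
      have hb' := hb
      rw [norm_inner_symm] at hb'
      rw [norm_mul, norm_mul, norm_pow, norm_pow, norm_mul, Complex.norm_real,
        Real.norm_of_nonneg ht0, Complex.norm_natCast]
      calc ‖inner ℂ e (ξ : Cn n)‖ ^ k * (((j + (n - 1)).choose (n - 1) : ℝ) *
            (t * ‖inner ℂ (ξ : Cn n) e‖) ^ j)
          ≤ 1 ^ k * (((j + (n - 1)).choose (n - 1) : ℝ) * (t * 1) ^ j) := by gcongr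
        _ = _ := by simp
    · refine Eventually.of_forall fun ξ => ?_
      exact (hasSum_choose_mul_geometric_of_norm_lt_one (n - 1) (r := t)
        (by rwa [Real.norm_of_nonneg ht0])).summable
    · exact integrable_const _
    · refine Eventually.of_forall fun ξ => ?_
      have h := hasSum_choose_mul_geometric_of_norm_lt_one (n - 1)
        (norm_smul_inner_lt he ht0 ht ξ)
      rw [hn] at h
      exact h.mul_left _
  have h2 : ∀ j : ℕ, ∫ ξ : unitSphere n, (inner ℂ e (ξ : Cn n)) ^ k *
      (((j + (n - 1)).choose (n - 1) : ℂ) * (t * inner ℂ (ξ : Cn n) e) ^ j) ∂(sigma n) =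
      if j = k then (t : ℂ) ^ k else 0 := by
    intro j
    have : ∀ ξ : unitSphere n, (inner ℂ e (ξ : Cn n)) ^ k *
      (((j + (n - 1)).choose (n - 1) : ℂ) * (t * inner ℂ (ξ : Cn n) e) ^ j) =
      (((j + (n - 1)).choose (n - 1) : ℂ) * t ^ j) *
        ((inner ℂ e (ξ : Cn n)) ^ k * (inner ℂ (ξ : Cn n) e) ^ j) := by
      intro ξ
      rw [mul_pow]; ring
    simp_rw [this]
    rw [integral_const_mul, integral_inner_pow_mul_conj he]
    split_ifs with h
    · subst h
      have : ((j + (n - 1)).choose (n - 1) : ℂ) ≠ 0 := by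
        exact_mod_cast (Nat.choose_pos (by omega)).ne'
      rw [add_comm (n - 1) j]
      field_simp
    · simp
  simp_rw [h2] at h1
  exact h1.unique (by simpa using hasSum_ite_eq k ((t : ℂ) ^ k))

/-- Rotations of the complement of e fix both σ and the factor K. Averaging f over them is a circle
mean of a holomorphic function of c, which equals its value at c = 0: f at the projection of ξ to
the line of e. -/
lemma integral_slice_mul {n : ℕ} [NeZero n] {r : ℝ} (hr : 1 < r) {f : Cn n → ℂ}
    (hf : DifferentiableOn ℂ f (Metric.ball 0 r)) {e : Cn n} (he : ‖e‖ = 1) {K : ℂ → ℂ}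
    (hK : Continuous fun ξ : unitSphere n => K (inner ℂ e (ξ : Cn n))) :
    ∫ ξ : unitSphere n, f ξ * K (inner ℂ e (ξ : Cn n)) ∂(sigma n) =
      ∫ ξ : unitSphere n, f (inner ℂ e (ξ : Cn n) • e) * K (inner ℂ e (ξ : Cn n)) ∂(sigma n) := by
  have hc1 : ∀ θ : ℝ, ‖circleMap 0 1 θ‖ = 1 := fun θ => by simp
  set G : ℝ → unitSphere n → ℂ := fun θ ξ =>
    f (complementRotation e he (circleMap 0 1 θ) (hc1 θ) ξ) * K (inner ℂ e (ξ : Cn n)) with hG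
  have hGc : Continuous (Function.uncurry G) := by
    refine Continuous.mul ?_ (hK.comp continuous_snd)
    refine hf.continuousOn.comp_continuous ?_ ?_
    · simp only [complementRotation_apply]
      have : Continuous (circleMap 0 1) := continuous_circleMap 0 1
      fun_prop
    · rintro ⟨θ, ξ⟩
      rw [mem_ball_zero_iff, LinearIsometryEquiv.norm_map, norm_eq_of_mem_sphere]
      exact hr
  have hrot : ∀ θ, ∫ ξ : unitSphere n, G θ ξ ∂(sigma n) =
      ∫ ξ : unitSphere n, f ξ * K (inner ℂ e (ξ : Cn n)) ∂(sigma n) := by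
    intro θ
    rw [← integral_sphereMap (complementRotation e he (circleMap 0 1 θ) (hc1 θ))
      fun ξ : unitSphere n => f ξ * K (inner ℂ e (ξ : Cn n))]
    refine integral_congr_ae (Eventually.of_forall fun ξ => ?_)
    simp only [hG, sphereMap, inner_complementRotation]
  have hmean : ∀ ξ : unitSphere n, ∫ θ in (0 : ℝ)..2 * Real.pi, G θ ξ =
      (2 * Real.pi) • (f (inner ℂ e (ξ : Cn n) • e) * K (inner ℂ e (ξ : Cn n))) := by
    intro ξ
    simp only [hG, intervalIntegral.integral_mul_const]
    rw [← smul_mul_assoc]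
    congr 1
    -- By Pythagoras, shrinking the orthogonal component keeps the point in the closed unit ball,
    -- where f is holomorphic because r > 1.
    have hball : ∀ c : ℂ, ‖c‖ ≤ 1 →
        inner ℂ e (ξ : Cn n) • e + c • ((ξ : Cn n) - inner ℂ e (ξ : Cn n) • e) ∈
          Metric.ball (0 : Cn n) r := by
      intro c hc
      rw [mem_ball_zero_iff]
      have h1 : inner ℂ e (ξ : Cn n) • e + c • ((ξ : Cn n) - inner ℂ e (ξ : Cn n) • e) =
        (1 - c) • (inner ℂ e (ξ : Cn n) • e) + c • (ξ : Cn n) := by module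
      refine lt_of_le_of_lt ?_ hr
      have hee : inner ℂ e e = (1 : ℂ) := by
        rw [inner_self_eq_norm_sq_to_K, he]; simp
      have h0 : inner ℂ e ((ξ : Cn n) - inner ℂ e (ξ : Cn n) • e) = 0 := by
        rw [inner_sub_right, inner_smul_right, hee]; simp
      have e1 := norm_add_sq_eq_norm_sq_add_norm_sq_of_inner_eq_zero (inner ℂ e (ξ : Cn n) • e)
        (c • ((ξ : Cn n) - inner ℂ e (ξ : Cn n) • e))
        (by rw [inner_smul_left, inner_smul_right, h0]; simp)
      have e2 := norm_add_sq_eq_norm_sq_add_norm_sq_of_inner_eq_zero (inner ℂ e (ξ : Cn n) • e)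
        ((ξ : Cn n) - inner ℂ e (ξ : Cn n) • e) (by rw [inner_smul_left, h0]; simp)
      rw [add_sub_cancel, norm_eq_of_mem_sphere ξ] at e2
      rw [norm_smul c] at e1
      have h3 : ‖c‖ * ‖(ξ : Cn n) - inner ℂ e (ξ : Cn n) • e‖ ≤
          ‖(ξ : Cn n) - inner ℂ e (ξ : Cn n) • e‖ :=
        mul_le_of_le_one_left (norm_nonneg _) hc
      have h4 := mul_self_le_mul_self (by positivity) h3
      nlinarith [norm_nonneg
        (inner ℂ e (ξ : Cn n) • e + c • ((ξ : Cn n) - inner ℂ e (ξ : Cn n) • e))]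
    have hd : DiffContOnCl ℂ (fun c : ℂ => f (inner ℂ e (ξ : Cn n) • e +
        c • ((ξ : Cn n) - inner ℂ e (ξ : Cn n) • e))) (Metric.ball 0 |1|) := by
      refine DifferentiableOn.diffContOnCl ?_
      rw [abs_one, closure_ball _ one_ne_zero]
      refine hf.comp (by fun_prop) fun c hc => hball c (by simpa using hc)
    have := hd.circleAverage
    rw [Real.circleAverage_def, zero_smul, add_zero] at this
    rw [← this, smul_smul, mul_inv_cancel₀ (by positivity), one_smul]
    rfl
  have hpi : (0 : ℝ) ≤ 2 * Real.pi := by positivity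
  have hswap : ∫ θ in (0 : ℝ)..2 * Real.pi, (∫ ξ : unitSphere n, G θ ξ ∂(sigma n)) =
      ∫ ξ : unitSphere n, (∫ θ in (0 : ℝ)..2 * Real.pi, G θ ξ) ∂(sigma n) := by
    simp_rw [intervalIntegral.integral_of_le hpi]
    refine integral_integral_swap ?_
    have h1 : IntegrableOn (Function.uncurry G) (Icc (0 : ℝ) (2 * Real.pi) ×ˢ univ)
        (volume.prod (sigma n)) :=
      hGc.continuousOn.integrableOn_compact (isCompact_Icc.prod isCompact_univ)
    have h2 := h1.mono_set (prod_mono (Ioc_subset_Icc_self (a := (0 : ℝ))) (subset_refl univ))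
    rwa [IntegrableOn, ← Measure.prod_restrict, Measure.restrict_univ] at h2
  simp_rw [hrot, hmean] at hswap
  rw [integral_smul, intervalIntegral.integral_const, sub_zero] at hswap
  exact smul_right_injective ℂ (by positivity : 2 * Real.pi ≠ 0) hswap

lemma integral_disc_mul_cauchy {n : ℕ} [NeZero n] {r : ℝ} (hr : 1 < r) {g : ℂ → ℂ}
    (hg : DifferentiableOn ℂ g (Metric.ball 0 r)) {e : Cn n} (he : ‖e‖ = 1) {t : ℝ}
    (ht0 : 0 ≤ t) (ht : t < 1) :
    ∫ ξ : unitSphere n, g (inner ℂ e (ξ : Cn n)) *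
      (1 / (1 - t * inner ℂ (ξ : Cn n) e) ^ n) ∂(sigma n) = g t := by
  -- A radius s > 1 of convergence makes the Taylor coefficients absolutely summable, which
  -- dominates the series on the whole sphere.
  obtain ⟨s, hs1, hsr⟩ := exists_between hr
  lift s to NNReal using by linarith
  have hps : HasFPowerSeriesOnBall g (cauchyPowerSeries g 0 s) 0 s :=
    (hg.mono (Metric.closedBall_subset_ball hsr)).hasFPowerSeriesOnBall
      (by exact_mod_cast lt_trans one_pos hs1)
  set P := cauchyPowerSeries g 0 s with hP
  have hsum : ∀ a : ℂ, ‖a‖ ≤ 1 → HasSum (fun k : ℕ => P.coeff k * a ^ k) (g a) := by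
    intro a ha
    have h := hps.hasSum (y := a) (by
      rw [Metric.mem_eball, edist_zero_right]
      have : ‖a‖₊ < s := by
        rw [← NNReal.coe_lt_coe]
        exact lt_of_le_of_lt ha hs1
      exact_mod_cast this)
    simp only [FormalMultilinearSeries.apply_eq_pow_smul_coeff, zero_add, smul_eq_mul] at h
    simpa only [mul_comm] using h
  have hsn : Summable fun k => ‖P.coeff k‖ := by
    have h := P.summable_norm_mul_pow (r := 1) (lt_of_lt_of_le (by exact_mod_cast hs1) hps.r_le)
    simpa [FormalMultilinearSeries.norm_apply_eq_norm_coef] using h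
  have hcont : Continuous fun ξ : unitSphere n => 1 / (1 - t * inner ℂ (ξ : Cn n) e) ^ n := by
    refine continuous_const.div (by fun_prop) fun ξ => ?_
    exact pow_ne_zero _ (one_sub_ne_zero_of_norm_lt (norm_smul_inner_lt he ht0 ht ξ))
  obtain ⟨C, hC⟩ : ∃ C, ∀ ξ : unitSphere n, ‖1 / (1 - t * inner ℂ (ξ : Cn n) e) ^ n‖ ≤ C := by
    obtain ⟨C, hC⟩ := isCompact_univ.exists_bound_of_continuousOn hcont.continuousOn
    exact ⟨C, fun ξ => hC ξ (mem_univ _)⟩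
  have hXle : ∀ ξ : unitSphere n, ‖inner ℂ e (ξ : Cn n)‖ ≤ 1 := fun ξ =>
    (norm_inner_sphere_le e ξ).trans_eq he
  have h1 : HasSum (fun k : ℕ => ∫ ξ : unitSphere n, P.coeff k * (inner ℂ e (ξ : Cn n)) ^ k *
      (1 / (1 - t * inner ℂ (ξ : Cn n) e) ^ n) ∂(sigma n))
      (∫ ξ : unitSphere n, g (inner ℂ e (ξ : Cn n)) *
      (1 / (1 - t * inner ℂ (ξ : Cn n) e) ^ n) ∂(sigma n)) := by
    refine hasSum_integral_of_dominated_convergence (fun k _ => ‖P.coeff k‖ * C) ?_ ?_ ?_ ?_ ?_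
    · intro k
      exact Continuous.aestronglyMeasurable (by fun_prop)
    · intro k
      refine Eventually.of_forall fun ξ => ?_
      rw [norm_mul, norm_mul, norm_pow]
      calc ‖P.coeff k‖ * ‖inner ℂ e (ξ : Cn n)‖ ^ k *
            ‖1 / (1 - t * inner ℂ (ξ : Cn n) e) ^ n‖
          ≤ ‖P.coeff k‖ * 1 ^ k * C := by
            gcongr
            · exact hXle ξ
            · exact hC ξ
        _ = _ := by simp
    · exact Eventually.of_forall fun ξ => hsn.mul_right _
    · exact integrable_const _
    · exact Eventually.of_forall fun ξ => (hsum _ (hXle ξ)).mul_right _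
  have h2 : ∀ k : ℕ, ∫ ξ : unitSphere n, P.coeff k * (inner ℂ e (ξ : Cn n)) ^ k *
      (1 / (1 - t * inner ℂ (ξ : Cn n) e) ^ n) ∂(sigma n) = P.coeff k * (t : ℂ) ^ k := by
    intro k
    simp_rw [mul_assoc]
    rw [integral_const_mul, integral_inner_pow_mul_cauchy he ht0 ht]
  simp_rw [h2] at h1
  refine h1.unique (hsum t ?_)
  rw [Complex.norm_real, Real.norm_of_nonneg ht0]
  exact ht.le

/-- Cauchy's formula for the ball. -/
theorem cauchy_formula {n : ℕ} [NeZero n] {r : ℝ} (hr : 1 < r) {f : Cn n → ℂ}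
    (hf : DifferentiableOn ℂ f (Metric.ball 0 r)) {w : Cn n} (hw : ‖w‖ < 1) :
    ∫ ξ : unitSphere n, f ξ * (1 / (1 - inner ℂ (ξ : Cn n) w) ^ n) ∂(sigma n) = f w := by
  obtain ⟨e, he, hwe⟩ : ∃ e : Cn n, ‖e‖ = 1 ∧ w = (‖w‖ : ℂ) • e := by
    by_cases h : w = 0
    · exact ⟨EuclideanSpace.single 0 1, by simp, by simp [h]⟩
    · have : (‖w‖ : ℂ) ≠ 0 := by simpa using h
      refine ⟨(‖w‖ : ℂ)⁻¹ • w, ?_, ?_⟩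
      · rw [norm_smul, norm_inv, Complex.norm_real, norm_norm, inv_mul_cancel₀ (by simpa using h)]
      · rw [smul_smul, mul_inv_cancel₀ this, one_smul]
  have ht0 := norm_nonneg w
  generalize ‖w‖ = t at hw hwe ht0
  subst hwe
  have h1 : ∀ ξ : unitSphere n, f ξ * (1 / (1 - inner ℂ (ξ : Cn n) ((t : ℂ) • e)) ^ n) =
      f ξ * (fun a : ℂ => 1 / (1 - t * (starRingEnd ℂ) a) ^ n) (inner ℂ e (ξ : Cn n)) := by
    intro ξ
    rw [inner_smul_right]
    simp only [inner_conj_symm]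
  simp_rw [h1]
  -- The kernel sees ξ only through its component along e, so f may be replaced by its restriction
  -- to the complex line through w.
  rw [integral_slice_mul hr hf he (K := fun a : ℂ => 1 / (1 - t * (starRingEnd ℂ) a) ^ n)]
  · simp only [inner_conj_symm]
    refine integral_disc_mul_cauchy hr (g := fun a => f (a • e)) ?_ he ht0 hw
    refine hf.comp (by fun_prop) fun a ha => ?_
    simpa [norm_smul, he] using ha
  · simp only [inner_conj_symm]
    refine continuous_const.div (by fun_prop) fun ξ => ?_
    exact pow_ne_zero _ (one_sub_ne_zero_of_norm_lt (norm_smul_inner_lt he ht0 hw ξ))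

/-! ### Poisson integrals, integral means and point evaluations -/

/-- The invariant Poisson kernel of the ball. -/
def poissonKernel {n : ℕ} (z ξ : Cn n) : ℝ :=
  (1 - ‖z‖ ^ 2) ^ n / ‖1 - inner ℂ ξ z‖ ^ (2 * n)

lemma one_sub_norm_le {n : ℕ} (z ξ : Cn n) (hξ : ‖ξ‖ ≤ 1) : 1 - ‖z‖ ≤ ‖1 - inner ℂ ξ z‖ := by
  have h1 := norm_inner_le_norm (𝕜 := ℂ) ξ z
  have h2 := norm_sub_norm_le (1 : ℂ) (inner ℂ ξ z)
  rw [norm_one] at h2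
  nlinarith [norm_nonneg z, norm_nonneg ξ]

lemma norm_one_sub_inner_pos {n : ℕ} {z ξ : Cn n} (hz : ‖z‖ < 1) (hξ : ‖ξ‖ ≤ 1) :
    0 < ‖1 - inner ℂ ξ z‖ :=
  lt_of_lt_of_le (by linarith) (one_sub_norm_le z ξ hξ)

lemma poissonKernel_nonneg {n : ℕ} {z ξ : Cn n} (hz : ‖z‖ < 1) : 0 ≤ poissonKernel z ξ := by
  refine div_nonneg (pow_nonneg ?_ _) (by positivity)
  nlinarith [norm_nonneg z]

lemma continuous_poissonKernel {n : ℕ} {z : Cn n} (hz : ‖z‖ < 1) :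
    Continuous fun ξ : unitSphere n => poissonKernel z ξ := by
  refine continuous_const.div (by fun_prop) fun ξ => ?_
  exact (pow_pos (norm_one_sub_inner_pos hz (norm_eq_of_mem_sphere ξ).le) _).ne'

/-- Cauchy's formula at z is applied to f(w)/(1-⟨w,z⟩)^n. On the sphere the extra factor is
conjugate to the Cauchy kernel, so their product is |1-⟨z,ξ⟩|^(-2n), and at w = z it contributes
(1-|z|²)^(-n). -/
theorem poisson_formula {n : ℕ} [NeZero n] {r : ℝ} (hr : 1 < r) {f : Cn n → ℂ}
    (hf : DifferentiableOn ℂ f (Metric.ball 0 r)) {z : Cn n} (hz : ‖z‖ < 1) :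
    ∫ ξ : unitSphere n, (poissonKernel z ξ : ℂ) * f ξ ∂(sigma n) = f z := by
  have hz0 := norm_nonneg z
  -- The radius exceeds 1 but still satisfies ‖z‖ · r' < 1, which keeps the zeros of 1-⟨w,z⟩ outside
  -- the ball.
  set r' := min r (2 / (1 + ‖z‖)) with hr'
  have hr1 : 1 < r' := lt_min hr (by rw [lt_div_iff₀ (by linarith)]; linarith)
  have hne : ∀ w : Cn n, ‖w‖ < r' → 1 - inner ℂ z w ≠ 0 := by
    intro w hw
    refine one_sub_ne_zero_of_norm_lt ((norm_inner_le_norm z w).trans_lt ?_)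
    have h2 : ‖w‖ < 2 / (1 + ‖z‖) := hw.trans_le (min_le_right _ _)
    rw [lt_div_iff₀ (by linarith)] at h2
    nlinarith [norm_nonneg w]
  have hh : DifferentiableOn ℂ (fun w => f w * (1 / (1 - inner ℂ z w) ^ n))
      (Metric.ball 0 r') := by
    refine (hf.mono (Metric.ball_subset_ball (min_le_left _ _))).mul ?_
    have h1 : Differentiable ℂ fun w : Cn n => (1 - inner ℂ z w) ^ n :=
      ((differentiable_const _).sub (innerSL ℂ z).differentiable).pow n
    simp only [one_div]
    exact h1.differentiableOn.fun_inv
      fun w hw => pow_ne_zero _ (hne w (mem_ball_zero_iff.1 hw))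
  have h := cauchy_formula hr1 hh hz
  have hzz : (1 - inner ℂ z z : ℂ) = ((1 - ‖z‖ ^ 2 : ℝ) : ℂ) := by
    rw [inner_self_eq_norm_sq_to_K]
    push_cast
    rfl
  have hpos : (0 : ℝ) < 1 - ‖z‖ ^ 2 := by nlinarith
  have hne0 : ((1 - ‖z‖ ^ 2 : ℝ) : ℂ) ^ n ≠ 0 :=
    pow_ne_zero _ (by exact_mod_cast hpos.ne')
  rw [hzz] at h
  calc _ = ((1 - ‖z‖ ^ 2 : ℝ) : ℂ) ^ n *
        ∫ ξ : unitSphere n, f ξ * (1 / (1 - inner ℂ z (ξ : Cn n)) ^ n) *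
        (1 / (1 - inner ℂ (ξ : Cn n) z) ^ n) ∂(sigma n) := by
        rw [← integral_const_mul]
        refine integral_congr_ae (Eventually.of_forall fun ξ => ?_)
        simp only [poissonKernel]
        have h1 : ((‖1 - inner ℂ (ξ : Cn n) z‖ ^ (2 * n) : ℝ) : ℂ) =
            (1 - inner ℂ z (ξ : Cn n)) ^ n * (1 - inner ℂ (ξ : Cn n) z) ^ n := by
          rw [pow_mul, ← Complex.normSq_eq_norm_sq, ← mul_pow, ← inner_conj_symm z (ξ : Cn n)]
          push_cast
          rw [← Complex.mul_conj, mul_comm]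
          simp
        rw [Complex.ofReal_div, h1]
        push_cast
        rw [div_eq_mul_inv, mul_inv]
        ring
    _ = _ := by
        rw [h, one_div, mul_comm, mul_assoc, inv_mul_cancel₀ hne0, mul_one]

lemma integral_poissonKernel {n : ℕ} [NeZero n] {z : Cn n} (hz : ‖z‖ < 1) :
    ∫ ξ : unitSphere n, poissonKernel z ξ ∂(sigma n) = 1 := by
  have h := poisson_formula one_lt_two (f := fun _ : Cn n => (1 : ℂ)) (differentiableOn_const _) hz
  simp only [mul_one] at h
  rw [integral_complex_ofReal] at h
  exact_mod_cast h

lemma lintegral_poissonKernel {n : ℕ} [NeZero n] {z : Cn n} (hz : ‖z‖ < 1) :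
    ∫⁻ ξ : unitSphere n, ENNReal.ofReal (poissonKernel z ξ) ∂(sigma n) = 1 := by
  rw [← ofReal_integral_eq_lintegral_ofReal (Continuous.integrable_sigma
    (continuous_poissonKernel hz)) (Eventually.of_forall fun ξ => poissonKernel_nonneg hz),
    integral_poissonKernel hz, ENNReal.ofReal_one]

lemma enorm_le_poisson {n : ℕ} [NeZero n] {r : ℝ} (hr : 1 < r) {f : Cn n → ℂ}
    (hf : DifferentiableOn ℂ f (Metric.ball 0 r)) {z : Cn n} (hz : ‖z‖ < 1) :
    ‖f z‖ₑ ≤ ∫⁻ ξ : unitSphere n, ENNReal.ofReal (poissonKernel z ξ) * ‖f ξ‖ₑ ∂(sigma n) := by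
  rw [← poisson_formula hr hf hz]
  refine (enorm_integral_le_lintegral_enorm _).trans (lintegral_mono fun ξ => ?_)
  rw [enorm_mul, ← ofReal_norm (poissonKernel z ξ : ℂ), Complex.norm_real,
    Real.norm_of_nonneg (poissonKernel_nonneg hz)]

lemma differentiableOn_dilate {n : ℕ} {f : Cn n → ℂ} (hf : DifferentiableOn ℂ f (unitBall n))
    {ρ : ℝ} (hρ : 0 < ρ) : DifferentiableOn ℂ (fun z => f (ρ • z)) (Metric.ball 0 ρ⁻¹) := by
  refine hf.comp ?_ fun z hz => ?_
  · have : Differentiable ℂ fun z : Cn n => ρ • z := differentiable_id.const_smul ρ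
    exact this.differentiableOn
  · rw [mem_ball_zero_iff] at hz ⊢
    rw [norm_smul, Real.norm_of_nonneg hρ.le]
    calc ρ * ‖z‖ < ρ * ρ⁻¹ := by gcongr
      _ = 1 := mul_inv_cancel₀ hρ.ne'

lemma lintegral_rpow_le_of_prob {α : Type*} [MeasurableSpace α] {ν : Measure α}
    [IsProbabilityMeasure ν] {q : ℝ} (hq : 1 ≤ q) {g : α → ℝ≥0∞} (hg : AEMeasurable g ν) :
    (∫⁻ x, g x ∂ν) ^ q ≤ ∫⁻ x, g x ^ q ∂ν := by
  have h := eLpNorm'_le_eLpNorm'_of_exponent_le one_pos hq ν hg.aestronglyMeasurable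
  simp only [eLpNorm', enorm_eq_self, ENNReal.rpow_one, div_one] at h
  calc (∫⁻ x, g x ∂ν) ^ q ≤ ((∫⁻ x, g x ^ q ∂ν) ^ (1 / q)) ^ q :=
        ENNReal.rpow_le_rpow h (by linarith)
    _ = _ := by
        rw [← ENNReal.rpow_mul, one_div, inv_mul_cancel₀ (by linarith), ENNReal.rpow_one]

lemma measurable_ofReal_poissonKernel {n : ℕ} {z : Cn n} (hz : ‖z‖ < 1) :
    Measurable fun ξ : unitSphere n => ENNReal.ofReal (poissonKernel z ξ) :=
  (continuous_poissonKernel hz).measurable.ennreal_ofReal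

/-- Jensen's inequality for the probability measure with density P(z,·). -/
lemma poisson_rpow_le {n : ℕ} [NeZero n] {q : ℝ} (hq : 1 ≤ q) {z : Cn n} (hz : ‖z‖ < 1)
    {g : unitSphere n → ℝ≥0∞} (hg : Measurable g) :
    (∫⁻ ξ : unitSphere n, ENNReal.ofReal (poissonKernel z ξ) * g ξ ∂(sigma n)) ^ q ≤
      ∫⁻ ξ : unitSphere n, ENNReal.ofReal (poissonKernel z ξ) * g ξ ^ q ∂(sigma n) := by
  have hm := measurable_ofReal_poissonKernel hz
  have : IsProbabilityMeasure
      ((sigma n).withDensity fun ξ => ENNReal.ofReal (poissonKernel z ξ)) := by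
    constructor
    rw [withDensity_apply _ MeasurableSet.univ, Measure.restrict_univ, lintegral_poissonKernel hz]
  have h := lintegral_rpow_le_of_prob
    (ν := (sigma n).withDensity fun ξ => ENNReal.ofReal (poissonKernel z ξ)) hq hg.aemeasurable
  rwa [lintegral_withDensity_eq_lintegral_mul _ hm hg,
    lintegral_withDensity_eq_lintegral_mul _ hm (hg.pow_const q)] at h

/-- The integral mean of order `q` over the sphere of radius `r`. -/
def hardyMean {n : ℕ} (q : ℝ) (f : Cn n → ℂ) (r : ℝ) : ℝ≥0∞ :=
  ∫⁻ ξ : unitSphere n, ‖f (r • (ξ : Cn n))‖ₑ ^ q ∂(sigma n)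

lemma poissonKernel_smul_comm {n : ℕ} (u : ℝ) (ξ ζ : unitSphere n) :
    poissonKernel (u • (ξ : Cn n)) ζ = poissonKernel (u • (ζ : Cn n)) ξ := by
  have hr : ∀ x y : Cn n, inner ℂ x (u • y) = (u : ℂ) * inner ℂ x y := fun x y => by
    rw [← inner_smul_right]; rfl
  have h : ‖1 - inner ℂ (ζ : Cn n) (u • (ξ : Cn n))‖ =
      ‖1 - inner ℂ (ξ : Cn n) (u • (ζ : Cn n))‖ := by
    rw [hr, hr, ← Complex.norm_conj, map_sub, map_mul, inner_conj_symm]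
    simp
  unfold poissonKernel
  rw [h, norm_smul, norm_smul, norm_eq_of_mem_sphere, norm_eq_of_mem_sphere]

lemma norm_smul_sphere {n : ℕ} {u : ℝ} (hu : 0 ≤ u) (ξ : unitSphere n) :
    ‖u • (ξ : Cn n)‖ = u := by
  rw [norm_smul, norm_eq_of_mem_sphere, mul_one, Real.norm_of_nonneg hu]

lemma measurable_poissonKernel_uncurry {n : ℕ} (u : ℝ) :
    Measurable fun x : unitSphere n × unitSphere n =>
      ENNReal.ofReal (poissonKernel (u • (x.1 : Cn n)) x.2) := by
  refine Measurable.ennreal_ofReal (Measurable.div ?_ ?_)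
  · exact Continuous.measurable (by fun_prop)
  · exact Continuous.measurable (by fun_prop)

/-- Subharmonicity of |f|^q: bound it by its Poisson integral and exchange the integrals. By the
symmetry P(uξ,ζ) = P(uζ,ξ) the inner integral is again one. -/
lemma lintegral_dilate_le {n : ℕ} [NeZero n] {q r : ℝ} (hq : 1 ≤ q) (hr : 1 < r) {f : Cn n → ℂ}
    (hf : DifferentiableOn ℂ f (Metric.ball 0 r)) {u : ℝ} (hu0 : 0 ≤ u) (hu : u < 1) :
    ∫⁻ ξ : unitSphere n, ‖f (u • (ξ : Cn n))‖ₑ ^ q ∂(sigma n) ≤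
      ∫⁻ ξ : unitSphere n, ‖f ξ‖ₑ ^ q ∂(sigma n) := by
  have hfc : Continuous fun ξ : unitSphere n => f ξ :=
    hf.continuousOn.comp_continuous continuous_subtype_val fun ξ => by
      rw [mem_ball_zero_iff, norm_eq_of_mem_sphere]; exact hr
  have hfm : Measurable fun ξ : unitSphere n => ‖f ξ‖ₑ := hfc.enorm.measurable
  calc ∫⁻ ξ : unitSphere n, ‖f (u • (ξ : Cn n))‖ₑ ^ q ∂(sigma n)
      ≤ ∫⁻ ξ : unitSphere n, ∫⁻ ζ : unitSphere n,
          ENNReal.ofReal (poissonKernel (u • (ξ : Cn n)) ζ) * ‖f ζ‖ₑ ^ q ∂(sigma n) ∂(sigma n) := by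
        refine lintegral_mono fun ξ => ?_
        have hz : ‖u • (ξ : Cn n)‖ < 1 := by rwa [norm_smul_sphere hu0]
        exact (ENNReal.rpow_le_rpow (enorm_le_poisson hr hf hz) (by linarith)).trans
          (poisson_rpow_le hq hz hfm)
    _ = ∫⁻ ζ : unitSphere n, ∫⁻ ξ : unitSphere n,
          ENNReal.ofReal (poissonKernel (u • (ξ : Cn n)) ζ) * ‖f ζ‖ₑ ^ q ∂(sigma n) ∂(sigma n) := by
        refine lintegral_lintegral_swap (Measurable.aemeasurable ?_)
        exact (measurable_poissonKernel_uncurry u).mul ((hfm.comp measurable_snd).pow_const q)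
    _ = _ := by
        refine lintegral_congr fun ζ => ?_
        have hz : ‖u • (ζ : Cn n)‖ < 1 := by rwa [norm_smul_sphere hu0]
        simp_rw [poissonKernel_smul_comm u _ ζ]
        rw [lintegral_mul_const _ (measurable_ofReal_poissonKernel hz), lintegral_poissonKernel hz,
          one_mul]

lemma hardyMean_mono {n : ℕ} [NeZero n] {q : ℝ} (hq : 1 ≤ q) {f : Cn n → ℂ}
    (hf : DifferentiableOn ℂ f (unitBall n)) {s r : ℝ} (hs : 0 ≤ s) (hsr : s ≤ r) (hr : r < 1) :
    hardyMean q f s ≤ hardyMean q f r := by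
  rcases hsr.eq_or_lt with rfl | hlt
  · exact le_rfl
  have hr0 : 0 < r := hs.trans_lt hlt
  have h := lintegral_dilate_le hq ((one_lt_inv₀ hr0).2 hr) (differentiableOn_dilate hf hr0)
    (u := s / r) (by positivity) ((div_lt_one hr0).2 hlt)
  simp only [smul_smul, mul_div_cancel₀ s hr0.ne'] at h
  exact h

lemma eLpNorm_dilate {n : ℕ} {p : ℝ} (hp : 1 ≤ p) (f : Cn n → ℂ) (r : ℝ) :
    eLpNorm (fun ξ : unitSphere n => f (r • (ξ : Cn n))) (ENNReal.ofReal p) (sigma n) =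
      hardyMean p f r ^ (1 / p) := by
  rw [eLpNorm_eq_lintegral_rpow_enorm_toReal (by simp; linarith) ENNReal.ofReal_ne_top,
    ENNReal.toReal_ofReal (by linarith)]
  rfl

lemma hardyMean_le {n : ℕ} {p : ℝ} (hp : 1 ≤ p) (f : Cn n → ℂ) {r : ℝ} (hr : r ∈ Ioo (0 : ℝ) 1) :
    hardyMean p f r ≤ hardyENorm p f ^ p := by
  have h : hardyMean p f r ^ (1 / p) ≤ hardyENorm p f := by
    rw [← eLpNorm_dilate hp]
    exact le_iSup₂_of_le r hr le_rfl
  have h2 := ENNReal.rpow_le_rpow h (by linarith : 0 ≤ p)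
  rwa [← ENNReal.rpow_mul, one_div, inv_mul_cancel₀ (by linarith), ENNReal.rpow_one] at h2

lemma hardyENorm_rpow_le {n : ℕ} {p : ℝ} (hp : 1 ≤ p) (f : Cn n → ℂ) {C : ℝ≥0∞}
    (h : ∀ r ∈ Ioo (0 : ℝ) 1, hardyMean p f r ≤ C) : hardyENorm p f ^ p ≤ C := by
  have h1 : hardyENorm p f ≤ C ^ (1 / p) := by
    refine iSup₂_le fun r hr => ?_
    rw [eLpNorm_dilate hp]
    exact ENNReal.rpow_le_rpow (h r hr) (by positivity)
  have h2 := ENNReal.rpow_le_rpow h1 (by linarith : 0 ≤ p)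
  rwa [← ENNReal.rpow_mul, one_div, inv_mul_cancel₀ (by linarith), ENNReal.rpow_one] at h2

lemma poissonKernel_le {n : ℕ} {z ξ : Cn n} (hz : ‖z‖ < 1) (hξ : ‖ξ‖ ≤ 1) :
    poissonKernel z ξ ≤ (2 / (1 - ‖z‖)) ^ n := by
  have h0 : 0 < 1 - ‖z‖ := by linarith
  have h1 := one_sub_norm_le z ξ hξ
  have hz0 := norm_nonneg z
  rw [poissonKernel, pow_mul, ← div_pow]
  refine pow_le_pow_left₀ (div_nonneg (by nlinarith) (by positivity)) ?_ _
  rw [div_le_div_iff₀ (pow_pos (norm_one_sub_inner_pos hz hξ) 2) h0]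
  have : (1 - ‖z‖) ^ 2 ≤ ‖1 - inner ℂ ξ z‖ ^ 2 := pow_le_pow_left₀ h0.le h1 2
  nlinarith

/-- The Poisson integral is taken over the sphere of radius ρ = (1+|z|)/2. The kernel at z/ρ is at
most (4/(1-|z|))^n. -/
lemma point_evaluation {n : ℕ} [NeZero n] {q : ℝ} (hq : 1 ≤ q) {f : Cn n → ℂ}
    (hf : DifferentiableOn ℂ f (unitBall n)) {z : Cn n} (hz : ‖z‖ < 1) :
    ‖f z‖ₑ ^ q ≤ ENNReal.ofReal ((4 / (1 - ‖z‖)) ^ n) * hardyENorm q f ^ q := by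
  have hz0 := norm_nonneg z
  set ρ := (1 + ‖z‖) / 2 with hρ
  have hρ0 : 0 < ρ := by positivity
  have hρ1 : ρ < 1 := by rw [hρ]; linarith
  have hzρ : z = ρ • (ρ⁻¹ • z) := by rw [smul_smul, mul_inv_cancel₀ hρ0.ne', one_smul]
  have hn : ‖ρ⁻¹ • z‖ = ‖z‖ / ρ := by
    rw [norm_smul, norm_inv, Real.norm_of_nonneg hρ0.le, inv_mul_eq_div]
  have hn1 : ‖ρ⁻¹ • z‖ < 1 := by rw [hn, div_lt_one hρ0, hρ]; linarith
  have hfd := differentiableOn_dilate hf hρ0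
  have hρi : 1 < ρ⁻¹ := (one_lt_inv₀ hρ0).2 hρ1
  have hm : Measurable fun ξ : unitSphere n => ‖f (ρ • (ξ : Cn n))‖ₑ :=
    (continuous_dilate hf ⟨hρ0, hρ1⟩).enorm.measurable
  have h1 : ‖f z‖ₑ ^ q ≤ ∫⁻ ξ : unitSphere n, ENNReal.ofReal (poissonKernel (ρ⁻¹ • z) ξ) *
      ‖f (ρ • (ξ : Cn n))‖ₑ ^ q ∂(sigma n) := by
    have h := enorm_le_poisson hρi hfd hn1
    rw [← hzρ] at h
    exact (ENNReal.rpow_le_rpow h (by linarith)).trans (poisson_rpow_le hq hn1 hm)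
  refine h1.trans ?_
  calc _ ≤ ∫⁻ ξ : unitSphere n, ENNReal.ofReal ((4 / (1 - ‖z‖)) ^ n) *
      ‖f (ρ • (ξ : Cn n))‖ₑ ^ q ∂(sigma n) := by
        refine lintegral_mono fun ξ => mul_le_mul_left (ENNReal.ofReal_le_ofReal ?_) _
        refine (poissonKernel_le hn1 (norm_eq_of_mem_sphere ξ).le).trans ?_
        refine pow_le_pow_left₀ (div_nonneg zero_le_two (by linarith)) ?_ _
        rw [div_le_div_iff₀ (by linarith) (by linarith), hn, hρ]
        have : 0 < 1 + ‖z‖ := by linarith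
        have h3 : 4 * (1 - ‖z‖ / ((1 + ‖z‖) / 2)) = 4 * (1 - ‖z‖) / (1 + ‖z‖) := by
          field_simp; ring
        rw [h3, le_div_iff₀ this]
        nlinarith
    _ = ENNReal.ofReal ((4 / (1 - ‖z‖)) ^ n) * hardyMean q f ρ := by
        rw [lintegral_const_mul _ (hm.pow_const q)]
        rfl
    _ ≤ _ := by
        gcongr
        exact hardyMean_le hq f ⟨hρ0, hρ1⟩

/-! ### Nonisotropic caps and the weak type inequality -/

/-- The nonisotropic quasi-triangle inequality, through a point of the sphere. -/
lemma norm_one_sub_inner_le {n : ℕ} {a c ζ : Cn n} (ha : ‖a‖ ≤ 1) (hc : ‖c‖ ≤ 1) (hζ : ‖ζ‖ = 1)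
    {t₁ t₂ : ℝ} (h1 : ‖1 - inner ℂ ζ a‖ ≤ t₁) (h2 : ‖1 - inner ℂ ζ c‖ ≤ t₂) (ht : t₁ ≤ 2 * t₂) :
    ‖1 - inner ℂ c a‖ ≤ 6 * t₂ := by
  have hζζ : inner ℂ ζ ζ = (1 : ℂ) := by
    rw [inner_self_eq_norm_sq_to_K, hζ]; simp
  have ht1 : 0 ≤ t₁ := (norm_nonneg _).trans h1
  have ht2 : 0 ≤ t₂ := (norm_nonneg _).trans h2
  -- The part of x orthogonal to ζ has squared norm at most 1-|⟨x,ζ⟩|² ≤ 2|1-⟨x,ζ⟩|: orthogonal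
  -- directions scale like the square root of the distance.
  have hpart : ∀ x : Cn n, ‖x‖ ≤ 1 → ∀ t, ‖1 - inner ℂ ζ x‖ ≤ t →
      inner ℂ ζ (x - inner ℂ ζ x • ζ) = 0 ∧ ‖x - inner ℂ ζ x • ζ‖ ^ 2 ≤ 2 * t := by
    intro x hx t hxt
    have h0 : inner ℂ ζ (x - inner ℂ ζ x • ζ) = 0 := by
      rw [inner_sub_right, inner_smul_right, hζζ]; simp
    refine ⟨h0, ?_⟩
    have e2 := norm_add_sq_eq_norm_sq_add_norm_sq_of_inner_eq_zero (inner ℂ ζ x • ζ)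
        (x - inner ℂ ζ x • ζ) (by rw [inner_smul_left, h0]; simp)
    rw [add_sub_cancel, norm_smul, hζ, mul_one] at e2
    have h3 := norm_sub_norm_le (1 : ℂ) (1 - inner ℂ ζ x)
    rw [norm_one, sub_sub_cancel] at h3
    have h4 : ‖x‖ * ‖x‖ ≤ 1 := by nlinarith [norm_nonneg x]
    have h5 : ‖inner ℂ ζ x‖ ≤ 1 := by
      have := norm_inner_le_norm (𝕜 := ℂ) ζ x
      rw [hζ, one_mul] at this
      exact this.trans hx
    nlinarith [norm_nonneg (inner ℂ ζ x)]
  obtain ⟨ha0, ha'⟩ := hpart a ha _ h1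
  obtain ⟨hc0, hc'⟩ := hpart c hc _ h2
  set a' := a - inner ℂ ζ a • ζ with ha'd
  set c' := c - inner ℂ ζ c • ζ with hc'd
  set α := inner ℂ ζ a with hα
  set γ := inner ℂ ζ c with hγ
  have hc0' : inner ℂ c' ζ = 0 := by
    rw [← inner_conj_symm, hc0, map_zero]
  have hac : inner ℂ c a = (starRingEnd ℂ) γ * α + inner ℂ c' a' := by
    have e1 : a = α • ζ + a' := by rw [ha'd]; abel
    have e2 : c = γ • ζ + c' := by rw [hc'd]; abel
    conv_lhs => rw [e1, e2]
    rw [inner_add_left, inner_add_right, inner_add_right, inner_smul_left, inner_smul_left,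
      inner_smul_right, inner_smul_right, ha0, hc0', hζζ]
    ring
  have hα1 : ‖α‖ ≤ 1 := by
    have := norm_inner_le_norm (𝕜 := ℂ) ζ a
    rw [hζ, one_mul] at this
    exact this.trans ha
  have h5 : ‖1 - (starRingEnd ℂ) γ * α‖ ≤ t₁ + t₂ := by
    have e : 1 - (starRingEnd ℂ) γ * α = (1 - α) + α * (starRingEnd ℂ) (1 - γ) := by
      rw [map_sub, map_one]; ring
    rw [e]
    refine (norm_add_le _ _).trans ?_
    rw [norm_mul, Complex.norm_conj]
    nlinarith [norm_nonneg (1 - γ), norm_nonneg α]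
  -- Since t₁ ≤ 2t₂, the product is at most 2√(t₁t₂) ≤ 2√2·t₂ < 3t₂ when t₂ > 0; the parallel part
  -- gives t₁+t₂ ≤ 3t₂, whence the 6.
  have h6 : ‖inner ℂ c' a'‖ ≤ 3 * t₂ := by
    refine (norm_inner_le_norm c' a').trans ?_
    have h7 : ‖c'‖ ^ 2 * ‖a'‖ ^ 2 ≤ (2 * t₂) * (2 * t₁) := by gcongr
    refine le_of_sq_le_sq ?_ (by linarith)
    nlinarith
  rw [hac, ← sub_sub]
  refine (norm_sub_le _ _).trans ?_
  linarith

/-- The nonisotropic cap of the sphere around a point of the ball. -/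
def cap {n : ℕ} (z : Cn n) (t : ℝ) : Set (unitSphere n) :=
  {ζ | ‖1 - inner ℂ (ζ : Cn n) z‖ < t}

lemma isOpen_cap {n : ℕ} (z : Cn n) (t : ℝ) : IsOpen (cap z t) :=
  isOpen_lt (by fun_prop) continuous_const

/-- Dyadic decomposition of the sphere: ζ satisfies 2^k(1-|z|) ≤ |1-⟨z,ζ⟩| < 2^(k+1)(1-|z|) for some
k, and the k-th summand bounds the kernel there. -/
lemma poissonKernel_le_tsum {n : ℕ} {z : Cn n} (hz : ‖z‖ < 1) (ζ : unitSphere n) :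
    ENNReal.ofReal (poissonKernel z ζ) ≤ ∑' k : ℕ, (cap z (2 ^ (k + 1) * (1 - ‖z‖))).indicator
      (fun _ => ENNReal.ofReal ((2 * (1 - ‖z‖)) ^ n / (2 ^ k * (1 - ‖z‖)) ^ (2 * n))) ζ := by
  have hd : 0 < 1 - ‖z‖ := by linarith
  have hD := one_sub_norm_le z ζ (norm_eq_of_mem_sphere ζ).le
  obtain ⟨k, hk1, hk2⟩ := exists_nat_pow_near
    (x := ‖1 - inner ℂ (ζ : Cn n) z‖ / (1 - ‖z‖)) ((one_le_div hd).2 hD) one_lt_two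
  rw [le_div_iff₀ hd] at hk1
  rw [div_lt_iff₀ hd] at hk2
  refine le_trans ?_ (ENNReal.le_tsum k)
  rw [indicator_of_mem (by exact hk2)]
  refine ENNReal.ofReal_le_ofReal ?_
  rw [poissonKernel]
  have hz0 := norm_nonneg z
  have h3 : 0 ≤ 1 - ‖z‖ ^ 2 := by nlinarith
  gcongr
  nlinarith

/-- Pigeonhole on the dyadic caps. If every cap integral were small, the k-th term would be at most
λ·2^(-kn)/2 ≤ λ·2^(-(k+1)), and these sum to λ. The factor 2·4^n is what this normalization costs.
-/
lemma exists_cap_of_lt_poisson {n : ℕ} [NeZero n] {z : Cn n} (hz : ‖z‖ < 1)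
    {g : unitSphere n → ℝ≥0∞} (hg : Measurable g) {lam : ℝ≥0∞}
    (h : lam < ∫⁻ ζ : unitSphere n, ENNReal.ofReal (poissonKernel z ζ) * g ζ ∂(sigma n)) :
    ∃ t, 1 - ‖z‖ ≤ t ∧ lam * ENNReal.ofReal (t ^ n) <
      ENNReal.ofReal (2 * 4 ^ n) * ∫⁻ ζ in cap z t, g ζ ∂(sigma n) := by
  by_contra! hcon
  refine absurd h (not_lt.2 ?_)
  have hd : 0 < 1 - ‖z‖ := by linarith
  set d := 1 - ‖z‖ with hdd
  have hn : 1 ≤ n := NeZero.one_le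
  calc ∫⁻ ζ : unitSphere n, ENNReal.ofReal (poissonKernel z ζ) * g ζ ∂(sigma n)
      ≤ ∫⁻ ζ : unitSphere n, ∑' k : ℕ, (cap z (2 ^ (k + 1) * d)).indicator
          (fun ζ => ENNReal.ofReal ((2 * d) ^ n / (2 ^ k * d) ^ (2 * n)) * g ζ) ζ ∂(sigma n) := by
        refine lintegral_mono fun ζ => ?_
        refine (mul_le_mul_left (poissonKernel_le_tsum hz ζ) _).trans ?_
        rw [← ENNReal.tsum_mul_right]
        refine le_of_eq (tsum_congr fun k => ?_)
        rw [← hdd]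
        by_cases hm : ζ ∈ cap z (2 ^ (k + 1) * d)
        · rw [indicator_of_mem hm, indicator_of_mem hm]
        · rw [indicator_of_notMem hm, indicator_of_notMem hm, zero_mul]
    _ = ∑' k : ℕ, ENNReal.ofReal ((2 * d) ^ n / (2 ^ k * d) ^ (2 * n)) *
          ∫⁻ ζ in cap z (2 ^ (k + 1) * d), g ζ ∂(sigma n) := by
        rw [lintegral_tsum fun k => ((hg.const_mul _).indicator
          (isOpen_cap _ _).measurableSet).aemeasurable]
        refine tsum_congr fun k => ?_
        rw [lintegral_indicator (isOpen_cap _ _).measurableSet, lintegral_const_mul _ hg]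
    _ ≤ ∑' k : ℕ, lam * (2⁻¹ : ℝ≥0∞) ^ (k + 1) := by
        refine ENNReal.tsum_le_tsum fun k => ?_
        have h2k : (1 : ℝ) ≤ 2 ^ (k + 1) := one_le_pow₀ one_le_two
        have hk := hcon (2 ^ (k + 1) * d) (by nlinarith)
        have hb : (2 * d) ^ n / (2 ^ k * d) ^ (2 * n) =
            ((2 * d) ^ n / (2 ^ k * d) ^ (2 * n) / (2 * 4 ^ n)) * (2 * 4 ^ n) := by
          field_simp
        rw [hb, ENNReal.ofReal_mul (by positivity), mul_assoc]
        refine (mul_le_mul_right hk _).trans ?_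
        rw [mul_left_comm, ← ENNReal.ofReal_mul (by positivity)]
        gcongr
        have h3 : (2 * d) ^ n / (2 ^ k * d) ^ (2 * n) / (2 * 4 ^ n) * (2 ^ (k + 1) * d) ^ n =
            (2⁻¹ ^ k) ^ n * 2⁻¹ := by
          rw [pow_succ, pow_mul, mul_pow (2 ^ k) d 2, show (4 : ℝ) ^ n = 2 ^ n * 2 ^ n by
            rw [← mul_pow]; norm_num]
          simp only [mul_pow]
          rw [inv_pow, inv_pow]
          field_simp
          ring_nf
        have h4 : (2⁻¹ : ℝ≥0∞) ^ (k + 1) = ENNReal.ofReal (2⁻¹ ^ k * 2⁻¹) := by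
          rw [← pow_succ, ENNReal.ofReal_pow (by positivity), ENNReal.ofReal_inv_of_pos two_pos]
          simp
        rw [h3, h4]
        refine ENNReal.ofReal_le_ofReal ?_
        gcongr
        exact pow_le_of_le_one (by positivity) (pow_le_one₀ (by positivity) (by norm_num))
          (by omega)
    _ = lam := by
        rw [ENNReal.tsum_mul_left]
        simp_rw [pow_succ]
        rw [ENNReal.tsum_mul_right, ENNReal.tsum_geometric, ENNReal.one_sub_inv_two, inv_inv,
          ENNReal.mul_inv_cancel two_ne_zero ENNReal.ofNat_ne_top, mul_one]

/-- A weak type inequality for Poisson integrals with respect to a measure which satisfies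
Carleson's condition on nonisotropic tents. -/
theorem weak_type {n : ℕ} [NeZero n] {X : Type*} [MeasurableSpace X] (m : Measure X)
    (Z : X → Cn n) (E : Set X) {g : unitSphere n → ℝ≥0∞} (hg : Measurable g)
    (hgfin : ∫⁻ ζ, g ζ ∂(sigma n) ≠ ∞) {lam : ℝ≥0∞} (hl0 : lam ≠ 0) (hltop : lam ≠ ∞) {s : ℝ}
    (hs : 1 ≤ s) (A : ℝ≥0∞) (hE1 : ∀ x ∈ E, ‖Z x‖ < 1)
    (hE : ∀ x ∈ E, lam <
      ∫⁻ ζ : unitSphere n, ENNReal.ofReal (poissonKernel (Z x) ζ) * g ζ ∂(sigma n))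
    (hA : ∀ a, ‖a‖ < 1 → ∀ t, 1 - ‖a‖ ≤ t →
      m {x | x ∈ E ∧ ‖1 - inner ℂ a (Z x)‖ ≤ 6 * t} ≤ A * ENNReal.ofReal (t ^ n) ^ s) :
    m E ≤ A * (ENNReal.ofReal (2 * 4 ^ n) * (lam⁻¹ * ∫⁻ ζ, g ζ ∂(sigma n))) ^ s := by
  classical
  have hsel : ∀ x : X, ∃ t, x ∈ E → 1 - ‖Z x‖ ≤ t ∧ lam * ENNReal.ofReal (t ^ n) <
      ENNReal.ofReal (2 * 4 ^ n) * ∫⁻ ζ in cap (Z x) t, g ζ ∂(sigma n) := by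
    intro x
    by_cases hx : x ∈ E
    · obtain ⟨t, ht⟩ := exists_cap_of_lt_poisson (hE1 x hx) hg (hE x hx)
      exact ⟨t, fun _ => ht⟩
    · exact ⟨0, fun h => absurd h hx⟩
  choose τ hτ using hsel
  have hτ0 : ∀ x ∈ E, 0 < τ x := fun x hx => by linarith [(hτ x hx).1, hE1 x hx]
  set N := ENNReal.ofReal (2 * 4 ^ n) * (lam⁻¹ * ∫⁻ ζ, g ζ ∂(sigma n)) with hN
  have hNtop : N ≠ ∞ := ENNReal.mul_ne_top ENNReal.ofReal_ne_top
    (ENNReal.mul_ne_top (ENNReal.inv_ne_top.2 hl0) hgfin)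
  have hy : ∀ x ∈ E, ENNReal.ofReal (τ x ^ n) ≤
      ENNReal.ofReal (2 * 4 ^ n) * (lam⁻¹ * ∫⁻ ζ in cap (Z x) (τ x), g ζ ∂(sigma n)) := by
    intro x hx
    have h := mul_le_mul_right (hτ x hx).2.le lam⁻¹
    rwa [← mul_assoc, ENNReal.inv_mul_cancel hl0 hltop, one_mul, mul_left_comm] at h
  have hyN : ∀ x, ENNReal.ofReal (2 * 4 ^ n) *
      (lam⁻¹ * ∫⁻ ζ in cap (Z x) (τ x), g ζ ∂(sigma n)) ≤ N := fun x => by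
    rw [hN]
    gcongr
    exact Measure.restrict_le_self
  have hτR : ∀ x ∈ E, τ x ≤ N.toReal + 1 := by
    intro x hx
    have h1 : τ x ^ n ≤ N.toReal := by
      have := ENNReal.toReal_mono hNtop ((hy x hx).trans (hyN x))
      rwa [ENNReal.toReal_ofReal (pow_nonneg (hτ0 x hx).le _)] at this
    rcases le_total (τ x) 1 with h | h
    · linarith [ENNReal.toReal_nonneg (a := N)]
    · linarith [le_self_pow₀ h (NeZero.ne n)]
  have hne : ∀ x ∈ E, (cap (Z x) (τ x)).Nonempty := by
    intro x hx
    rw [nonempty_iff_ne_empty]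
    intro h0
    have := (hτ x hx).2
    rw [h0] at this
    simp at this
  -- Vitali is applied to the caps on the sphere while m lives on X. If the caps of x and b meet at
  -- ζ and τ x ≤ 2 τ b, the quasi-triangle inequality through ζ puts x in the tent of b of size 6 τ
  -- b.
  obtain ⟨u, huE, hdisj, hcov⟩ := Vitali.exists_disjoint_subfamily_covering_enlargement
    (fun x => cap (Z x) (τ x)) E τ 2 one_lt_two (fun x hx => (hτ0 x hx).le) _ hτR hne
  have hcount : u.Countable := hdisj.countable_of_isOpen (fun x _ => isOpen_cap _ _)
    fun x hx => hne x (huE hx)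
  have hsub : E ⊆ ⋃ b ∈ u, {x | x ∈ E ∧ ‖1 - inner ℂ (Z b) (Z x)‖ ≤ 6 * τ b} := by
    intro x hx
    obtain ⟨b, hb, ⟨ζ, hζx, hζb⟩, hle⟩ := hcov x hx
    refine mem_biUnion hb ⟨hx, ?_⟩
    exact norm_one_sub_inner_le (hE1 x hx).le (hE1 b (huE hb)).le (norm_eq_of_mem_sphere ζ)
      (le_of_lt hζx) (le_of_lt hζb) hle
  have := hcount.to_subtype
  calc m E ≤ m (⋃ b ∈ u, {x | x ∈ E ∧ ‖1 - inner ℂ (Z b) (Z x)‖ ≤ 6 * τ b}) := measure_mono hsub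
    _ ≤ ∑' b : u, m {x | x ∈ E ∧ ‖1 - inner ℂ (Z b) (Z x)‖ ≤ 6 * τ b} :=
        measure_biUnion_le _ hcount _
    -- For s ≥ 1 and y ≤ N one has y^s ≤ y·N^(s-1); the sum becomes linear in the cap integrals,
    -- which add up over disjoint caps.
    _ ≤ ∑' b : u, A * ((ENNReal.ofReal (2 * 4 ^ n) *
          (lam⁻¹ * ∫⁻ ζ in cap (Z b) (τ b), g ζ ∂(sigma n))) * N ^ (s - 1)) := by
        refine ENNReal.tsum_le_tsum fun b => ?_
        refine (hA _ (hE1 b (huE b.2)) _ (hτ b (huE b.2)).1).trans ?_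
        gcongr
        refine (ENNReal.rpow_le_rpow (hy b (huE b.2)) (by linarith)).trans ?_
        conv_lhs => rw [← add_sub_cancel 1 s]
        rw [ENNReal.rpow_add_of_nonneg _ _ zero_le_one (by linarith), ENNReal.rpow_one]
        exact mul_le_mul_right (ENNReal.rpow_le_rpow (hyN b) (by linarith)) _
    _ ≤ A * (N * N ^ (s - 1)) := by
        rw [ENNReal.tsum_mul_left, ENNReal.tsum_mul_right, ENNReal.tsum_mul_left,
          ENNReal.tsum_mul_left]
        gcongr
        rw [hN]
        gcongr
        rw [← lintegral_iUnion (fun b : u => (isOpen_cap (Z b) (τ b)).measurableSet)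
          fun b c hbc => hdisj b.2 c.2 (Subtype.coe_injective.ne hbc)]
        exact setLIntegral_le_lintegral _ _
    _ = A * N ^ s := by
        conv_rhs => rw [← add_sub_cancel 1 s]
        rw [ENNReal.rpow_add_of_nonneg _ _ zero_le_one (by linarith), ENNReal.rpow_one]

/-! ### Uniform convexity and convergence of dilates in mean -/

/-- The convexity defect of `|·|^q` at the midpoint of two points. -/
def convexityDefect (q : ℝ) (a b : ℂ) : ℝ :=
  (‖a‖ ^ q + ‖b‖ ^ q) / 2 - ‖(a + b) / 2‖ ^ q

/-- For equal norms the midpoint is strictly shorter because ℂ is strictly convex; for different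
norms t^q is strictly convex. -/
lemma convexityDefect_pos {q : ℝ} (hq : 1 < q) {a b : ℂ} (hab : a ≠ b) :
    0 < convexityDefect q a b := by
  have hq0 : 0 < q := by linarith
  rw [convexityDefect, sub_pos]
  by_cases h : ‖a‖ = ‖b‖
  · have h1 := (norm_midpoint_lt_iff (x := a) (y := b) h).2 hab
    have h2 : (1 / 2 : ℝ) • (a + b) = (a + b) / 2 := by
      rw [Complex.real_smul]; push_cast; ring
    rw [h2] at h1
    calc ‖(a + b) / 2‖ ^ q < ‖a‖ ^ q := Real.rpow_lt_rpow (norm_nonneg _) h1 hq0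
      _ = _ := by rw [← h]; ring
  · have h1 : ‖(a + b) / 2‖ ≤ (1 / 2 : ℝ) • ‖a‖ + (1 / 2 : ℝ) • ‖b‖ := by
      rw [norm_div, smul_eq_mul, smul_eq_mul]
      have := norm_add_le a b
      simp only [Complex.norm_ofNat]
      linarith
    have h2 := (strictConvexOn_rpow hq).2 (mem_Ici.2 (norm_nonneg a)) (mem_Ici.2 (norm_nonneg b)) h
      (by norm_num : (0 : ℝ) < 1 / 2) (by norm_num : (0 : ℝ) < 1 / 2) (by norm_num)
    refine (Real.rpow_le_rpow (norm_nonneg _) h1 hq0.le).trans_lt (h2.trans_eq ?_)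
    rw [smul_eq_mul, smul_eq_mul]; ring

lemma convexityDefect_nonneg {q : ℝ} (hq : 1 < q) (a b : ℂ) : 0 ≤ convexityDefect q a b := by
  by_cases hab : a = b
  · subst hab
    rw [convexityDefect, add_self_div_two, add_self_div_two, sub_self]
  · exact (convexityDefect_pos hq hab).le

lemma convexityDefect_smul {q : ℝ} (a b : ℂ) {c : ℝ} (hc : 0 ≤ c) :
    convexityDefect q (c * a) (c * b) = c ^ q * convexityDefect q a b := by
  have h : ((c : ℂ) * a + c * b) / 2 = c * ((a + b) / 2) := by ring
  rw [convexityDefect, convexityDefect, h]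
  simp only [norm_mul, Complex.norm_real, Real.norm_of_nonneg hc,
    Real.mul_rpow hc (norm_nonneg _)]
  ring

/-- A form of uniform convexity for the function `|·|^q`, for `q > 1`. -/
lemma exists_norm_sub_rpow_le {q : ℝ} (hq : 1 < q) {δ : ℝ} (hδ : 0 < δ) :
    ∃ C : ℝ, 0 < C ∧ ∀ a b : ℂ,
      ‖a - b‖ ^ q ≤ δ * (‖a‖ ^ q + ‖b‖ ^ q) + C * convexityDefect q a b := by
  have hq0 : 0 < q := by linarith
  have hcont : Continuous fun x : ℂ × ℂ => convexityDefect q x.1 x.2 := by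
    unfold convexityDefect
    have h : ∀ g : ℂ × ℂ → ℂ, Continuous g → Continuous fun x => ‖g x‖ ^ q := fun g hg =>
      hg.norm.rpow_const fun _ => Or.inr hq0.le
    exact (((h _ continuous_fst).add (h _ continuous_snd)).div_const 2).sub
      (h _ ((continuous_fst.add continuous_snd).div_const 2))
  -- On this compact set a ≠ b, so the defect has a positive minimum there. All terms are
  -- homogeneous of degree q, so the unit sphere suffices.
  set K : Set (ℂ × ℂ) := Metric.sphere 0 1 ∩ {x | δ ≤ ‖x.1 - x.2‖ ^ q} with hK
  have hKc : IsCompact K := by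
    refine (isCompact_sphere _ _).inter_right (isClosed_le continuous_const ?_)
    exact (continuous_fst.sub continuous_snd).norm.rpow_const fun _ => Or.inr hq0.le
  obtain ⟨c, hc0, hc⟩ : ∃ c : ℝ, 0 < c ∧ ∀ x ∈ K, c ≤ convexityDefect q x.1 x.2 := by
    rcases K.eq_empty_or_nonempty with h | h
    · exact ⟨1, one_pos, by simp [h]⟩
    · obtain ⟨x, hx, hmin⟩ := hKc.exists_isMinOn h hcont.continuousOn
      refine ⟨_, convexityDefect_pos hq (a := x.1) (b := x.2) ?_, fun y hy => hmin hy⟩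
      intro heq
      have := hx.2
      rw [mem_ofPred_eq, heq, sub_self, norm_zero, Real.zero_rpow hq0.ne'] at this
      linarith
  have hsphere : ∀ x : ℂ × ℂ, ‖x‖ = 1 → ‖x.1 - x.2‖ ^ q ≤
      δ * (‖x.1‖ ^ q + ‖x.2‖ ^ q) + 2 ^ q / c * convexityDefect q x.1 x.2 := by
    intro x hx
    have hD := convexityDefect_nonneg hq x.1 x.2
    have h1 : 1 ≤ ‖x.1‖ ^ q + ‖x.2‖ ^ q := by
      have e1 := Real.rpow_nonneg (norm_nonneg x.1) q
      have e2 := Real.rpow_nonneg (norm_nonneg x.2) q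
      rw [Prod.norm_def] at hx
      rcases max_choice ‖x.1‖ ‖x.2‖ with h | h
      · rw [h] at hx; rw [hx, Real.one_rpow]; linarith
      · rw [h] at hx; rw [hx, Real.one_rpow]; linarith
    by_cases hxK : δ ≤ ‖x.1 - x.2‖ ^ q
    · have h2 : ‖x.1 - x.2‖ ^ q ≤ 2 ^ q := by
        refine Real.rpow_le_rpow (norm_nonneg _) ?_ hq0.le
        refine (norm_sub_le _ _).trans ?_
        have e1 := norm_fst_le x
        have e2 := norm_snd_le x
        linarith
      have h3 := hc x ⟨by simpa using hx, hxK⟩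
      have h4 : 2 ^ q ≤ 2 ^ q / c * convexityDefect q x.1 x.2 := by
        rw [div_mul_eq_mul_div, le_div_iff₀ hc0]
        gcongr
      have h5 : 0 ≤ δ * (‖x.1‖ ^ q + ‖x.2‖ ^ q) := by positivity
      linarith
    · have h4 : 0 ≤ 2 ^ q / c * convexityDefect q x.1 x.2 := by positivity
      nlinarith
  refine ⟨2 ^ q / c, by positivity, fun a b => ?_⟩
  by_cases h0 : ((a, b) : ℂ × ℂ) = 0
  · obtain ⟨rfl, rfl⟩ := Prod.mk.inj h0
    simp [convexityDefect, Real.zero_rpow hq0.ne']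
  · set ρ := ‖((a, b) : ℂ × ℂ)‖ with hρ
    have hρ0 : 0 < ρ := norm_pos_iff.2 h0
    have hρq : 0 < ρ ^ q := Real.rpow_pos_of_pos hρ0 q
    have hρc : (ρ : ℂ) ≠ 0 := by exact_mod_cast hρ0.ne'
    have h1 := hsphere ((ρ⁻¹ : ℝ) • ((a, b) : ℂ × ℂ)) (by
      rw [norm_smul, norm_inv, Real.norm_of_nonneg hρ0.le, ← hρ, inv_mul_cancel₀ hρ0.ne'])
    simp only [Prod.smul_mk, Complex.real_smul] at h1
    rw [convexityDefect_smul _ _ (by positivity), ← mul_sub] at h1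
    simp only [norm_mul, Complex.norm_real, Real.norm_of_nonneg (inv_nonneg.2 hρ0.le),
      Real.mul_rpow (inv_nonneg.2 hρ0.le) (norm_nonneg _), Real.inv_rpow hρ0.le] at h1
    have h2 := mul_le_mul_of_nonneg_left h1 hρq.le
    have e1 : ρ ^ q * ((ρ ^ q)⁻¹ * ‖a - b‖ ^ q) = ‖a - b‖ ^ q := by
      rw [← mul_assoc, mul_inv_cancel₀ hρq.ne', one_mul]
    rw [e1] at h2
    refine h2.trans_eq ?_
    field_simp

lemma lintegral_enorm_rpow_eq {n : ℕ} [NeZero n] {q : ℝ} (hq : 0 ≤ q) {F : unitSphere n → ℂ}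
    (hF : Continuous F) :
    ∫⁻ ξ, ‖F ξ‖ₑ ^ q ∂(sigma n) = ENNReal.ofReal (∫ ξ, ‖F ξ‖ ^ q ∂(sigma n)) := by
  rw [ofReal_integral_eq_lintegral_ofReal
    (Continuous.integrable_sigma (hF.norm.rpow_const fun _ => Or.inr hq))
    (Eventually.of_forall fun ξ => by positivity)]
  refine lintegral_congr fun ξ => ?_
  rw [← ofReal_norm, ENNReal.ofReal_rpow_of_nonneg (norm_nonneg _) hq]

/-- The dilates of a function in `H^q`, `q > 1`, are Cauchy in the mean of order `q`. -/
theorem exists_dilate_cauchy {n : ℕ} [NeZero n] {q : ℝ} (hq : 1 < q) {f : Cn n → ℂ}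
    (hf : DifferentiableOn ℂ f (unitBall n)) (hfq : hardyENorm q f < ∞) {η : ℝ} (hη : 0 < η) :
    ∃ r₁ ∈ Ioo (0 : ℝ) 1, ∀ r ∈ Ico r₁ 1, ∀ s ∈ Ico r₁ 1,
      ∫⁻ ξ : unitSphere n, ‖f (r • (ξ : Cn n)) - f (s • (ξ : Cn n))‖ₑ ^ q ∂(sigma n) ≤
        ENNReal.ofReal η := by
  have hq0 : 0 < q := by linarith
  set M : ℝ → ℝ := fun r => ∫ ξ : unitSphere n, ‖f (r • (ξ : Cn n))‖ ^ q ∂(sigma n) with hM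
  have hM0 : ∀ r, 0 ≤ M r := fun r => integral_nonneg fun ξ => by positivity
  have hMe : ∀ r ∈ Ioo (0 : ℝ) 1, hardyMean q f r = ENNReal.ofReal (M r) := fun r hr =>
    lintegral_enorm_rpow_eq hq0.le (continuous_dilate hf hr)
  have hbdd : BddAbove (M '' Ioo (0 : ℝ) 1) := by
    refine ⟨(hardyENorm q f ^ q).toReal, ?_⟩
    rintro _ ⟨r, hr, rfl⟩
    have h := hardyMean_le hq.le f hr
    rw [hMe r hr] at h
    exact (ENNReal.ofReal_le_iff_le_toReal (ENNReal.rpow_ne_top_of_nonneg hq0.le hfq.ne)).1 h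
  set N := sSup (M '' Ioo (0 : ℝ) 1) with hN
  have hMN : ∀ r ∈ Ioo (0 : ℝ) 1, M r ≤ N := fun r hr => le_csSup hbdd ⟨r, hr, rfl⟩
  have hN0 : 0 ≤ N := (hM0 (1 / 2)).trans (hMN _ ⟨by norm_num, by norm_num⟩)
  -- This δ and the ε below give 2Nδ ≤ η/2 and Cε = η/4; N + 1 avoids division by zero.
  obtain ⟨C, hC0, hC⟩ := exists_norm_sub_rpow_le hq
    (δ := η / (4 * (N + 1))) (by positivity)
  set ε := η / (4 * C) with hε
  have hε0 : 0 < ε := by positivity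
  obtain ⟨_, ⟨r₀, hr₀, rfl⟩, hr₀N⟩ := exists_lt_of_lt_csSup (s := M '' Ioo (0 : ℝ) 1)
    (Set.Nonempty.image _ ⟨1 / 2, by norm_num, by norm_num⟩) (show N - ε < N by linarith)
  set mid : ℝ → ℝ → ℝ → ℝ := fun t r s =>
    ∫ ξ : unitSphere n, ‖(f ((r * t) • (ξ : Cn n)) + f ((s * t) • (ξ : Cn n))) / 2‖ ^ q ∂(sigma n)
    with hmid
  have hmul : ∀ r ∈ Ioo (0 : ℝ) 1, r * r₀ ∈ Ioo (0 : ℝ) r₀ := fun r hr =>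
    ⟨mul_pos hr.1 hr₀.1, mul_lt_of_lt_one_left hr₀.1 hr.2⟩
  have hmul1 : ∀ r ∈ Ioo (0 : ℝ) 1, r * r₀ ∈ Ioo (0 : ℝ) 1 := fun r hr =>
    ⟨(hmul r hr).1, (hmul r hr).2.trans hr₀.2⟩
  obtain ⟨B, hB⟩ : ∃ B, ∀ z ∈ Metric.closedBall (0 : Cn n) r₀, ‖f z‖ ≤ B :=
    (isCompact_closedBall _ _).exists_bound_of_continuousOn
      (hf.continuousOn.mono (Metric.closedBall_subset_ball hr₀.2))
  have hIoo : ∀ᶠ r : ℝ in 𝓝[<] 1, r ∈ Ioo (0 : ℝ) 1 := Ioo_mem_nhdsLT one_pos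
  -- At the fixed radius r₀ < 1 the function is bounded and continuous, so the mean of the midpoint
  -- of two dilates tends to M r₀, which nearly attains the supremum N.
  have hlim : Tendsto (fun x : ℝ × ℝ => mid r₀ x.1 x.2) (𝓝[<] 1 ×ˢ 𝓝[<] 1) (𝓝 (M r₀)) := by
    refine tendsto_integral_filter_of_dominated_convergence (fun _ => B ^ q) ?_ ?_ ?_ ?_
    · filter_upwards [hIoo.prod_mk hIoo] with x hx
      refine Continuous.aestronglyMeasurable ?_
      exact (((continuous_dilate hf (hmul1 _ hx.1)).add
        (continuous_dilate hf (hmul1 _ hx.2))).div_const 2).norm.rpow_const fun _ => Or.inr hq0.le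
    · filter_upwards [hIoo.prod_mk hIoo] with x hx
      refine Eventually.of_forall fun ξ => ?_
      rw [Real.norm_of_nonneg (by positivity)]
      refine Real.rpow_le_rpow (norm_nonneg _) ?_ hq0.le
      have hb : ∀ r ∈ Ioo (0 : ℝ) 1, ‖f ((r * r₀) • (ξ : Cn n))‖ ≤ B := fun r hr => by
        refine hB _ ?_
        rw [mem_closedBall_zero_iff, norm_smul_sphere (hmul r hr).1.le]
        exact (hmul r hr).2.le
      rw [norm_div, Complex.norm_ofNat, div_le_iff₀ two_pos]
      linarith [norm_add_le (f ((x.1 * r₀) • (ξ : Cn n))) (f ((x.2 * r₀) • (ξ : Cn n))),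
        hb _ hx.1, hb _ hx.2]
    · exact integrable_const _
    · refine Eventually.of_forall fun ξ => ?_
      have hfc : ContinuousAt f (r₀ • (ξ : Cn n)) := hf.continuousOn.continuousAt
        (Metric.isOpen_ball.mem_nhds (smul_mem_unitBall hr₀ ξ))
      have h1 : Tendsto (fun r : ℝ => f ((r * r₀) • (ξ : Cn n))) (𝓝[<] 1)
          (𝓝 (f (r₀ • (ξ : Cn n)))) := by
        refine hfc.tendsto.comp (Tendsto.mono_left ?_ nhdsWithin_le_nhds)
        have : Continuous fun r : ℝ => (r * r₀) • (ξ : Cn n) := by fun_prop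
        simpa using this.tendsto 1
      have h2 := (((h1.comp tendsto_fst).add (h1.comp tendsto_snd)).div_const 2).norm.rpow_const
        (p := q) (Or.inr hq0.le)
      simpa using h2
  have hev := hlim.eventually (lt_mem_nhds hr₀N)
  rw [eventually_prod_iff] at hev
  obtain ⟨pa, hpa, pb, hpb, hp⟩ := hev
  obtain ⟨r₁, hr₁1, hr₁⟩ := mem_nhdsLT_iff_exists_Ico_subset.1
    ((hpa.and hpb).and hIoo)
  have hr₁mem : r₁ ∈ Ioo (0 : ℝ) 1 := (hr₁ ⟨le_rfl, hr₁1⟩).2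
  refine ⟨r₁, hr₁mem, fun r hr s hs => ?_⟩
  have hrI : r ∈ Ioo (0 : ℝ) 1 := (hr₁ hr).2
  have hsI : s ∈ Ioo (0 : ℝ) 1 := (hr₁ hs).2
  have hmid0 : N - ε < mid r₀ r s := hp (hr₁ hr).1.1 (hr₁ hs).1.2
  have hfr := continuous_dilate hf hrI
  have hfs := continuous_dilate hf hsI
  have hpow : ∀ F : unitSphere n → ℂ, Continuous F → Integrable (fun ξ => ‖F ξ‖ ^ q) (sigma n) :=
    fun F hF => Continuous.integrable_sigma (hF.norm.rpow_const fun _ => Or.inr hq0.le)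
  have hadd : ∀ a b : ℝ, a ∈ Ioo (0 : ℝ) 1 → b ∈ Ioo (0 : ℝ) 1 → Continuous fun ξ : unitSphere n =>
      (f (a • (ξ : Cn n)) + f (b • (ξ : Cn n))) / 2 := fun a b ha hb =>
    ((continuous_dilate hf ha).add (continuous_dilate hf hb)).div_const 2
  -- Subharmonicity of the midpoint function moves the lower bound N - ε from radius r₀ to the
  -- sphere. Both dilates have mean at most N, so the mean convexity defect is at most ε.
  have hmid1 : mid r₀ r s ≤
      ∫ ξ : unitSphere n, ‖(f (r • (ξ : Cn n)) + f (s • (ξ : Cn n))) / 2‖ ^ q ∂(sigma n) := by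
    set m := max r s with hm
    have hmI : m ∈ Ioo (0 : ℝ) 1 := ⟨lt_max_of_lt_left hrI.1, max_lt hrI.2 hsI.2⟩
    have hd : ∀ u ∈ Ioc (0 : ℝ) m, DifferentiableOn ℂ (fun z : Cn n => f (u • z))
        (Metric.ball 0 m⁻¹) := fun u hu =>
      (differentiableOn_dilate hf hu.1).mono (Metric.ball_subset_ball (inv_anti₀ hu.1 hu.2))
    have h := lintegral_dilate_le hq.le ((one_lt_inv₀ hmI.1).2 hmI.2)
      (f := fun z : Cn n => (f (r • z) + f (s • z)) / 2)
      (by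
        simp only [div_eq_mul_inv]
        exact ((hd r ⟨hrI.1, le_max_left _ _⟩).add (hd s ⟨hsI.1, le_max_right _ _⟩)).mul_const _)
      hr₀.1.le hr₀.2
    simp only [smul_smul] at h
    rw [lintegral_enorm_rpow_eq hq0.le (hadd _ _ hrI hsI),
      lintegral_enorm_rpow_eq hq0.le (hadd _ _ (hmul1 _ hrI) (hmul1 _ hsI))] at h
    exact (ENNReal.ofReal_le_ofReal_iff (integral_nonneg fun ξ => by positivity)).1 h
  rw [lintegral_enorm_rpow_eq hq0.le (show Continuous fun ξ : unitSphere n =>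
    f (r • (ξ : Cn n)) - f (s • (ξ : Cn n)) from hfr.sub hfs)]
  refine ENNReal.ofReal_le_ofReal ?_
  have i1 := hpow _ hfr
  have i2 := hpow _ hfs
  have i3 := hpow _ (hadd _ _ hrI hsI)
  have i12 : Integrable (fun ξ : unitSphere n =>
    ‖f (r • (ξ : Cn n))‖ ^ q + ‖f (s • (ξ : Cn n))‖ ^ q) (sigma n) := i1.add i2
  have i4 : Integrable (fun ξ : unitSphere n =>
    (‖f (r • (ξ : Cn n))‖ ^ q + ‖f (s • (ξ : Cn n))‖ ^ q) / 2 -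
      ‖(f (r • (ξ : Cn n)) + f (s • (ξ : Cn n))) / 2‖ ^ q) (sigma n) := (i12.div_const 2).sub i3
  calc ∫ ξ : unitSphere n, ‖f (r • (ξ : Cn n)) - f (s • (ξ : Cn n))‖ ^ q ∂(sigma n)
      ≤ ∫ ξ : unitSphere n, (η / (4 * (N + 1)) *
          (‖f (r • (ξ : Cn n))‖ ^ q + ‖f (s • (ξ : Cn n))‖ ^ q) +
          C * ((‖f (r • (ξ : Cn n))‖ ^ q + ‖f (s • (ξ : Cn n))‖ ^ q) / 2 -
            ‖(f (r • (ξ : Cn n)) + f (s • (ξ : Cn n))) / 2‖ ^ q)) ∂(sigma n) :=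
        integral_mono (hpow _ (hfr.sub hfs)) ((i12.const_mul _).add (i4.const_mul C))
          fun ξ => hC _ _
    _ = η / (4 * (N + 1)) * (M r + M s) + C * ((M r + M s) / 2 -
          ∫ ξ : unitSphere n, ‖(f (r • (ξ : Cn n)) + f (s • (ξ : Cn n))) / 2‖ ^ q ∂(sigma n)) := by
        rw [integral_add (i12.const_mul _) (i4.const_mul C), integral_const_mul,
          integral_const_mul, integral_sub (i12.div_const 2) i3, integral_div,
          integral_add i1 i2]
    _ ≤ η / (4 * (N + 1)) * (N + N) + C * ((N + N) / 2 - (N - ε)) := by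
        have := hMN r hrI
        have := hMN s hsI
        gcongr
        linarith
    _ ≤ η := by
        have h1 : η / (4 * (N + 1)) * (N + N) ≤ η / 2 := by
          rw [div_mul_eq_mul_div, div_le_div_iff₀ (by positivity) two_pos]
          nlinarith
        have h2 : C * ((N + N) / 2 - (N - ε)) = η / 4 := by
          rw [hε]; field_simp; ring
        linarith

/-! ### The radial maximal function and radial limits -/

lemma inner_real_smul_right {n : ℕ} (x y : Cn n) (u : ℝ) :
    inner ℂ x (u • y) = (u : ℂ) * inner ℂ x y := by
  rw [← inner_smul_right]; rfl

/-- Passing from a point of the ball to a nearby smaller one in the nonisotropic distance. -/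
lemma norm_one_sub_inner_shrink_le {n : ℕ} {a x : Cn n} (ha : ‖a‖ ≤ 1) (hx : ‖x‖ ≤ 1) {t c : ℝ}
    (ht : 0 ≤ t) (h : ‖1 - inner ℂ a x‖ ≤ c * t) :
    ‖1 - inner ℂ x ((1 - t) • a)‖ ≤ (c + 1) * t := by
  have h1 : 1 - inner ℂ x ((1 - t) • a) = (1 - inner ℂ x a) + t * inner ℂ x a := by
    rw [inner_real_smul_right]; push_cast; ring
  have h2 : ‖1 - inner ℂ x a‖ = ‖1 - inner ℂ a x‖ := by
    rw [← Complex.norm_conj, map_sub, map_one, inner_conj_symm]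
  have h3 : ‖inner ℂ x a‖ ≤ 1 := by
    have := norm_inner_le_norm (𝕜 := ℂ) x a
    nlinarith [norm_nonneg x, norm_nonneg a]
  rw [h1]
  refine (norm_add_le _ _).trans ?_
  rw [h2, norm_mul, Complex.norm_real, Real.norm_of_nonneg ht]
  nlinarith

lemma norm_shrink_le {n : ℕ} {a : Cn n} (ha : ‖a‖ ≤ 1) {t : ℝ} (ht1 : t ≤ 1) :
    ‖(1 - t) • a‖ ≤ 1 - t := by
  rw [norm_smul, Real.norm_of_nonneg (by linarith)]
  nlinarith [norm_nonneg a]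

/-- On the tent the Poisson kernel at (1-t)a is at least (13^(2n) t^n)⁻¹, and it has integral one;
moving from a to (1-t)a turns 12 into 13. For t ≥ 1 the bound exceeds the total mass. -/
lemma sigma_tent_le {n : ℕ} [NeZero n] {a : Cn n} (ha : ‖a‖ < 1) {t : ℝ} (hat : 1 - ‖a‖ ≤ t) :
    sigma n {ξ | ‖1 - inner ℂ a (ξ : Cn n)‖ ≤ 12 * t} ≤
      ENNReal.ofReal (13 ^ (2 * n)) * ENNReal.ofReal (t ^ n) := by
  have ht0 : 0 < t := by linarith
  rw [← ENNReal.ofReal_mul (by positivity)]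
  rcases le_total 1 t with h1 | h1
  · refine prob_le_one.trans ?_
    rw [ENNReal.one_le_ofReal]
    exact one_le_mul_of_one_le_of_one_le (one_le_pow₀ (by norm_num)) (one_le_pow₀ h1)
  · set w := (1 - t) • a with hw
    have hw1 : ‖w‖ ≤ 1 - t := norm_shrink_le ha.le h1
    have hwlt : ‖w‖ < 1 := by linarith
    have hc : 0 < (13 ^ (2 * n) * t ^ n : ℝ) := by positivity
    have hS : MeasurableSet {ξ : unitSphere n | ‖1 - inner ℂ a (ξ : Cn n)‖ ≤ 12 * t} :=
      (isClosed_le (by fun_prop) continuous_const).measurableSet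
    have key : ∀ ξ ∈ {ξ : unitSphere n | ‖1 - inner ℂ a (ξ : Cn n)‖ ≤ 12 * t},
        ENNReal.ofReal ((13 ^ (2 * n) * t ^ n)⁻¹) ≤ ENNReal.ofReal (poissonKernel w ξ) := by
      intro ξ hξ
      have h2 := norm_one_sub_inner_shrink_le ha.le (norm_eq_of_mem_sphere ξ).le ht0.le hξ
      rw [← hw] at h2
      refine ENNReal.ofReal_le_ofReal ?_
      have h0 := norm_one_sub_inner_pos hwlt (norm_eq_of_mem_sphere ξ).le
      rw [poissonKernel, ← one_div, div_le_div_iff₀ hc (by positivity), one_mul]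
      calc ‖1 - inner ℂ (ξ : Cn n) w‖ ^ (2 * n) ≤ ((12 + 1) * t) ^ (2 * n) := by gcongr
        _ = t ^ n * (13 ^ (2 * n) * t ^ n) := by
            rw [mul_pow, two_mul, pow_add]; norm_num; ring
        _ ≤ (1 - ‖w‖ ^ 2) ^ n * (13 ^ (2 * n) * t ^ n) := by
            gcongr
            nlinarith [norm_nonneg w]
    have h3 := setLIntegral_mono' (μ := sigma n) hS key
    rw [setLIntegral_const] at h3
    have h4 := h3.trans (setLIntegral_le_lintegral _ _)
    rw [lintegral_poissonKernel hwlt, ENNReal.ofReal_inv_of_pos hc] at h4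
    have h5 := mul_le_mul_right h4 (ENNReal.ofReal (13 ^ (2 * n) * t ^ n))
    rwa [← mul_assoc, ENNReal.mul_inv_cancel (by simpa using hc) ENNReal.ofReal_ne_top, one_mul,
      mul_one] at h5

/-- `weak_type` with m = σ, s = 1 and Z ξ = τ(ξ)ξ, where τ(ξ) is a radius at which f exceeds λ. No
measurability of τ is required. If Z ξ lies in a tent of size 6t then 1-τ(ξ) ≤ 6t, so ξ itself lies
in the tent of size 12t. -/
lemma radial_weak_type_of_lt {n : ℕ} [NeZero n] {r : ℝ} (hr : 1 < r) {f : Cn n → ℂ}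
    (hf : DifferentiableOn ℂ f (Metric.ball 0 r)) {lam : ℝ≥0∞} (hl0 : lam ≠ 0) (hltop : lam ≠ ∞) :
    sigma n {ξ | ∃ t ∈ Ioo (0 : ℝ) 1, lam < ‖f (t • (ξ : Cn n))‖ₑ} ≤
      ENNReal.ofReal (13 ^ (2 * n)) * (ENNReal.ofReal (2 * 4 ^ n) *
        (lam⁻¹ * ∫⁻ ξ : unitSphere n, ‖f ξ‖ₑ ∂(sigma n))) := by
  classical
  set E : Set (unitSphere n) := {ξ | ∃ t ∈ Ioo (0 : ℝ) 1, lam < ‖f (t • (ξ : Cn n))‖ₑ} with hE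
  have hfc : Continuous fun ξ : unitSphere n => f ξ :=
    hf.continuousOn.comp_continuous continuous_subtype_val fun ξ => by
      rw [mem_ball_zero_iff, norm_eq_of_mem_sphere]; exact hr
  have hsel : ∀ ξ : unitSphere n, ∃ t : ℝ, ξ ∈ E → t ∈ Ioo (0 : ℝ) 1 ∧
      lam < ‖f (t • (ξ : Cn n))‖ₑ := by
    intro ξ
    by_cases hξ : ξ ∈ E
    · obtain ⟨t, ht⟩ := hξ
      exact ⟨t, fun _ => ht⟩
    · exact ⟨0, fun h => absurd h hξ⟩
  choose τ hτ using hsel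
  have hZ : ∀ ξ ∈ E, ‖τ ξ • (ξ : Cn n)‖ = τ ξ := fun ξ hξ => norm_smul_sphere (hτ ξ hξ).1.1.le ξ
  have h := weak_type (sigma n) (fun ξ : unitSphere n => τ ξ • (ξ : Cn n)) E (g := fun ξ => ‖f ξ‖ₑ)
    hfc.enorm.measurable ?_ hl0 hltop le_rfl (ENNReal.ofReal (13 ^ (2 * n))) ?_ ?_ ?_
  · simpa only [ENNReal.rpow_one] using h
  · have := (Continuous.integrable_sigma hfc).2
    exact this.ne
  · intro ξ hξ
    rw [hZ ξ hξ]
    exact (hτ ξ hξ).1.2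
  · intro ξ hξ
    exact (hτ ξ hξ).2.trans_le (enorm_le_poisson hr hf (by rw [hZ ξ hξ]; exact (hτ ξ hξ).1.2))
  · intro a ha t hat
    rw [ENNReal.rpow_one]
    refine (measure_mono ?_).trans (sigma_tent_le ha hat)
    rintro ξ ⟨hξ, h6⟩
    have ht := (hτ ξ hξ).1
    have h1 := one_sub_norm_le (τ ξ • (ξ : Cn n)) a ha.le
    rw [hZ ξ hξ] at h1
    have h2 : ‖inner ℂ a (ξ : Cn n)‖ ≤ 1 := (norm_inner_sphere_le a ξ).trans ha.le
    have h3 : 1 - inner ℂ a (ξ : Cn n) = (1 - inner ℂ a (τ ξ • (ξ : Cn n))) -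
        ((1 - τ ξ : ℝ) : ℂ) * inner ℂ a (ξ : Cn n) := by
      rw [inner_real_smul_right]; push_cast; ring
    rw [mem_ofPred_eq, h3]
    refine (norm_sub_le _ _).trans ?_
    rw [norm_mul, Complex.norm_real, Real.norm_of_nonneg (by linarith [ht.2])]
    nlinarith [ht.2]

/-- The radial maximal function is of weak type on `H^1`. -/
theorem radial_weak_type {n : ℕ} [NeZero n] {f : Cn n → ℂ}
    (hf : DifferentiableOn ℂ f (unitBall n)) {lam : ℝ≥0∞} (hl0 : lam ≠ 0) (hltop : lam ≠ ∞)
    {B : ℝ≥0∞} (hB : ∀ ρ ∈ Ioo (0 : ℝ) 1, hardyMean 1 f ρ ≤ B) :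
    sigma n {ξ | ∃ t ∈ Ioo (0 : ℝ) 1, lam < ‖f (t • (ξ : Cn n))‖ₑ} ≤
      ENNReal.ofReal (13 ^ (2 * n)) * (ENNReal.ofReal (2 * 4 ^ n) * (lam⁻¹ * B)) := by
  -- Restricting to radii below ρ reduces to the dilate f(ρ·), which is holomorphic across the
  -- sphere; the sets increase as ρ → 1.
  set E : ℝ → Set (unitSphere n) := fun ρ =>
    {ξ | ∃ t ∈ Ioo (0 : ℝ) ρ, lam < ‖f (t • (ξ : Cn n))‖ₑ} with hE
  set ρ : ℕ → ℝ := fun k => 1 - 1 / ((k : ℝ) + 2) with hρ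
  have hρI : ∀ k, ρ k ∈ Ioo (0 : ℝ) 1 := by
    intro k
    have h1 : (0 : ℝ) < (k : ℝ) + 2 := by positivity
    have h2 : 1 / ((k : ℝ) + 2) < 1 := by
      rw [div_lt_one h1]; linarith [(Nat.cast_nonneg k : (0 : ℝ) ≤ k)]
    have h3 : 0 < 1 / ((k : ℝ) + 2) := by positivity
    exact ⟨by simp only [hρ]; linarith, by simp only [hρ]; linarith⟩
  have hmono : Monotone fun k => E (ρ k) := by
    intro k l hkl ξ hξ
    obtain ⟨t, ht, h⟩ := hξ
    refine ⟨t, ⟨ht.1, ht.2.trans_le ?_⟩, h⟩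
    have : (k : ℝ) ≤ l := by exact_mod_cast hkl
    simp only [hρ]
    gcongr
  have hun : {ξ : unitSphere n | ∃ t ∈ Ioo (0 : ℝ) 1, lam < ‖f (t • (ξ : Cn n))‖ₑ} ⊆
      ⋃ k, E (ρ k) := by
    rintro ξ ⟨t, ht, h⟩
    obtain ⟨k, hk⟩ := exists_nat_one_div_lt (show 0 < 1 - t by linarith [ht.2])
    refine mem_iUnion.2 ⟨k, t, ⟨ht.1, ?_⟩, h⟩
    have : 1 / ((k : ℝ) + 2) ≤ 1 / ((k : ℝ) + 1) := by gcongr; norm_num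
    simp only [hρ]
    linarith
  refine (measure_mono hun).trans ?_
  rw [hmono.measure_iUnion]
  refine iSup_le fun k => ?_
  change sigma n (E (ρ k)) ≤ _
  have h := radial_weak_type_of_lt ((one_lt_inv₀ (hρI k).1).2 (hρI k).2)
    (differentiableOn_dilate hf (hρI k).1) hl0 hltop
  have hsub : E (ρ k) ⊆ {ξ | ∃ t ∈ Ioo (0 : ℝ) 1, lam < ‖f (ρ k • t • (ξ : Cn n))‖ₑ} := by
    rintro ξ ⟨t, ht, h⟩
    refine ⟨t / ρ k, ⟨div_pos ht.1 (hρI k).1, (div_lt_one (hρI k).1).2 ht.2⟩, ?_⟩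
    rwa [smul_smul, mul_div_cancel₀ _ (hρI k).1.ne']
  refine ((measure_mono hsub).trans h).trans ?_
  gcongr
  have := hB _ (hρI k)
  simpa only [hardyMean, ENNReal.rpow_one] using this

/-- Functions in `H^q` with `q > 1` have radial limits almost everywhere. -/
theorem ae_exists_radialLimit {n : ℕ} [NeZero n] {q : ℝ} (hq : 1 < q) {f : Cn n → ℂ}
    (hf : DifferentiableOn ℂ f (unitBall n)) (hfq : hardyENorm q f < ∞) :
    ∀ᵐ ξ : unitSphere n ∂(sigma n), ∃ l, Tendsto (fun r : ℝ => f (r • (ξ : Cn n))) (𝓝[<] 1) (𝓝 l) := by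
  -- Points where the radial oscillation of f at the boundary exceeds 3ε.
  set bad : ℝ → Set (unitSphere n) := fun ε => {ξ | ∀ r₁ ∈ Ioo (0 : ℝ) 1, ∃ r ∈ Ioo r₁ 1,
    ∃ s ∈ Ioo r₁ 1, 3 * ε < ‖f (r • (ξ : Cn n)) - f (s • (ξ : Cn n))‖} with hbad
  have hzero : ∀ ε > 0, sigma n (bad ε) = 0 := by
    intro ε hε
    have hbound : ∀ η : ℝ, 0 < η → sigma n (bad ε) ≤ ENNReal.ofReal (13 ^ (2 * n)) *
        (ENNReal.ofReal (2 * 4 ^ n) * ((ENNReal.ofReal ε)⁻¹ * ENNReal.ofReal η)) := by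
      intro η hη
      obtain ⟨r₁, hr₁, hc⟩ := exists_dilate_cauchy hq hf hfq (Real.rpow_pos_of_pos hη q)
      obtain ⟨u, hu1, hu2⟩ := exists_between hr₁.2
      have hu0 : 0 < u := hr₁.1.trans hu1
      -- f is compared with its dilate f(u·): the difference is small in mean, and f(u·) is
      -- continuous up to the sphere.
      have hh : DifferentiableOn ℂ (fun z => f z - f (u • z)) (unitBall n) :=
        hf.sub ((differentiableOn_dilate hf hu0).mono
          (Metric.ball_subset_ball ((one_le_inv₀ hu0).2 hu2.le)))
      have hB : ∀ ρ ∈ Ioo (0 : ℝ) 1,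
          hardyMean 1 (fun z => f z - f (u • z)) ρ ≤ ENNReal.ofReal η := by
        intro ρ hρ
        -- Monotonicity of the means allows ρ to be raised to ρ' > r₁/u, so that both radii ρ' and
        -- uρ' lie beyond r₁.
        have hru : r₁ / u < 1 := (div_lt_one hu0).2 hu1
        obtain ⟨ρ', h1, h2⟩ := exists_between (max_lt hρ.2 hru)
        have hρρ' : ρ < ρ' := (le_max_left _ _).trans_lt h1
        have hρ'0 : 0 < ρ' := hρ.1.trans hρρ'
        have h3 : r₁ < u * ρ' := by
          have := (le_max_right _ _).trans_lt h1
          rwa [div_lt_iff₀ hu0, mul_comm] at this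
        have h4 : u * ρ' ≤ ρ' := mul_le_of_le_one_left hρ'0.le hu2.le
        have h5 := hc ρ' ⟨h3.le.trans h4, h2⟩ (u * ρ') ⟨h3.le, h4.trans_lt h2⟩
        refine (hardyMean_mono le_rfl hh hρ.1.le hρρ'.le h2).trans ?_
        have hm : Measurable fun ξ : unitSphere n =>
            ‖f (ρ' • (ξ : Cn n)) - f (u • ρ' • (ξ : Cn n))‖ₑ :=
          (continuous_dilate hh ⟨hρ'0, h2⟩).enorm.measurable
        have h6 := lintegral_rpow_le_of_prob (ν := sigma n) hq.le hm.aemeasurable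
        simp only [smul_smul] at h6
        have h7 := h6.trans h5
        rw [← ENNReal.ofReal_rpow_of_nonneg hη.le (by linarith),
          ENNReal.rpow_le_rpow_iff (by linarith)] at h7
        simpa only [hardyMean, ENNReal.rpow_one, smul_smul] using h7
      have hw := radial_weak_type hh (lam := ENNReal.ofReal ε) (by simpa using hε)
        ENNReal.ofReal_ne_top hB
      refine (measure_mono ?_).trans hw
      intro ξ hξ
      have hcu : Continuous fun z : ℝ => u * z := continuous_const.mul continuous_id
      -- Near the boundary f(u·) oscillates by less than ε, so an oscillation above 3ε of f forces
      -- the difference to exceed ε somewhere on the radius.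
      have hfc : ContinuousAt (fun r : ℝ => f (u • r • (ξ : Cn n))) 1 := by
        have : ContinuousAt f (u • (1 : ℝ) • (ξ : Cn n)) := by
          rw [one_smul]
          exact hf.continuousOn.continuousAt
            (Metric.isOpen_ball.mem_nhds (smul_mem_unitBall ⟨hu0, hu2⟩ ξ))
        refine ContinuousAt.comp (f := fun r : ℝ => u • r • (ξ : Cn n)) this ?_
        fun_prop
      have hev := (Metric.continuousAt_iff.1 hfc) (ε / 2) (by positivity)
      obtain ⟨δ, hδ, hδc⟩ := hev
      obtain ⟨r₂, h21, h22⟩ := exists_between (max_lt one_pos (show 1 - δ < 1 by linarith))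
      have hr₂0 : 0 < r₂ := (le_max_left _ _).trans_lt h21
      have hclose : ∀ r ∈ Ioo r₂ 1, dist (f (u • r • (ξ : Cn n))) (f (u • (1 : ℝ) • (ξ : Cn n))) <
          ε / 2 := by
        intro r hr
        refine hδc ?_
        rw [Real.dist_eq, abs_lt]
        have := (le_max_right _ _).trans_lt h21
        constructor <;> linarith [hr.1, hr.2]
      obtain ⟨r, hr, s, hs, hrs⟩ := hξ r₂ ⟨hr₂0, h22⟩
      by_contra hcon
      have hsmall : ∀ t ∈ Ioo r₂ 1, ‖f (t • (ξ : Cn n)) - f (u • t • (ξ : Cn n))‖ ≤ ε := by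
        intro t ht
        by_contra! hlt
        refine hcon ⟨t, ⟨hr₂0.trans ht.1, ht.2⟩, ?_⟩
        rw [← ofReal_norm]
        exact (ENNReal.ofReal_lt_ofReal_iff (hε.trans hlt)).2 hlt
      have e1 := hsmall r hr
      have e2 := hsmall s hs
      have e3 := hclose r hr
      have e4 := hclose s hs
      rw [dist_eq_norm] at e3 e4
      set c := f (u • (1 : ℝ) • (ξ : Cn n))
      have e5 : f (r • (ξ : Cn n)) - f (s • (ξ : Cn n)) =
          (f (r • (ξ : Cn n)) - f (u • r • (ξ : Cn n))) -
          (f (s • (ξ : Cn n)) - f (u • s • (ξ : Cn n))) +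
          ((f (u • r • (ξ : Cn n)) - c) - (f (u • s • (ξ : Cn n)) - c)) := by ring
      rw [e5] at hrs
      have e6 := norm_add_le ((f (r • (ξ : Cn n)) - f (u • r • (ξ : Cn n))) -
          (f (s • (ξ : Cn n)) - f (u • s • (ξ : Cn n))))
          ((f (u • r • (ξ : Cn n)) - c) - (f (u • s • (ξ : Cn n)) - c))
      have e7 := norm_sub_le (f (r • (ξ : Cn n)) - f (u • r • (ξ : Cn n)))
          (f (s • (ξ : Cn n)) - f (u • s • (ξ : Cn n)))
      have e8 := norm_sub_le (f (u • r • (ξ : Cn n)) - c) (f (u • s • (ξ : Cn n)) - c)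
      linarith
    set K := ENNReal.ofReal (13 ^ (2 * n)) *
        (ENNReal.ofReal (2 * 4 ^ n) * (ENNReal.ofReal ε)⁻¹) with hK
    have hKtop : K ≠ ∞ := ENNReal.mul_ne_top ENNReal.ofReal_ne_top
      (ENNReal.mul_ne_top ENNReal.ofReal_ne_top (ENNReal.inv_ne_top.2 (by simpa using hε)))
    have hlim : Tendsto (fun η : ℝ => K * ENNReal.ofReal η) (𝓝[>] 0) (𝓝 0) := by
      have h1 : Tendsto (fun η : ℝ => ENNReal.ofReal η) (𝓝[>] 0) (𝓝 (ENNReal.ofReal 0)) :=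
        (ENNReal.continuous_ofReal.tendsto 0).mono_left nhdsWithin_le_nhds
      have h2 := ENNReal.Tendsto.const_mul h1 (Or.inr hKtop)
      simpa using h2
    refine le_antisymm (ge_of_tendsto hlim ?_) (zero_le)
    filter_upwards [self_mem_nhdsWithin] with η hη
    refine (hbound η hη).trans_eq ?_
    rw [hK]; ring
  have hall : ∀ᵐ ξ ∂(sigma n), ∀ k : ℕ, ξ ∉ bad (1 / ((k : ℝ) + 1)) :=
    ae_all_iff.2 fun k => measure_eq_zero_iff_ae_notMem.1 (hzero _ (by positivity))
  filter_upwards [hall] with ξ hξ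
  refine cauchy_map_iff_exists_tendsto.1 ?_
  rw [Metric.cauchy_iff]
  refine ⟨inferInstance, fun ε hε => ?_⟩
  obtain ⟨k, hk⟩ := exists_nat_one_div_lt (show 0 < ε / 3 by positivity)
  have h := hξ k
  simp only [hbad, mem_ofPred_eq, not_forall, not_exists, not_and, not_lt] at h
  obtain ⟨r₁, hr₁, h⟩ := h
  refine ⟨(fun r : ℝ => f (r • (ξ : Cn n))) '' Ioo r₁ 1,
    image_mem_map (Ioo_mem_nhdsLT hr₁.2), ?_⟩
  rintro _ ⟨r, hr, rfl⟩ _ ⟨s, hs, rfl⟩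
  rw [dist_eq_norm]
  exact (h r hr s hs).trans_lt (by linarith)

/-! ### Boundary functions and the Hardy norm -/

/-- A standard sequence of radii increasing to one. -/
def radius (k : ℕ) : ℝ := 1 - 1 / ((k : ℝ) + 2)

lemma radius_mem (k : ℕ) : radius k ∈ Ioo (0 : ℝ) 1 := by
  have h1 : (0 : ℝ) < (k : ℝ) + 2 := by positivity
  have h2 : 1 / ((k : ℝ) + 2) < 1 := by
    rw [div_lt_one h1]; linarith [(Nat.cast_nonneg k : (0 : ℝ) ≤ k)]
  have h3 : 0 < 1 / ((k : ℝ) + 2) := by positivity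
  exact ⟨by simp only [radius]; linarith, by simp only [radius]; linarith⟩

lemma tendsto_radius : Tendsto radius atTop (𝓝[<] 1) := by
  refine tendsto_nhdsWithin_iff.2 ⟨?_, Eventually.of_forall fun k => (radius_mem k).2⟩
  have h1 : Tendsto (fun k : ℕ => 1 / ((k : ℝ) + 2)) atTop (𝓝 0) := by
    have := (tendsto_add_atTop_iff_nat 1).2 (tendsto_one_div_add_atTop_nhds_zero_nat (𝕜 := ℝ))
    refine this.congr fun k => ?_
    push_cast
    ring
  have h2 := (tendsto_const_nhds (x := (1 : ℝ))).sub h1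
  rwa [sub_zero] at h2

lemma ae_tendsto_radialLimit {n : ℕ} [NeZero n] {q : ℝ} (hq : 1 < q) {f : Cn n → ℂ}
    (hf : DifferentiableOn ℂ f (unitBall n)) (hfq : hardyENorm q f < ∞) :
    ∀ᵐ ξ : unitSphere n ∂(sigma n),
      Tendsto (fun r : ℝ => f (r • (ξ : Cn n))) (𝓝[<] 1) (𝓝 (radialLimit f ξ)) := by
  filter_upwards [ae_exists_radialLimit hq hf hfq] with ξ hξ
  exact tendsto_nhds_limUnder hξ

lemma hardyENorm_lt_top_of_bounded {n : ℕ} [NeZero n] {q : ℝ} (hq : 1 ≤ q) {f : Cn n → ℂ} {C : ℝ}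
    (hC : ∀ z ∈ unitBall n, ‖f z‖ ≤ C) : hardyENorm q f < ∞ := by
  have h : hardyENorm q f ^ q ≤ ENNReal.ofReal C ^ q := by
    refine hardyENorm_rpow_le hq f fun r hr => ?_
    calc hardyMean q f r ≤ ∫⁻ _ : unitSphere n, ENNReal.ofReal C ^ q ∂(sigma n) := by
          refine lintegral_mono fun ξ => ENNReal.rpow_le_rpow ?_ (by linarith)
          rw [← ofReal_norm]
          exact ENNReal.ofReal_le_ofReal (hC _ (smul_mem_unitBall hr ξ))
      _ = _ := by simp
  rw [ENNReal.rpow_le_rpow_iff (by linarith)] at h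
  exact h.trans_lt ENNReal.ofReal_lt_top

/-- Holomorphic self-maps of the ball have radial limits almost everywhere. -/
lemma ae_tendsto_radialLimit_of_mapsTo {n : ℕ} [NeZero n] {φ : Cn n → Cn n}
    (hφ : DifferentiableOn ℂ φ (unitBall n)) (hφB : MapsTo φ (unitBall n) (unitBall n)) :
    ∀ᵐ ξ : unitSphere n ∂(sigma n),
      Tendsto (fun r : ℝ => φ (r • (ξ : Cn n))) (𝓝[<] 1) (𝓝 (radialLimit φ ξ)) := by
  have hcoord : ∀ᵐ ξ : unitSphere n ∂(sigma n), ∀ i,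
      ∃ l, Tendsto (fun r : ℝ => φ (r • (ξ : Cn n)) i) (𝓝[<] 1) (𝓝 l) := by
    refine ae_all_iff.2 fun i => ?_
    refine ae_exists_radialLimit one_lt_two (f := fun z => φ z i) ?_ ?_
    · exact (EuclideanSpace.proj (𝕜 := ℂ) i).differentiable.comp_differentiableOn hφ
    · refine hardyENorm_lt_top_of_bounded one_le_two (C := 1) fun z hz => ?_
      exact (PiLp.norm_apply_le (φ z) i).trans (mem_ball_zero_iff.1 (hφB hz)).le
  filter_upwards [hcoord] with ξ hξ
  choose l hl using hξ
  refine tendsto_nhds_limUnder ⟨WithLp.toLp 2 l, ?_⟩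
  have h1 : Tendsto (fun r : ℝ => WithLp.ofLp (φ (r • (ξ : Cn n)))) (𝓝[<] 1) (𝓝 l) :=
    tendsto_pi_nhds.2 hl
  exact ((PiLp.continuous_toLp 2 (fun _ : Fin n => ℂ)).tendsto l).comp h1

lemma aemeasurable_radialLimit {n : ℕ} {F : Type*} [NormedAddCommGroup F] [MeasurableSpace F]
    [BorelSpace F] {f : Cn n → F} {g : unitSphere n → F} (hf : ContinuousOn f (unitBall n))
    (h : ∀ᵐ ξ : unitSphere n ∂(sigma n),
      Tendsto (fun r : ℝ => f (r • (ξ : Cn n))) (𝓝[<] 1) (𝓝 (g ξ))) :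
    AEMeasurable g (sigma n) := by
  refine aemeasurable_of_tendsto_metrizable_ae atTop
    (f := fun (k : ℕ) (ξ : unitSphere n) => f (radius k • (ξ : Cn n))) (fun k => ?_) ?_
  · have : Continuous fun ξ : unitSphere n => f (radius k • (ξ : Cn n)) :=
      hf.comp_continuous (by fun_prop) (smul_mem_unitBall (radius_mem k))
    exact this.measurable.aemeasurable
  · filter_upwards [h] with ξ hξ
    exact hξ.comp tendsto_radius

lemma tendsto_enorm_rpow {α : Type*} {l : Filter α} {u : α → ℂ} {a : ℂ} (q : ℝ)
    (h : Tendsto u l (𝓝 a)) : Tendsto (fun x => ‖u x‖ₑ ^ q) l (𝓝 (‖a‖ₑ ^ q)) :=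
  (ENNReal.continuous_rpow_const.tendsto _).comp (h.enorm)

/-- The boundary function is at most as large as the Hardy norm. -/
lemma lintegral_boundary_le {n : ℕ} [NeZero n] {q : ℝ} (hq : 1 ≤ q) {f : Cn n → ℂ}
    (hf : DifferentiableOn ℂ f (unitBall n)) {g : unitSphere n → ℂ}
    (h : ∀ᵐ ξ : unitSphere n ∂(sigma n),
      Tendsto (fun r : ℝ => f (r • (ξ : Cn n))) (𝓝[<] 1) (𝓝 (g ξ))) :
    ∫⁻ ξ, ‖g ξ‖ₑ ^ q ∂(sigma n) ≤ hardyENorm q f ^ q := by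
  calc ∫⁻ ξ, ‖g ξ‖ₑ ^ q ∂(sigma n)
      = ∫⁻ ξ : unitSphere n, liminf (fun k => ‖f (radius k • (ξ : Cn n))‖ₑ ^ q) atTop
          ∂(sigma n) := by
        refine lintegral_congr_ae ?_
        filter_upwards [h] with ξ hξ
        exact ((tendsto_enorm_rpow q (hξ.comp tendsto_radius)).liminf_eq).symm
    _ ≤ liminf (fun k => hardyMean q f (radius k)) atTop :=
        lintegral_liminf_le fun k =>
          (continuous_dilate hf (radius_mem k)).enorm.measurable.pow_const q
    _ ≤ _ := by
        refine liminf_le_of_le (by isBoundedDefault) fun b hb => ?_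
        obtain ⟨k, hk⟩ := hb.exists
        exact hk.trans (hardyMean_le hq f (radius_mem k))

/-- The integral means of a function in `H^q`, `q > 1`, are bounded by its boundary function. -/
lemma hardyMean_le_boundary {n : ℕ} [NeZero n] {q : ℝ} (hq : 1 < q) {f : Cn n → ℂ}
    (hf : DifferentiableOn ℂ f (unitBall n)) (hfq : hardyENorm q f < ∞) {g : unitSphere n → ℂ}
    (h : ∀ᵐ ξ : unitSphere n ∂(sigma n),
      Tendsto (fun r : ℝ => f (r • (ξ : Cn n))) (𝓝[<] 1) (𝓝 (g ξ)))
    {R : ℝ} (hR : R ∈ Ioo (0 : ℝ) 1) :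
    hardyMean q f R ≤ ∫⁻ ξ, ‖g ξ‖ₑ ^ q ∂(sigma n) := by
  have hq0 : 0 < q := by linarith
  have hg := aemeasurable_radialLimit hf.continuousOn h
  have key : ∀ ε : ℝ, 0 < ε → hardyMean q f R ^ (1 / q) ≤
      (∫⁻ ξ, ‖g ξ‖ₑ ^ q ∂(sigma n)) ^ (1 / q) + ENNReal.ofReal ε := by
    intro ε hε
    obtain ⟨r₁, hr₁, hc⟩ := exists_dilate_cauchy hq hf hfq (Real.rpow_pos_of_pos hε q)
    set r := max r₁ R with hr
    have hr1 : r < 1 := max_lt hr₁.2 hR.2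
    have hrI : r ∈ Ioo (0 : ℝ) 1 := ⟨lt_max_of_lt_left hr₁.1, hr1⟩
    have hfr := continuous_dilate hf hrI
    -- Fatou's lemma turns the Cauchy property of the dilates into convergence in mean to the
    -- boundary function.
    have hdiff : ∫⁻ ξ : unitSphere n, ‖f (r • (ξ : Cn n)) - g ξ‖ₑ ^ q ∂(sigma n) ≤
        ENNReal.ofReal ε ^ q := by
      calc ∫⁻ ξ : unitSphere n, ‖f (r • (ξ : Cn n)) - g ξ‖ₑ ^ q ∂(sigma n)
          = ∫⁻ ξ : unitSphere n, liminf (fun k =>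
              ‖f (r • (ξ : Cn n)) - f (radius k • (ξ : Cn n))‖ₑ ^ q) atTop ∂(sigma n) := by
            refine lintegral_congr_ae ?_
            filter_upwards [h] with ξ hξ
            exact ((tendsto_enorm_rpow q
              (tendsto_const_nhds.sub (hξ.comp tendsto_radius))).liminf_eq).symm
        _ ≤ liminf (fun k => ∫⁻ ξ : unitSphere n,
              ‖f (r • (ξ : Cn n)) - f (radius k • (ξ : Cn n))‖ₑ ^ q ∂(sigma n)) atTop :=
            lintegral_liminf_le fun k =>
              (hfr.sub (continuous_dilate hf (radius_mem k))).enorm.measurable.pow_const q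
        _ ≤ _ := by
            refine liminf_le_of_le (by isBoundedDefault) fun b hb => ?_
            have hev : ∀ᶠ k in atTop, radius k ∈ Ico r₁ 1 :=
              tendsto_radius.eventually (Ico_mem_nhdsLT hr₁.2)
            obtain ⟨k, hk, hk2⟩ := (hb.and hev).exists
            refine hk.trans ((hc r ⟨le_max_left _ _, hr1⟩ _ hk2).trans_eq ?_)
            rw [ENNReal.ofReal_rpow_of_nonneg hε.le hq0.le]
    have h1 := ENNReal.lintegral_Lp_add_le (μ := sigma n) (p := q) (f := fun ξ => ‖g ξ‖ₑ)
      (g := fun ξ : unitSphere n => ‖f (r • (ξ : Cn n)) - g ξ‖ₑ) hg.enorm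
      (hfr.measurable.aemeasurable.sub hg).enorm hq.le
    calc hardyMean q f R ^ (1 / q) ≤ hardyMean q f r ^ (1 / q) :=
          ENNReal.rpow_le_rpow (hardyMean_mono hq.le hf hR.1.le (le_max_right _ _) hr1)
            (by positivity)
      _ ≤ (∫⁻ ξ : unitSphere n, (‖g ξ‖ₑ + ‖f (r • (ξ : Cn n)) - g ξ‖ₑ) ^ q ∂(sigma n)) ^
            (1 / q) := by
          refine ENNReal.rpow_le_rpow (lintegral_mono fun ξ => ?_) (by positivity)
          refine ENNReal.rpow_le_rpow ?_ hq0.le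
          calc ‖f (r • (ξ : Cn n))‖ₑ = ‖g ξ + (f (r • (ξ : Cn n)) - g ξ)‖ₑ := by
                rw [add_sub_cancel]
            _ ≤ _ := enorm_add_le _ _
      _ ≤ _ := by
          refine h1.trans ?_
          gcongr
          refine (ENNReal.rpow_le_rpow hdiff (by positivity)).trans_eq ?_
          rw [← ENNReal.rpow_mul, mul_one_div_cancel hq0.ne', ENNReal.rpow_one]
  have h2 : hardyMean q f R ^ (1 / q) ≤ (∫⁻ ξ, ‖g ξ‖ₑ ^ q ∂(sigma n)) ^ (1 / q) := by
    refine ENNReal.le_of_forall_pos_le_add fun ε hε _ => ?_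
    simpa using key ε (by exact_mod_cast hε)
  exact (ENNReal.rpow_le_rpow_iff (by positivity)).1 h2

/-! ### The Carleson embedding theorem -/

/-- The constant in the Carleson embedding theorem below. -/
def embeddingConst (n : ℕ) (p q : ℝ) : ℝ≥0∞ :=
  ENNReal.ofReal q * (ENNReal.ofReal (2 * 4 ^ n) ^ (q / p) *
    (ENNReal.ofReal (2 ^ (q - p + 1)) * ((ENNReal.ofReal (p - 1))⁻¹ * ENNReal.ofReal (2 ^ (p - 1)))))

lemma embeddingConst_ne_top (n : ℕ) {p q : ℝ} (hp : 1 < p) (hpq : p ≤ q) :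
    embeddingConst n p q ≠ ∞ := by
  refine ENNReal.mul_ne_top ENNReal.ofReal_ne_top (ENNReal.mul_ne_top
    (ENNReal.rpow_ne_top_of_nonneg (div_nonneg (by linarith) (by linarith)) ENNReal.ofReal_ne_top)
    (ENNReal.mul_ne_top ENNReal.ofReal_ne_top (ENNReal.mul_ne_top ?_ ENNReal.ofReal_ne_top)))
  rw [ENNReal.inv_ne_top]
  simpa using hp

/-- The Carleson embedding theorem for functions which are holomorphic across the sphere. -/
theorem carleson_embedding {n : ℕ} [NeZero n] {X : Type*} [MeasurableSpace X] (m : Measure X)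
    {Z : X → Cn n} (hZm : Measurable Z) (hZ : ∀ x, ‖Z x‖ < 1) {p q : ℝ} (hp : 1 < p) (hpq : p ≤ q)
    {A : ℝ≥0∞} (hA : ∀ a, ‖a‖ < 1 → ∀ t, 1 - ‖a‖ ≤ t →
      m {x | ‖1 - inner ℂ a (Z x)‖ ≤ 6 * t} ≤ A * ENNReal.ofReal (t ^ n) ^ (q / p))
    {r : ℝ} (hr : 1 < r) {f : Cn n → ℂ} (hf : DifferentiableOn ℂ f (Metric.ball 0 r)) :
    ∫⁻ x, ‖f (Z x)‖ₑ ^ q ∂m ≤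
      embeddingConst n p q * (A * (∫⁻ ξ : unitSphere n, ‖f ξ‖ₑ ^ p ∂(sigma n)) ^ (q / p)) := by
  have hp0 : 0 < p := by linarith
  have hq0 : 0 < q := by linarith
  have hs : 1 ≤ q / p := (one_le_div hp0).2 hpq
  set s := q / p with hsdef
  have hps : p * (s - 1) = q - p := by rw [hsdef]; field_simp
  have hfc : Continuous fun ξ : unitSphere n => f ξ :=
    hf.continuousOn.comp_continuous continuous_subtype_val fun ξ => by
      rw [mem_ball_zero_iff, norm_eq_of_mem_sphere]; exact hr
  have hfe : Measurable fun ξ : unitSphere n => ‖f ξ‖ₑ := hfc.enorm.measurable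
  have hfZ : Measurable fun x => ‖f (Z x)‖ := by
    have h1 : Measurable (Set.domRestrict (unitBall n) f) :=
      (hf.continuousOn.mono (Metric.ball_subset_ball hr.le)).domRestrict.measurable
    exact (h1.comp (hZm.subtype_mk (h := fun x => mem_ball_zero_iff.2 (hZ x)))).norm
  set G := ∫⁻ ξ : unitSphere n, ‖f ξ‖ₑ ^ p ∂(sigma n) with hG
  set K := ENNReal.ofReal (2 * 4 ^ n) with hK
  -- Marcinkiewicz splitting at height t/2: the part of |f| below t/2 has Poisson integral at most
  -- t/2, so where |f(Z)| > t the Poisson integral of the part on S t exceeds t/2.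
  set S : ℝ → Set (unitSphere n) := fun t => {ξ | t < 2 * ‖f ξ‖} with hS
  have hSm : ∀ t, MeasurableSet (S t) := fun t =>
    measurableSet_lt measurable_const (hfc.norm.measurable.const_mul 2)
  set H : ℝ → ℝ≥0∞ := fun t => ∫⁻ ξ in S t, ‖f ξ‖ₑ ∂(sigma n) with hH
  have hlevel : ∀ t : ℝ, 0 < t → m {x | t < ‖f (Z x)‖} ≤
      A * (K * ((ENNReal.ofReal (t / 2))⁻¹ * H t)) ^ s := by
    intro t ht
    have hg : Measurable ((S t).indicator fun ξ : unitSphere n => ‖f ξ‖ₑ) :=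
      hfe.indicator (hSm t)
    have hHt : ∫⁻ ξ, (S t).indicator (fun ξ : unitSphere n => ‖f ξ‖ₑ) ξ ∂(sigma n) = H t :=
      lintegral_indicator (hSm t) _
    rw [← hHt]
    refine weak_type m Z {x | t < ‖f (Z x)‖} hg ?_ (by simpa using ht) ENNReal.ofReal_ne_top hs A
      (fun x _ => hZ x) (fun x hx => ?_) fun a ha u hu =>
        (measure_mono fun x hx => hx.2).trans (hA a ha u hu)
    · rw [hHt]
      refine ne_top_of_le_ne_top (Continuous.integrable_sigma hfc).2.ne
        (setLIntegral_le_lintegral _ _)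
    · have h1 := enorm_le_poisson hr hf (hZ x)
      have h2 : ENNReal.ofReal t < ‖f (Z x)‖ₑ := by
        rw [← ofReal_norm]
        exact (ENNReal.ofReal_lt_ofReal_iff (ht.trans hx)).2 hx
      have h3 : ∫⁻ ξ : unitSphere n, ENNReal.ofReal (poissonKernel (Z x) ξ) * ‖f ξ‖ₑ ∂(sigma n) ≤
          (∫⁻ ξ : unitSphere n, ENNReal.ofReal (poissonKernel (Z x) ξ) *
            (S t).indicator (fun ξ : unitSphere n => ‖f ξ‖ₑ) ξ ∂(sigma n)) +
          ENNReal.ofReal (t / 2) := by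
        calc _ ≤ ∫⁻ ξ : unitSphere n, (ENNReal.ofReal (poissonKernel (Z x) ξ) *
              (S t).indicator (fun ξ : unitSphere n => ‖f ξ‖ₑ) ξ +
              ENNReal.ofReal (poissonKernel (Z x) ξ) * ENNReal.ofReal (t / 2)) ∂(sigma n) := by
              refine lintegral_mono fun ξ => ?_
              rw [← mul_add]
              refine mul_le_mul_right ?_ _
              by_cases hξ : ξ ∈ S t
              · rw [indicator_of_mem hξ]
                exact le_self_add
              · rw [indicator_of_notMem hξ, zero_add, ← ofReal_norm]
                refine ENNReal.ofReal_le_ofReal ?_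
                have : ¬ t < 2 * ‖f ξ‖ := hξ
                linarith
          _ = _ := by
              rw [lintegral_add_left (f := fun ξ : unitSphere n =>
                  ENNReal.ofReal (poissonKernel (Z x) ξ) *
                    (S t).indicator (fun ξ : unitSphere n => ‖f ξ‖ₑ) ξ)
                ((measurable_ofReal_poissonKernel (hZ x)).mul hg),
                lintegral_mul_const _ (measurable_ofReal_poissonKernel (hZ x)),
                lintegral_poissonKernel (hZ x), one_mul]
      have h4 := h2.trans_le (h1.trans h3)
      have h5 : ENNReal.ofReal t = ENNReal.ofReal (t / 2) + ENNReal.ofReal (t / 2) := by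
        rw [← ENNReal.ofReal_add (by positivity) (by positivity), add_halves]
      rw [h5] at h4
      exact lt_of_add_lt_add_right h4
  -- Of the s factors in the weak type bound one is kept linear in H t; the other s - 1 are
  -- estimated by Chebyshev through the p-mean G. As p(s-1) = q-p, the power t^(q-1) is reduced to
  -- t^(p-2).
  have hbound : ∀ t : ℝ, 0 < t → m {x | t < ‖f (Z x)‖} * ENNReal.ofReal (t ^ (q - 1)) ≤
      A * (K ^ s * (G ^ (s - 1) * ENNReal.ofReal (2 ^ (q - p + 1)))) *
        (H t * ENNReal.ofReal (t ^ (p - 1 - 1))) := by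
    intro t ht
    have ht2 : 0 < t / 2 := by positivity
    set a := ENNReal.ofReal (t / 2) with ha
    have ha0 : a ≠ 0 := by simpa [ha] using ht
    have hainv : a⁻¹ = ENNReal.ofReal (t / 2)⁻¹ := by rw [ENNReal.ofReal_inv_of_pos ht2]
    have hy : a⁻¹ * H t ≤ a⁻¹ ^ p * G := by
      rw [hH, hG, ← lintegral_const_mul _ hfe, ← lintegral_const_mul _ (hfe.pow_const p)]
      refine (setLIntegral_mono' (hSm t) fun ξ hξ => ?_).trans (setLIntegral_le_lintegral _ _)
      rw [← ENNReal.mul_rpow_of_nonneg _ _ hp0.le]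
      have h1 : 1 ≤ a⁻¹ * ‖f ξ‖ₑ := by
        rw [← ENNReal.inv_mul_cancel ha0 ENNReal.ofReal_ne_top]
        refine mul_le_mul_right ?_ _
        rw [← ofReal_norm]
        refine ENNReal.ofReal_le_ofReal ?_
        have : t < 2 * ‖f ξ‖ := hξ
        linarith
      conv_lhs => rw [← ENNReal.rpow_one (a⁻¹ * ‖f ξ‖ₑ)]
      exact ENNReal.rpow_le_rpow_of_exponent_le h1 hp.le
    have hys : (K * (a⁻¹ * H t)) ^ s ≤
        K ^ s * ((a⁻¹ * H t) * (a⁻¹ ^ (q - p) * G ^ (s - 1))) := by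
      rw [ENNReal.mul_rpow_of_nonneg _ _ (by linarith)]
      refine mul_le_mul_right ?_ _
      conv_lhs => rw [← add_sub_cancel 1 s]
      rw [ENNReal.rpow_add_of_nonneg _ _ zero_le_one (by linarith), ENNReal.rpow_one]
      refine mul_le_mul_right ?_ _
      refine (ENNReal.rpow_le_rpow hy (by linarith)).trans_eq ?_
      rw [ENNReal.mul_rpow_of_nonneg _ _ (by linarith), ← ENNReal.rpow_mul, hps]
    have hreal : a⁻¹ * a⁻¹ ^ (q - p) * ENNReal.ofReal (t ^ (q - 1)) =
        ENNReal.ofReal (2 ^ (q - p + 1)) * ENNReal.ofReal (t ^ (p - 1 - 1)) := by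
      rw [hainv, ENNReal.ofReal_rpow_of_pos (by positivity), ← ENNReal.ofReal_mul (by positivity),
        ← ENNReal.ofReal_mul (by positivity), ← ENNReal.ofReal_mul (by positivity)]
      congr 1
      have e1 : (t / 2)⁻¹ * (t / 2)⁻¹ ^ (q - p) = (2 * t⁻¹) ^ (q - p + 1) := by
        rw [show (t / 2)⁻¹ = 2 * t⁻¹ by field_simp, Real.rpow_add_one (by positivity), mul_comm]
      rw [e1, Real.mul_rpow (by positivity) (by positivity), Real.inv_rpow ht.le,
        ← Real.rpow_neg ht.le, mul_assoc, ← Real.rpow_add ht]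
      congr 2
      ring
    calc m {x | t < ‖f (Z x)‖} * ENNReal.ofReal (t ^ (q - 1))
        ≤ A * (K ^ s * ((a⁻¹ * H t) * (a⁻¹ ^ (q - p) * G ^ (s - 1)))) *
            ENNReal.ofReal (t ^ (q - 1)) := by
          refine mul_le_mul_left ((hlevel t ht).trans (mul_le_mul_right hys _)) _
      _ = A * (K ^ s * (G ^ (s - 1) * H t)) *
            (a⁻¹ * a⁻¹ ^ (q - p) * ENNReal.ofReal (t ^ (q - 1))) := by ring
      _ = _ := by rw [hreal]; ring
  set σ' := (sigma n).withDensity fun ξ : unitSphere n => ‖f ξ‖ₑ with hσ'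
  have hH' : ∀ t, H t = σ' {ξ | t < 2 * ‖f ξ‖} := fun t =>
    (withDensity_apply _ (hSm t)).symm
  have hp1 : ENNReal.ofReal (p - 1) ≠ 0 := by simpa using hp
  -- Layer cake for 2|f| against |f|σ with exponent p - 1; this is where p > 1 is needed.
  have hcake : ∫⁻ t in Ioi (0 : ℝ), H t * ENNReal.ofReal (t ^ (p - 1 - 1)) =
      (ENNReal.ofReal (p - 1))⁻¹ * (ENNReal.ofReal (2 ^ (p - 1)) * G) := by
    have h := lintegral_rpow_eq_lintegral_meas_lt_mul σ'
      (f := fun ξ : unitSphere n => 2 * ‖f ξ‖) (Eventually.of_forall fun ξ => by positivity)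
      (hfc.norm.measurable.const_mul 2).aemeasurable (p := p - 1) (by linarith)
    simp_rw [hH']
    have h2 : ∫⁻ ξ, ENNReal.ofReal ((2 * ‖f ξ‖) ^ (p - 1)) ∂σ' =
        ENNReal.ofReal (2 ^ (p - 1)) * G := by
      rw [hσ', lintegral_withDensity_eq_lintegral_mul _ hfe
        ((hfc.norm.measurable.const_mul 2).pow_const _).ennreal_ofReal, hG,
        ← lintegral_const_mul _ (hfe.pow_const p)]
      refine lintegral_congr fun ξ => ?_
      rw [Pi.mul_apply, Real.mul_rpow zero_le_two (norm_nonneg _),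
        ENNReal.ofReal_mul (by positivity), ← ENNReal.ofReal_rpow_of_nonneg (norm_nonneg _)
        (by linarith : 0 ≤ p - 1), ofReal_norm]
      conv_rhs => rw [← add_sub_cancel 1 p, ENNReal.rpow_add_of_nonneg _ _ zero_le_one
        (by linarith : 0 ≤ p - 1), ENNReal.rpow_one, add_sub_cancel]
      ring
    rw [← h2, h, ← mul_assoc, ENNReal.inv_mul_cancel hp1 ENNReal.ofReal_ne_top, one_mul]
  have hcakeq := lintegral_rpow_eq_lintegral_meas_lt_mul m (f := fun x => ‖f (Z x)‖)
    (Eventually.of_forall fun x => norm_nonneg _) hfZ.aemeasurable hq0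
  calc ∫⁻ x, ‖f (Z x)‖ₑ ^ q ∂m = ∫⁻ x, ENNReal.ofReal (‖f (Z x)‖ ^ q) ∂m := by
        refine lintegral_congr fun x => ?_
        rw [← ENNReal.ofReal_rpow_of_nonneg (norm_nonneg _) hq0.le, ofReal_norm]
    _ = ENNReal.ofReal q * ∫⁻ t in Ioi (0 : ℝ), m {x | t < ‖f (Z x)‖} *
          ENNReal.ofReal (t ^ (q - 1)) := hcakeq
    _ ≤ ENNReal.ofReal q * ∫⁻ t in Ioi (0 : ℝ),
          A * (K ^ s * (G ^ (s - 1) * ENNReal.ofReal (2 ^ (q - p + 1)))) *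
            (H t * ENNReal.ofReal (t ^ (p - 1 - 1))) :=
        mul_le_mul_right (setLIntegral_mono' measurableSet_Ioi fun t ht => hbound t ht) _
    _ = ENNReal.ofReal q * (A * (K ^ s * (G ^ (s - 1) * ENNReal.ofReal (2 ^ (q - p + 1)))) *
          ((ENNReal.ofReal (p - 1))⁻¹ * (ENNReal.ofReal (2 ^ (p - 1)) * G))) := by
        rw [lintegral_const_mul'', hcake]
        refine AEMeasurable.mul ?_ ?_
        · refine Measurable.aemeasurable (Antitone.measurable fun t u htu => ?_)
          exact lintegral_mono_set fun ξ hξ => lt_of_le_of_lt htu hξ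
        · exact (Measurable.ennreal_ofReal (by fun_prop)).aemeasurable
    _ = embeddingConst n p q * (A * G ^ s) := by
        conv_rhs => rw [← add_sub_cancel 1 s, ENNReal.rpow_add_of_nonneg _ _ zero_le_one
          (by linarith : 0 ≤ s - 1), ENNReal.rpow_one]
        rw [embeddingConst]
        ring

/-! ### From Poisson tests to a vanishing embedding -/

lemma norm_one_sub_inner_comm {n : ℕ} (x y : Cn n) :
    ‖1 - inner ℂ x y‖ = ‖1 - inner ℂ y x‖ := by
  rw [← Complex.norm_conj, map_sub, map_one, inner_conj_symm]

/-- Testing a measure on Poisson kernels bounds it on small tents. -/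
lemma measure_tent_le {n : ℕ} {X : Type*} [MeasurableSpace X] (m : Measure X)
    {Z : X → Cn n} (hZm : Measurable Z) (hZ : ∀ x, ‖Z x‖ < 1) {s : ℝ} (hs : 0 < s)
    {a : Cn n} (ha : ‖a‖ < 1) {t : ℝ} (hat : 1 - ‖a‖ ≤ t) (ht1 : t ≤ 1) {ε : ℝ≥0∞}
    (hε : ∫⁻ x, ENNReal.ofReal (poissonKernel ((1 - t) • a) (Z x)) ^ s ∂m ≤ ε) :
    m {x | ‖1 - inner ℂ a (Z x)‖ ≤ 6 * t} ≤
      (ENNReal.ofReal (49 ^ n) ^ s * ε) * ENNReal.ofReal (t ^ n) ^ s := by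
  have ht0 : 0 < t := by linarith
  -- The test point sits at height about t under the tent. On the tent |1-⟨z,w⟩| ≤ 7t, so P(w,z) ≥
  -- (49^n t^n)⁻¹.
  set w := (1 - t) • a with hw
  have hw1 : ‖w‖ ≤ 1 - t := norm_shrink_le ha.le ht1
  have hwlt : ‖w‖ < 1 := by linarith
  have hc : 0 < (49 ^ n * t ^ n : ℝ) := by positivity
  have hS : MeasurableSet {x | ‖1 - inner ℂ a (Z x)‖ ≤ 6 * t} := by
    have h1 : Measurable fun x => ‖1 - inner ℂ a (Z x)‖ :=
      (Continuous.measurable (f := fun z : Cn n => ‖1 - inner ℂ a z‖) (by fun_prop)).comp hZm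
    exact measurableSet_le h1 measurable_const
  have key : ∀ x ∈ {x | ‖1 - inner ℂ a (Z x)‖ ≤ 6 * t},
      ENNReal.ofReal ((49 ^ n * t ^ n)⁻¹) ^ s ≤ ENNReal.ofReal (poissonKernel w (Z x)) ^ s := by
    intro x hx
    have h2 := norm_one_sub_inner_shrink_le ha.le (hZ x).le ht0.le hx
    rw [← hw] at h2
    refine ENNReal.rpow_le_rpow (ENNReal.ofReal_le_ofReal ?_) hs.le
    have h0 := norm_one_sub_inner_pos hwlt (hZ x).le
    rw [poissonKernel, ← one_div, div_le_div_iff₀ hc (by positivity), one_mul]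
    calc ‖1 - inner ℂ (Z x) w‖ ^ (2 * n) ≤ ((6 + 1) * t) ^ (2 * n) := by gcongr
      _ = t ^ n * (49 ^ n * t ^ n) := by
          rw [mul_pow, two_mul, pow_add, pow_add, ← mul_pow]; norm_num; ring
      _ ≤ (1 - ‖w‖ ^ 2) ^ n * (49 ^ n * t ^ n) := by
          gcongr
          nlinarith [norm_nonneg w]
  have h3 := setLIntegral_mono' (μ := m) hS key
  rw [setLIntegral_const] at h3
  have h4 := (h3.trans (setLIntegral_le_lintegral _ _)).trans hε
  rw [ENNReal.ofReal_inv_of_pos hc, ENNReal.inv_rpow] at h4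
  set D := ENNReal.ofReal (49 ^ n * t ^ n) ^ s with hD
  have hD0 : D ≠ 0 := by
    rw [hD, Ne, ENNReal.rpow_eq_zero_iff]
    push Not
    exact ⟨fun h => absurd h (by simpa using hc), fun h => absurd h ENNReal.ofReal_ne_top⟩
  have hDtop : D ≠ ∞ := ENNReal.rpow_ne_top_of_nonneg hs.le ENNReal.ofReal_ne_top
  have h5 := mul_le_mul_right h4 D
  rw [← mul_assoc, ENNReal.mul_inv_cancel hD0 hDtop, one_mul] at h5
  refine h5.trans_eq ?_
  rw [hD, ENNReal.ofReal_mul (by positivity), ENNReal.mul_rpow_of_nonneg _ _ hs.le]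
  ring

lemma measurable_poissonKernel {n : ℕ} {Y : Type*} [MeasurableSpace Y] {u v : Y → Cn n}
    (hu : Measurable u) (hv : Measurable v) : Measurable fun y => poissonKernel (u y) (v y) := by
  have h1 : Measurable fun y => (1 - ‖u y‖ ^ 2) ^ n :=
    (measurable_const.sub (hu.norm.pow_const 2)).pow_const n
  have h2 : Measurable fun y => ‖(1 : ℂ) - inner ℂ (v y) (u y)‖ ^ (2 * n) :=
    (measurable_const.sub (Measurable.inner hv hu)).norm.pow_const (2 * n)
  exact h1.div h2

/-- Testing a measure on Poisson kernels bounds it near the sphere. -/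
lemma measure_shell_le {n : ℕ} [NeZero n] {X : Type*} [MeasurableSpace X] (m : Measure X)
    [SFinite m] {Z : X → Cn n} (hZm : Measurable Z) (hZ : ∀ x, ‖Z x‖ < 1) {s : ℝ} (hs : 1 ≤ s)
    {s₀ : ℝ} (hs₀ : s₀ ∈ Ioo (0 : ℝ) 1) {ε : ℝ≥0∞}
    (hε : ∀ w : Cn n, ‖w‖ = s₀ → ∫⁻ x, ENNReal.ofReal (poissonKernel w (Z x)) ^ s ∂m ≤ ε) :
    m {x | s₀ ≤ ‖Z x‖} ≤ ENNReal.ofReal (2 ^ n) ^ s * ε := by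
  have hs0 : 0 < s := by linarith
  have hS : MeasurableSet {x | s₀ ≤ ‖Z x‖} := measurableSet_le measurable_const hZm.norm
  have hmeas : Measurable fun y : unitSphere n × X =>
      ENNReal.ofReal (poissonKernel (s₀ • (y.1 : Cn n)) (Z y.2)) ^ s := by
    refine (Measurable.ennreal_ofReal ?_).pow_const s
    have h2 : Measurable fun y : unitSphere n × X => s₀ • (y.1 : Cn n) :=
      (Continuous.measurable (f := fun η : unitSphere n => s₀ • (η : Cn n)) (by fun_prop)).comp
        measurable_fst
    have h3 : Measurable fun y : unitSphere n × X => Z y.2 := hZm.comp measurable_snd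
    exact measurable_poissonKernel h2 h3
  have hswap := lintegral_lintegral_swap (μ := sigma n) (ν := m)
    (f := fun (η : unitSphere n) x => ENNReal.ofReal (poissonKernel (s₀ • (η : Cn n)) (Z x)) ^ s)
    hmeas.aemeasurable
  have hle : ∫⁻ η : unitSphere n, ∫⁻ x,
      ENNReal.ofReal (poissonKernel (s₀ • (η : Cn n)) (Z x)) ^ s ∂m ∂(sigma n) ≤ ε := by
    calc _ ≤ ∫⁻ _ : unitSphere n, ε ∂(sigma n) :=
          lintegral_mono fun η => hε _ (norm_smul_sphere hs₀.1.le η)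
      _ = ε := by simp
  rw [hswap] at hle
  -- Averaging the tests over |w| = s₀ avoids a covering of the shell. After Jensen, P(s₀η,z) ≥
  -- 2^(-n) P(s₀z,η) for |z| ≥ s₀, because 1-s₀⁴ ≤ 2(1-s₀²), and the right side has mean 2^(-n) in
  -- η.
  have key : ∀ x ∈ {x | s₀ ≤ ‖Z x‖}, (ENNReal.ofReal (2 ^ n)⁻¹) ^ s ≤
      ∫⁻ η : unitSphere n, ENNReal.ofReal (poissonKernel (s₀ • (η : Cn n)) (Z x)) ^ s
        ∂(sigma n) := by
    intro x hx
    have hx1 : s₀ ≤ ‖Z x‖ := hx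
    have hzn : ‖s₀ • Z x‖ = s₀ * ‖Z x‖ := by rw [norm_smul, Real.norm_of_nonneg hs₀.1.le]
    have hz : ‖s₀ • Z x‖ < 1 := by
      rw [hzn]
      nlinarith [hs₀.1, hs₀.2, hZ x, norm_nonneg (Z x)]
    have hmx : Measurable fun η : unitSphere n =>
        ENNReal.ofReal (poissonKernel (s₀ • (η : Cn n)) (Z x)) := by
      refine Measurable.ennreal_ofReal (Measurable.div ?_ ?_)
      · exact Continuous.measurable (by fun_prop)
      · exact Continuous.measurable (by fun_prop)
    refine le_trans ?_ (lintegral_rpow_le_of_prob hs hmx.aemeasurable)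
    refine ENNReal.rpow_le_rpow ?_ hs0.le
    calc ENNReal.ofReal (2 ^ n)⁻¹
        = ∫⁻ η : unitSphere n, ENNReal.ofReal (2 ^ n)⁻¹ *
            ENNReal.ofReal (poissonKernel (s₀ • Z x) η) ∂(sigma n) := by
          rw [lintegral_const_mul _ (measurable_ofReal_poissonKernel hz),
            lintegral_poissonKernel hz, mul_one]
      _ ≤ _ := by
          refine lintegral_mono fun η => ?_
          rw [← ENNReal.ofReal_mul (by positivity)]
          refine ENNReal.ofReal_le_ofReal ?_
          have h1 : ‖1 - inner ℂ (Z x) (s₀ • (η : Cn n))‖ =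
              ‖1 - inner ℂ (η : Cn n) (s₀ • Z x)‖ := by
            rw [inner_real_smul_right, inner_real_smul_right, ← Complex.norm_conj, map_sub, map_mul,
              inner_conj_symm]
            simp
          rw [poissonKernel, poissonKernel, h1, norm_smul_sphere hs₀.1.le, hzn, ← mul_div_assoc,
            ← inv_pow, ← mul_pow]
          have h2 := norm_one_sub_inner_pos hz (norm_eq_of_mem_sphere η).le
          have h3 : (s₀ * ‖Z x‖) ^ 2 < 1 := by
            rw [← hzn]
            nlinarith [norm_nonneg (s₀ • Z x)]
          gcongr
          have h4 : s₀ * s₀ ≤ s₀ * ‖Z x‖ := by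
            have := hs₀.1
            gcongr
          have h5 : s₀ ^ 2 < 1 := by nlinarith [hs₀.1, hs₀.2]
          have h6 : (s₀ * s₀) ^ 2 ≤ (s₀ * ‖Z x‖) ^ 2 := by
            have := hs₀.1
            gcongr
          nlinarith
  have h3 := setLIntegral_mono' (μ := m) hS key
  rw [setLIntegral_const] at h3
  have h4 := (h3.trans (setLIntegral_le_lintegral _ _)).trans hle
  rw [ENNReal.ofReal_inv_of_pos (by positivity), ENNReal.inv_rpow] at h4
  set D := ENNReal.ofReal (2 ^ n) ^ s with hD
  have hD0 : D ≠ 0 := by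
    rw [hD, Ne, ENNReal.rpow_eq_zero_iff]
    push Not
    exact ⟨fun h => absurd h (by simp), fun h => absurd h ENNReal.ofReal_ne_top⟩
  have hDtop : D ≠ ∞ := ENNReal.rpow_ne_top_of_nonneg hs0.le ENNReal.ofReal_ne_top
  have h5 := mul_le_mul_right h4 D
  rwa [← mul_assoc, ENNReal.mul_inv_cancel hD0 hDtop, one_mul] at h5

/-- The vanishing Carleson embedding: near the sphere, the embedding of `H^p` is as small as the
test on Poisson kernels. -/
theorem vanishing_embedding {n : ℕ} [NeZero n] {X : Type*} [MeasurableSpace X] (m : Measure X)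
    [SFinite m] {Z : X → Cn n} (hZm : Measurable Z) (hZ : ∀ x, ‖Z x‖ < 1) {p q : ℝ} (hp : 1 < p)
    (hpq : p ≤ q) {δ : ℝ} (hδ : δ ∈ Ioo (0 : ℝ) 1) {s₀ : ℝ} (hs₀ : s₀ ∈ Ioo (0 : ℝ) 1) {ε : ℝ≥0∞}
    (h1 : ∀ w : Cn n, ‖w‖ < 1 → 1 - δ < ‖w‖ →
      ∫⁻ x, ENNReal.ofReal (poissonKernel w (Z x)) ^ (q / p) ∂m ≤ ε)
    (h2 : ∀ w : Cn n, ‖w‖ = s₀ → ∫⁻ x, ENNReal.ofReal (poissonKernel w (Z x)) ^ (q / p) ∂m ≤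
      ε * ENNReal.ofReal ((δ / 2) ^ n) ^ (q / p))
    {f : Cn n → ℂ} (hf : DifferentiableOn ℂ f (unitBall n)) :
    ∫⁻ x in {x | s₀ ≤ ‖Z x‖}, ‖f (Z x)‖ₑ ^ q ∂m ≤
      embeddingConst n p q * (ENNReal.ofReal (49 ^ n) ^ (q / p) * ε * hardyENorm p f ^ q) := by
  have hp0 : 0 < p := by linarith
  have hs : 1 ≤ q / p := (one_le_div hp0).2 hpq
  have hs0 : 0 < q / p := by linarith
  have htent : ∀ a : Cn n, ‖a‖ < 1 → ∀ t, 1 - ‖a‖ ≤ t →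
      (m.restrict {x | s₀ ≤ ‖Z x‖}) {x | ‖1 - inner ℂ a (Z x)‖ ≤ 6 * t} ≤
        (ENNReal.ofReal (49 ^ n) ^ (q / p) * ε) * ENNReal.ofReal (t ^ n) ^ (q / p) := by
    intro a ha t hat
    rcases lt_or_ge t (δ / 2) with h | h
    -- Small tents: the test point has norm at least (1-t)² ≥ 1-2t > 1-δ, so the first hypothesis
    -- applies.
    · have ht1 : t ≤ 1 := by linarith [hδ.2]
      have ht0 : 0 < t := by linarith
      refine (Measure.restrict_le_self _).trans
        (measure_tent_le m hZm hZ hs0 ha hat ht1 (h1 _ ?_ ?_))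
      · exact (norm_shrink_le ha.le ht1).trans_lt (by linarith)
      · rw [norm_smul, Real.norm_of_nonneg (by linarith)]
        nlinarith [norm_nonneg a]
    -- Large tents: the whole shell already has mass of order ε(δ/2)^(nq/p), at most ε t^(nq/p) up
    -- to the constant.
    · have hd : 0 < δ / 2 := by linarith [hδ.1]
      calc (m.restrict {x | s₀ ≤ ‖Z x‖}) {x | ‖1 - inner ℂ a (Z x)‖ ≤ 6 * t}
          ≤ m {x | s₀ ≤ ‖Z x‖} := by
            refine (measure_mono (subset_univ _)).trans ?_
            rw [Measure.restrict_apply_univ]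
        _ ≤ ENNReal.ofReal (2 ^ n) ^ (q / p) * (ε * ENNReal.ofReal ((δ / 2) ^ n) ^ (q / p)) :=
            measure_shell_le m hZm hZ hs hs₀ h2
        _ ≤ ENNReal.ofReal (49 ^ n) ^ (q / p) * (ε * ENNReal.ofReal (t ^ n) ^ (q / p)) := by
            gcongr
            norm_num
        _ = _ := by rw [mul_assoc]
  -- The embedding theorem needs functions holomorphic across the sphere, so it is applied to
  -- dilates and Fatou's lemma passes to f.
  have hlim : ∀ x, Tendsto (fun k => ‖f (radius k • Z x)‖ₑ ^ q) atTop (𝓝 (‖f (Z x)‖ₑ ^ q)) := by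
    intro x
    refine tendsto_enorm_rpow q ?_
    have hc : ContinuousAt f (Z x) := hf.continuousOn.continuousAt
      (Metric.isOpen_ball.mem_nhds (mem_ball_zero_iff.2 (hZ x)))
    refine hc.tendsto.comp ?_
    have h3 : Tendsto (fun r : ℝ => r • Z x) (𝓝 1) (𝓝 ((1 : ℝ) • Z x)) :=
      (continuous_id.smul continuous_const).tendsto 1
    rw [one_smul] at h3
    exact h3.comp (tendsto_radius.mono_right nhdsWithin_le_nhds)
  have hmeas : ∀ k, Measurable fun x => ‖f (radius k • Z x)‖ₑ ^ q := by
    intro k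
    have h3 : Measurable (Set.domRestrict (unitBall n) f) := hf.continuousOn.domRestrict.measurable
    have h4 : ∀ x, radius k • Z x ∈ unitBall n := fun x => by
      rw [mem_ball_zero_iff, norm_smul, Real.norm_of_nonneg (radius_mem k).1.le]
      nlinarith [(radius_mem k).1, (radius_mem k).2, hZ x, norm_nonneg (Z x)]
    exact (h3.comp ((hZm.const_smul (radius k)).subtype_mk (h := h4))).enorm.pow_const q
  calc ∫⁻ x in {x | s₀ ≤ ‖Z x‖}, ‖f (Z x)‖ₑ ^ q ∂m
      = ∫⁻ x in {x | s₀ ≤ ‖Z x‖}, liminf (fun k => ‖f (radius k • Z x)‖ₑ ^ q) atTop ∂m :=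
        lintegral_congr fun x => (hlim x).liminf_eq.symm
    _ ≤ liminf (fun k => ∫⁻ x in {x | s₀ ≤ ‖Z x‖}, ‖f (radius k • Z x)‖ₑ ^ q ∂m) atTop :=
        lintegral_liminf_le hmeas
    _ ≤ _ := by
        refine liminf_le_of_le (by isBoundedDefault) fun b hb => ?_
        obtain ⟨k, hk⟩ := hb.exists
        refine hk.trans ?_
        have h3 := carleson_embedding (m.restrict {x | s₀ ≤ ‖Z x‖}) hZm hZ hp hpq htent
          ((one_lt_inv₀ (radius_mem k).1).2 (radius_mem k).2)
          (differentiableOn_dilate hf (radius_mem k).1)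
        refine h3.trans ?_
        gcongr
        calc hardyMean p f (radius k) ^ (q / p) ≤ (hardyENorm p f ^ p) ^ (q / p) :=
              ENNReal.rpow_le_rpow (hardyMean_le hp.le f (radius_mem k)) hs0.le
          _ = hardyENorm p f ^ q := by
              rw [← ENNReal.rpow_mul, mul_div_cancel₀ _ hp0.ne']

/-! ### Montel's theorem in several variables -/

/-- The derivative of a holomorphic function that is small on a ball is small at the centre. -/
lemma norm_fderiv_le_of_norm_le {E F : Type*} [NormedAddCommGroup E] [NormedSpace ℂ E]
    [NormedAddCommGroup F] [NormedSpace ℂ F] {f : E → F} {c : E} {R M : ℝ} (hR : 0 < R)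
    (hf : DifferentiableOn ℂ f (Metric.ball c R)) (hM : ∀ z ∈ Metric.ball c R, ‖f z‖ ≤ M) :
    ‖fderiv ℂ f c‖ ≤ 2 * M / R := by
  refine Complex.norm_fderiv_le_div_of_mapsTo_ball hf (fun z hz => ?_) hR
  rw [mem_closedBall_iff_norm]
  calc ‖f z - f c‖ ≤ ‖f z‖ + ‖f c‖ := norm_sub_le _ _
    _ ≤ 2 * M := by linarith [hM z hz, hM c (Metric.mem_ball_self hR)]

/-- A locally uniform limit of holomorphic functions of several variables is holomorphic. -/
theorem differentiableOn_of_tendstoLocallyUniformlyOn {E F ι : Type*} [NormedAddCommGroup E]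
    [NormedSpace ℂ E] [ProperSpace E] [NormedAddCommGroup F] [NormedSpace ℂ F] [CompleteSpace F]
    {l : Filter ι} [l.NeBot] {f : ι → E → F} {g : E → F} {U : Set E} (hU : IsOpen U)
    (hf : ∀ i, DifferentiableOn ℂ (f i) U) (h : TendstoLocallyUniformlyOn f g l U) :
    DifferentiableOn ℂ g U := by
  intro x hx
  obtain ⟨R, hR, hRU⟩ := Metric.nhds_basis_closedBall.mem_iff.1 (hU.mem_nhds hx)
  set ρ := R / 2 with hρ
  have hρ0 : 0 < ρ := by positivity
  have hu : TendstoUniformlyOn f g l (Metric.closedBall x R) :=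
    (tendstoLocallyUniformlyOn_iff_forall_isCompact hU).1 h _ hRU (isCompact_closedBall x R)
  have hsub : ∀ y ∈ Metric.ball x ρ, Metric.ball y ρ ⊆ Metric.closedBall x R := by
    intro y hy z hz
    have h1 := dist_triangle z y x
    rw [Metric.mem_ball] at hy hz
    rw [Metric.mem_closedBall]
    linarith
  have hder : ∀ i, ∀ y ∈ Metric.ball x ρ, HasFDerivAt (f i) (fderiv ℂ (f i) y) y := by
    intro i y hy
    have hyU : y ∈ U := hRU (hsub y hy (Metric.mem_ball_self hρ0))
    exact ((hf i).differentiableAt (hU.mem_nhds hyU)).hasFDerivAt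
  -- Cauchy estimates on balls of radius ρ turn uniform closeness of the functions into uniform
  -- closeness of the derivatives.
  have hc : UniformCauchySeqOn (fun i => fderiv ℂ (f i)) l (Metric.ball x ρ) := by
    intro u hu'
    obtain ⟨ε, hε, hεu⟩ := Metric.mem_uniformity_dist.1 hu'
    filter_upwards [hu.uniformCauchySeqOn _ (Metric.dist_mem_uniformity
      (show 0 < ε * ρ / 4 by positivity))] with i hi y hy
    refine hεu ?_
    rw [dist_eq_norm]
    have hy1 := hder i.1 y hy
    have hy2 := hder i.2 y hy
    have h3 : fderiv ℂ (f i.1) y - fderiv ℂ (f i.2) y = fderiv ℂ (f i.1 - f i.2) y :=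
      ((hy1.sub hy2).fderiv).symm
    rw [h3]
    have h4 : ∀ z ∈ Metric.ball y ρ, ‖(f i.1 - f i.2) z‖ ≤ ε * ρ / 4 := by
      intro z hz
      have := hi z (hsub y hy hz)
      rw [Pi.sub_apply, ← dist_eq_norm]
      exact le_of_lt this
    have h5 := norm_fderiv_le_of_norm_le hρ0 (((hf i.1).sub (hf i.2)).mono
      ((hsub y hy).trans hRU)) h4
    refine h5.trans_lt ?_
    rw [div_lt_iff₀ hρ0]
    nlinarith [mul_pos hε hρ0]
  have hlim : ∀ y, ∃ a, y ∈ Metric.ball x ρ → Tendsto (fun i => fderiv ℂ (f i) y) l (𝓝 a) := by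
    intro y
    by_cases hy : y ∈ Metric.ball x ρ
    · obtain ⟨a, ha⟩ := CompleteSpace.complete (hc.cauchy_map hy)
      exact ⟨a, fun _ => ha⟩
    · exact ⟨0, fun h => absurd h hy⟩
  choose g' hg' using hlim
  have hg : HasFDerivAt g (g' x) x :=
    hasFDerivAt_of_tendstoUniformlyOn Metric.isOpen_ball
      (hc.tendstoUniformlyOn_of_tendsto hg') hder
      (fun y hy => hu.tendsto_at (hsub y hy (Metric.mem_ball_self hρ0)))
      (Metric.mem_ball_self hρ0)
  exact hg.differentiableAt.differentiableWithinAt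

/-- **Montel's theorem** in several variables, along an ultrafilter. -/
theorem exists_tendstoLocallyUniformlyOn_of_bounded {E ι : Type*} [NormedAddCommGroup E]
    [NormedSpace ℂ E] [ProperSpace E] (l : Ultrafilter ι) {f : ι → E → ℂ} {U : Set E}
    (hU : IsOpen U) (hf : ∀ i, DifferentiableOn ℂ (f i) U)
    (hb : ∀ K ⊆ U, IsCompact K → ∃ M, ∀ᶠ i in (l : Filter ι), ∀ z ∈ K, ‖f i z‖ ≤ M) :
    ∃ g, TendstoLocallyUniformlyOn f g l U := by
  have hlim : ∀ z, ∃ a, z ∈ U → Tendsto (fun i => f i z) l (𝓝 a) := by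
    intro z
    by_cases hz : z ∈ U
    · obtain ⟨M, hM⟩ := hb {z} (singleton_subset_iff.2 hz) isCompact_singleton
      have h1 : Metric.closedBall (0 : ℂ) M ∈ l.map fun i => f i z := by
        rw [Ultrafilter.mem_map]
        filter_upwards [hM] with i hi
        simpa using hi z rfl
      obtain ⟨a, -, ha⟩ := (isCompact_closedBall (0 : ℂ) M).ultrafilter_le_nhds' _ h1
      exact ⟨a, fun _ => ha⟩
    · exact ⟨0, fun h => absurd h hz⟩
  choose g hg using hlim
  refine ⟨g, Metric.tendstoLocallyUniformlyOn_iff.2 fun ε hε x hx => ?_⟩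
  obtain ⟨R, hR, hRU⟩ := Metric.nhds_basis_closedBall.mem_iff.1 (hU.mem_nhds hx)
  obtain ⟨M, hM⟩ := hb _ hRU (isCompact_closedBall x R)
  have hball : ∀ y ∈ Metric.ball x R, y ∈ U := fun y hy => hRU (Metric.ball_subset_closedBall hy)
  -- The Schwarz lemma makes the family equi-Lipschitz at x, which upgrades the pointwise
  -- ultrafilter limit to a locally uniform one.
  have hlip : ∀ᶠ i in (l : Filter ι), ∀ y ∈ Metric.ball x R,
      dist (f i y) (f i x) ≤ 2 * M / R * dist y x := by
    filter_upwards [hM] with i hi y hy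
    refine Complex.dist_le_div_mul_dist_of_mapsTo_ball
      ((hf i).mono (Metric.ball_subset_closedBall.trans hRU)) (fun z hz => ?_) hy
    rw [mem_closedBall_iff_norm]
    calc ‖f i z - f i x‖ ≤ ‖f i z‖ + ‖f i x‖ := norm_sub_le _ _
      _ ≤ 2 * M := by
        linarith [hi z (Metric.ball_subset_closedBall hz), hi x (Metric.mem_closedBall_self hR.le)]
  have hlipg : ∀ y ∈ Metric.ball x R, dist (g y) (g x) ≤ 2 * M / R * dist y x := by
    intro y hy
    exact le_of_tendsto ((hg y (hball y hy)).dist (hg x hx)) (hlip.mono fun i hi => hi y hy)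
  have hM0 : 0 ≤ M := by
    obtain ⟨i, hi⟩ := hM.exists
    exact (norm_nonneg _).trans (hi x (Metric.mem_closedBall_self hR.le))
  have hK0 : 0 ≤ 2 * M / R := by positivity
  set η := min R (ε / (4 * (2 * M / R + 1))) with hη
  have hη0 : 0 < η := by positivity
  have hKη : 2 * M / R * η ≤ ε / 4 := by
    have h1 : η ≤ ε / (4 * (2 * M / R + 1)) := min_le_right _ _
    rw [le_div_iff₀ (by positivity)] at h1
    nlinarith
  refine ⟨Metric.ball x η, mem_nhdsWithin_of_mem_nhds (Metric.ball_mem_nhds x hη0), ?_⟩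
  filter_upwards [hlip, Metric.tendsto_nhds.1 (hg x hx) (ε / 4) (by positivity)] with i hi hix y hy
  have hyR : y ∈ Metric.ball x R := Metric.ball_subset_ball (min_le_left _ _) hy
  have h1 := (hlipg y hyR).trans ((mul_le_mul_of_nonneg_left (le_of_lt hy) hK0).trans hKη)
  have h2 := (hi y hyR).trans ((mul_le_mul_of_nonneg_left (le_of_lt hy) hK0).trans hKη)
  have h3 := dist_triangle4 (g y) (g x) (f i x) (f i y)
  rw [dist_comm (g x) (f i x), dist_comm (f i x) (f i y)] at h3
  linarith

/-! ### Test functions and Hardy space elements -/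

lemma poissonKernel_smul_right_le {n : ℕ} {w : Cn n} (hw : ‖w‖ < 1) {r : ℝ} (hr : r ∈ Ioo (0 : ℝ) 1)
    (ξ : Cn n) : poissonKernel w (r • ξ) ≤ poissonKernel (r • w) ξ := by
  have h1 : ‖1 - inner ℂ (r • ξ) w‖ = ‖1 - inner ℂ ξ (r • w)‖ := by
    rw [norm_one_sub_inner_comm (r • ξ) w, norm_one_sub_inner_comm ξ (r • w),
      inner_real_smul_right, ← Complex.norm_conj, map_sub, map_one, map_mul, inner_conj_symm,
      Complex.conj_ofReal, ← inner_real_smul_right, norm_one_sub_inner_comm]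
  have h2 : ‖r • w‖ ≤ ‖w‖ := by
    rw [norm_smul, Real.norm_of_nonneg hr.1.le]
    nlinarith [hr.2, norm_nonneg w]
  have h3 : 0 ≤ 1 - ‖w‖ ^ 2 := by nlinarith [norm_nonneg w]
  unfold poissonKernel
  rw [h1]
  gcongr

/-- The `p`-normalized test function at `w`: a power of the reproducing kernel. -/
def testFun {n : ℕ} (p : ℝ) (w z : Cn n) : ℂ :=
  (((1 - ‖w‖ ^ 2) ^ ((n : ℝ) / p) : ℝ) : ℂ) / (1 - inner ℂ w z) ^ ((2 * n / p : ℝ) : ℂ)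

lemma norm_testFun {n : ℕ} (p : ℝ) {w : Cn n} (hw : ‖w‖ < 1) (z : Cn n) :
    ‖testFun p w z‖ = poissonKernel w z ^ (1 / p) := by
  have h0 : 0 ≤ 1 - ‖w‖ ^ 2 := by nlinarith [norm_nonneg w]
  rw [testFun, norm_div, Complex.norm_real, Complex.norm_cpow_real, poissonKernel,
    Real.div_rpow (by positivity) (by positivity), norm_one_sub_inner_comm z w,
    ← Real.rpow_natCast (1 - ‖w‖ ^ 2) n, ← Real.rpow_natCast ‖1 - inner ℂ w z‖ (2 * n),
    ← Real.rpow_mul h0, ← Real.rpow_mul (norm_nonneg _),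
    Real.norm_of_nonneg (by positivity)]
  push_cast
  congr 2 <;> ring

lemma enorm_testFun_rpow {n : ℕ} {p : ℝ} (hp : 0 < p) (t : ℝ) {w : Cn n}
    (hw : ‖w‖ < 1) (z : Cn n) :
    ‖testFun p w z‖ₑ ^ t = ENNReal.ofReal (poissonKernel w z) ^ (t / p) := by
  rw [← ofReal_norm, norm_testFun p hw, ← ENNReal.ofReal_rpow_of_nonneg (poissonKernel_nonneg hw)
    (by positivity), ← ENNReal.rpow_mul]
  congr 1
  ring

lemma one_sub_inner_mem_slitPlane {n : ℕ} {w z : Cn n} (hw : ‖w‖ < 1) (hz : ‖z‖ ≤ 1) :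
    1 - inner ℂ w z ∈ Complex.slitPlane := by
  refine Complex.mem_slitPlane_iff.2 (Or.inl ?_)
  have h1 : (inner ℂ w z : ℂ).re ≤ ‖w‖ * ‖z‖ :=
    (Complex.re_le_norm _).trans (norm_inner_le_norm w z)
  have h2 : ‖w‖ * ‖z‖ ≤ ‖w‖ := mul_le_of_le_one_right (norm_nonneg _) hz
  rw [Complex.sub_re, Complex.one_re]
  linarith

lemma differentiableAt_testFun {n : ℕ} (p : ℝ) {w z : Cn n} (hw : ‖w‖ < 1) (hz : ‖z‖ ≤ 1) :
    DifferentiableAt ℂ (testFun p w) z := by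
  have h1 : DifferentiableAt ℂ (fun z : Cn n => 1 - inner ℂ w z) z :=
    (differentiableAt_const _).sub (innerSL ℂ w).differentiableAt
  have h2 := h1.cpow (differentiableAt_const ((2 * n / p : ℝ) : ℂ))
    (one_sub_inner_mem_slitPlane hw hz)
  refine ((h2.fun_inv ?_).const_mul (((1 - ‖w‖ ^ 2) ^ ((n : ℝ) / p) : ℝ) : ℂ)).congr_of_eventuallyEq
    (Eventually.of_forall fun x => div_eq_mul_inv _ _)
  rw [Ne, Complex.cpow_eq_zero_iff, not_and_or]
  exact Or.inl (Complex.slitPlane_ne_zero (one_sub_inner_mem_slitPlane hw hz))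

/-- The p-mean at radius r is the mean of P(w,rξ), which is at most P(rw,ξ), a kernel of mean one.
-/
lemma hardyENorm_testFun_le {n : ℕ} [NeZero n] {p : ℝ} (hp : 1 ≤ p) {w : Cn n} (hw : ‖w‖ < 1) :
    hardyENorm p ((unitBall n).indicator (testFun p w)) ≤ 1 := by
  have hp0 : 0 < p := by linarith
  have h : hardyENorm p ((unitBall n).indicator (testFun p w)) ^ p ≤ 1 := by
    refine hardyENorm_rpow_le hp _ fun r hr => ?_
    have hrw : ‖r • w‖ < 1 := by
      rw [norm_smul, Real.norm_of_nonneg hr.1.le]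
      nlinarith [hr.1, hr.2, norm_nonneg w]
    rw [← lintegral_poissonKernel hrw]
    refine lintegral_mono fun ξ => ?_
    simp only
    rw [indicator_of_mem (smul_mem_unitBall hr ξ), enorm_testFun_rpow hp0 p hw, div_self hp0.ne',
      ENNReal.rpow_one]
    exact ENNReal.ofReal_le_ofReal (poissonKernel_smul_right_le hw hr ξ)
  by_contra! hlt
  exact absurd h (not_le.2 (ENNReal.one_lt_rpow hlt hp0))

/-- A holomorphic function on the ball with finite Hardy norm, as an element of the Hardy space. -/
def HardySpace.ofFun {n : ℕ} {p : ℝ} (f : Cn n → ℂ) (hf : DifferentiableOn ℂ f (unitBall n))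
    (hfp : hardyENorm p ((unitBall n).indicator f) < ∞) : HardySpace n p :=
  (⟨(unitBall n).indicator f, hf.congr fun _ hz => indicator_of_mem hz _,
    fun _ hz => indicator_of_notMem hz _, hfp⟩ : hardySubmodule n p)

lemma HardySpace.toFun_ofFun {n : ℕ} {p : ℝ} {f : Cn n → ℂ}
    (hf : DifferentiableOn ℂ f (unitBall n))
    (hfp : hardyENorm p ((unitBall n).indicator f) < ∞) :
    (HardySpace.ofFun f hf hfp).toFun = (unitBall n).indicator f := rfl

lemma differentiableOn_testFun {n : ℕ} (p : ℝ) {w : Cn n} (hw : ‖w‖ < 1) :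
    DifferentiableOn ℂ (testFun p w) (unitBall n) := fun _ hz =>
  (differentiableAt_testFun p hw (mem_ball_zero_iff.1 hz).le).differentiableWithinAt

open scoped Classical in
/-- The test function at `w` as an element of the Hardy space. -/
def testElement {n : ℕ} [NeZero n] (p : ℝ) [hp : Fact (1 ≤ p)] (w : Cn n) : HardySpace n p :=
  if hw : ‖w‖ < 1 then HardySpace.ofFun (testFun p w) (differentiableOn_testFun p hw)
    ((hardyENorm_testFun_le hp.out hw).trans_lt ENNReal.one_lt_top)
  else 0

lemma toFun_testElement {n : ℕ} [NeZero n] {p : ℝ} [Fact (1 ≤ p)] {w : Cn n} (hw : ‖w‖ < 1) :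
    (testElement p w).toFun = (unitBall n).indicator (testFun p w) := by
  rw [testElement, dif_pos hw, HardySpace.toFun_ofFun]

lemma norm_testElement_le {n : ℕ} [NeZero n] {p : ℝ} [hp : Fact (1 ≤ p)] (w : Cn n) :
    ‖testElement p w‖ ≤ 1 := by
  by_cases hw : ‖w‖ < 1
  · rw [HardySpace.norm_def, toFun_testElement hw]
    exact ENNReal.toReal_le_of_le_ofReal zero_le_one
      (by simpa using hardyENorm_testFun_le hp.out hw)
  · rw [testElement, dif_neg hw, norm_zero]
    exact zero_le_one

/-- The test functions tend to zero pointwise as the point `w` tends to the sphere. -/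
lemma tendsto_testFun {n : ℕ} [NeZero n] {p : ℝ} (hp : 0 < p) {z : Cn n} (hz : ‖z‖ < 1) :
    Tendsto (fun w : Cn n => testFun p w z) (comap (fun w : Cn n => ‖w‖) (𝓝[<] 1)) (𝓝 0) := by
  have hn : 0 < n := Nat.pos_of_ne_zero (NeZero.ne n)
  have hw1 : Tendsto (fun w : Cn n => ‖w‖) (comap (fun w : Cn n => ‖w‖) (𝓝[<] 1)) (𝓝[<] 1) :=
    tendsto_comap
  have hlt : ∀ᶠ w : Cn n in comap (fun w : Cn n => ‖w‖) (𝓝[<] 1), ‖w‖ < 1 :=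
    hw1.eventually self_mem_nhdsWithin
  have h1 : Tendsto (fun w : Cn n => ((1 - ‖w‖ ^ 2) ^ n / (1 - ‖z‖) ^ (2 * n)) ^ (1 / p))
      (comap (fun w : Cn n => ‖w‖) (𝓝[<] 1)) (𝓝 0) := by
    have hc : Continuous fun t : ℝ => ((1 - t ^ 2) ^ n / (1 - ‖z‖) ^ (2 * n)) ^ (1 / p) :=
      Continuous.rpow_const (by fun_prop) fun _ => Or.inr (by positivity)
    have h2 := (hc.tendsto 1).comp (hw1.mono_right nhdsWithin_le_nhds)
    have h3 : ((1 - (1 : ℝ) ^ 2) ^ n / (1 - ‖z‖) ^ (2 * n)) ^ (1 / p) = 0 := by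
      rw [one_pow, sub_self, zero_pow hn.ne', zero_div, Real.zero_rpow (by positivity)]
    rwa [h3] at h2
  refine squeeze_zero_norm' ?_ h1
  filter_upwards [hlt] with w hw
  have h0 : 0 ≤ 1 - ‖w‖ ^ 2 := by nlinarith [norm_nonneg w]
  rw [norm_testFun p hw]
  refine Real.rpow_le_rpow (poissonKernel_nonneg hw) ?_ (by positivity)
  have hz0 : 0 < 1 - ‖z‖ := by linarith
  have h4 : 1 - ‖z‖ ≤ ‖1 - inner ℂ z w‖ := by
    rw [norm_one_sub_inner_comm]
    exact one_sub_norm_le z w hw.le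
  unfold poissonKernel
  gcongr

lemma hardyENorm_congr {n : ℕ} {p : ℝ} {f g : Cn n → ℂ} (h : EqOn f g (unitBall n)) :
    hardyENorm p f = hardyENorm p g := by
  refine iSup_congr fun r => iSup_congr fun hr => ?_
  congr 1
  exact funext fun ξ => h (smul_mem_unitBall hr ξ)

lemma weightedComp_indicator {n : ℕ} {ψ : Cn n → ℂ} {φ : Cn n → Cn n}
    (hφB : MapsTo φ (unitBall n) (unitBall n)) (f : Cn n → ℂ) :
    weightedComp ψ φ ((unitBall n).indicator f) = weightedComp ψ φ f := by
  refine indicator_congr fun z hz => ?_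
  simp only [indicator_of_mem (hφB hz)]

lemma HardySpace.hardyENorm_eq {n : ℕ} [NeZero n] {p : ℝ} [Fact (1 ≤ p)] (f : HardySpace n p) :
    hardyENorm p f.toFun = ENNReal.ofReal ‖f‖ := by
  rw [HardySpace.norm_def]
  exact (ENNReal.ofReal_toReal f.2.2.2.ne).symm

lemma HardySpace.differentiableOn {n : ℕ} {p : ℝ} (f : HardySpace n p) :
    DifferentiableOn ℂ f.toFun (unitBall n) := f.2.1

lemma HardySpace.toFun_sub {n : ℕ} {p : ℝ} (f g : HardySpace n p) :
    (f - g).toFun = f.toFun - g.toFun := rfl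

lemma HardySpace.norm_apply_le {n : ℕ} [NeZero n] {p : ℝ} [hp : Fact (1 ≤ p)] (f : HardySpace n p)
    {z : Cn n} (hz : ‖z‖ < 1) :
    ‖f.toFun z‖ ≤ ((4 / (1 - ‖z‖)) ^ n) ^ (1 / p) * ‖f‖ := by
  have hp0 : 0 < p := zero_lt_one.trans_le hp.out
  have h0 : 0 < 1 - ‖z‖ := by linarith
  have h := point_evaluation hp.out f.differentiableOn hz
  rw [f.hardyENorm_eq, ← ofReal_norm, ENNReal.ofReal_rpow_of_nonneg (norm_nonneg _) hp0.le,
    ENNReal.ofReal_rpow_of_nonneg (norm_nonneg _) hp0.le, ← ENNReal.ofReal_mul (by positivity),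
    ENNReal.ofReal_le_ofReal_iff (by positivity)] at h
  have h2 := Real.rpow_le_rpow (by positivity) h (show 0 ≤ 1 / p by positivity)
  rw [Real.mul_rpow (by positivity) (by positivity), ← Real.rpow_mul (norm_nonneg _),
    ← Real.rpow_mul (norm_nonneg _), mul_one_div_cancel hp0.ne', Real.rpow_one, Real.rpow_one] at h2
  exact h2

/-- Point evaluations are continuous on the Hardy space. -/
lemma HardySpace.tendsto_apply {n : ℕ} [NeZero n] {p : ℝ} [Fact (1 ≤ p)] {ι : Type*}
    {l : Filter ι} {u : ι → HardySpace n p} {f : HardySpace n p} (h : Tendsto u l (𝓝 f))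
    {z : Cn n} (hz : ‖z‖ < 1) : Tendsto (fun i => (u i).toFun z) l (𝓝 (f.toFun z)) := by
  rw [tendsto_iff_norm_sub_tendsto_zero] at h ⊢
  refine squeeze_zero (fun _ => norm_nonneg _) (fun i => (u i - f).norm_apply_le hz) ?_
  simpa using h.const_mul (((4 / (1 - ‖z‖)) ^ n) ^ (1 / p))

lemma HardySpace.ext_ball {n : ℕ} {p : ℝ} {f g : HardySpace n p}
    (h : EqOn f.toFun g.toFun (unitBall n)) : f = g := by
  refine Subtype.ext (funext fun z => ?_)
  by_cases hz : z ∈ unitBall n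
  · exact h hz
  · exact (f.2.2.1 z hz).trans (g.2.2.1 z hz).symm

lemma norm_radialLimit_le_one {n : ℕ} {φ : Cn n → Cn n} (hφB : MapsTo φ (unitBall n) (unitBall n))
    {ξ : unitSphere n} {a : Cn n}
    (h : Tendsto (fun r : ℝ => φ (r • (ξ : Cn n))) (𝓝[<] 1) (𝓝 a)) : ‖a‖ ≤ 1 := by
  refine le_of_tendsto h.norm ?_
  filter_upwards [Ioo_mem_nhdsLT (zero_lt_one (α := ℝ))] with r hr
  exact (mem_ball_zero_iff.1 (hφB (smul_mem_unitBall hr ξ))).le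

lemma tendsto_weightedComp_testFun {n : ℕ} {ψ : Cn n → ℂ} {φ : Cn n → Cn n} (p : ℝ)
    (hφB : MapsTo φ (unitBall n) (unitBall n)) {w : Cn n} (hw : ‖w‖ < 1) {ξ : unitSphere n}
    {b : ℂ} {a : Cn n} (hψ : Tendsto (fun r : ℝ => ψ (r • (ξ : Cn n))) (𝓝[<] 1) (𝓝 b))
    (hφ : Tendsto (fun r : ℝ => φ (r • (ξ : Cn n))) (𝓝[<] 1) (𝓝 a)) :
    Tendsto (fun r : ℝ => weightedComp ψ φ (testFun p w) (r • (ξ : Cn n))) (𝓝[<] 1)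
      (𝓝 (b * testFun p w a)) := by
  have h1 := (differentiableAt_testFun p hw (norm_radialLimit_le_one hφB hφ)).continuousAt
  refine (hψ.mul (h1.tendsto.comp hφ)).congr' ?_
  filter_upwards [Ioo_mem_nhdsLT (zero_lt_one (α := ℝ))] with r hr
  rw [weightedComp, indicator_of_mem (smul_mem_unitBall hr ξ), Function.comp_apply]

/-- The test integral of the pull-back measure, as an integral over the sphere. -/
lemma lintegral_pullMeasure {n : ℕ} [NeZero n] {p q : ℝ} (hp : 0 < p) (hq : 0 < q) {ψ : Cn n → ℂ}
    {φ : Cn n → Cn n} (hψ : DifferentiableOn ℂ ψ (unitBall n))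
    (hφ : DifferentiableOn ℂ φ (unitBall n)) (hφB : MapsTo φ (unitBall n) (unitBall n))
    (hψl : ∀ᵐ ξ : unitSphere n ∂(sigma n),
      Tendsto (fun r : ℝ => ψ (r • (ξ : Cn n))) (𝓝[<] 1) (𝓝 (radialLimit ψ ξ)))
    {w : Cn n} (hw : ‖w‖ < 1) :
    ∫⁻ z in Metric.closedBall (0 : Cn n) 1,
        ENNReal.ofReal ((1 - ‖w‖ ^ 2) ^ ((n : ℝ) * q / p) /
          ‖1 - inner ℂ w z‖ ^ (2 * (n : ℝ) * q / p)) ∂(pullMeasure ψ φ q) =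
      ∫⁻ ξ, ‖radialLimit ψ ξ * testFun p w (radialLimit φ ξ)‖ₑ ^ q ∂(sigma n) := by
  have hφl := ae_tendsto_radialLimit_of_mapsTo hφ hφB
  have hψm := (aemeasurable_radialLimit hψ.continuousOn hψl).enorm.pow_const q
  have hφm := aemeasurable_radialLimit hφ.continuousOn hφl
  set ν := (sigma n).withDensity fun ξ => ‖radialLimit ψ ξ‖ₑ ^ q with hν
  have hac : ν ≪ sigma n := withDensity_absolutelyContinuous _ _
  have hφν : AEMeasurable (radialLimit φ) ν := hφm.mono_ac hac
  have hint : ∀ z : Cn n, ENNReal.ofReal ((1 - ‖w‖ ^ 2) ^ ((n : ℝ) * q / p) /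
      ‖1 - inner ℂ w z‖ ^ (2 * (n : ℝ) * q / p)) =
      ENNReal.ofReal (poissonKernel w z) ^ (q / p) := by
    intro z
    have h0 : 0 ≤ 1 - ‖w‖ ^ 2 := by nlinarith [norm_nonneg w]
    rw [ENNReal.ofReal_rpow_of_nonneg (poissonKernel_nonneg hw) (by positivity), poissonKernel,
      Real.div_rpow (by positivity) (by positivity), norm_one_sub_inner_comm z w,
      ← Real.rpow_natCast (1 - ‖w‖ ^ 2) n, ← Real.rpow_natCast ‖1 - inner ℂ w z‖ (2 * n),
      ← Real.rpow_mul h0, ← Real.rpow_mul (norm_nonneg _)]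
    push_cast
    simp only [mul_div_assoc]
  have hmeas : Measurable fun z : Cn n => ENNReal.ofReal (poissonKernel w z) ^ (q / p) :=
    (measurable_poissonKernel measurable_const measurable_id).ennreal_ofReal.pow_const _
  -- Radial limits of φ lie in the closed ball almost everywhere, so restricting the measure to it
  -- changes nothing.
  have hball : ∀ᵐ z ∂(pullMeasure ψ φ q), z ∈ Metric.closedBall (0 : Cn n) 1 := by
    refine (ae_map_iff hφν Metric.isClosed_closedBall.measurableSet).2 (hac.ae_le ?_)
    filter_upwards [hφl] with ξ hξ
    exact mem_closedBall_zero_iff.2 (norm_radialLimit_le_one hφB hξ)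
  simp only [hint]
  rw [Measure.restrict_eq_self_of_ae_mem hball, pullMeasure, lintegral_map' hmeas.aemeasurable hφν]
  refine (lintegral_withDensity_eq_lintegral_mul₀ hψm (hmeas.comp_aemeasurable hφm)).trans ?_
  refine lintegral_congr fun ξ => ?_
  rw [Pi.mul_apply, Function.comp_apply, enorm_mul, ENNReal.mul_rpow_of_nonneg _ _ hq.le, enorm_testFun_rpow hp q hw]

/-! ### Compactness and vanishing test integrals -/

/-- A compact weighted composition operator has vanishing test integrals. -/
theorem tendsto_testIntegral_of_isCompactOperator {n : ℕ} [NeZero n] {p q : ℝ} [Fact (1 ≤ p)]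
    [Fact (1 ≤ q)] {ψ : Cn n → ℂ} {φ : Cn n → Cn n}
    (hφB : MapsTo φ (unitBall n) (unitBall n)) {T : HardySpace n p →L[ℂ] HardySpace n q}
    (hT : ∀ f : HardySpace n p, (T f).toFun = weightedComp ψ φ f.toFun)
    (hK : IsCompactOperator T) {Ω : Cn n → ℝ≥0∞}
    (hΩ : ∀ w, ‖w‖ < 1 → Ω w ≤ hardyENorm q (weightedComp ψ φ (testFun p w)) ^ q) :
    Tendsto Ω (comap (fun w : Cn n => ‖w‖) (𝓝[<] 1)) (𝓝 0) := by
  have hp0 : 0 < p := zero_lt_one.trans_le Fact.out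
  have hq0 : 0 < q := zero_lt_one.trans_le Fact.out
  obtain ⟨K, hKc, hKT⟩ :=
    IsCompactOperator.image_closedBall_subset_compact
      (f := (T : HardySpace n p →ₗ[ℂ] HardySpace n q)) hK 1
  refine (tendsto_iff_ultrafilter _ _ _).2 fun l hl => ?_
  obtain ⟨h, -, hlim⟩ := hKc.ultrafilter_le_nhds' (l.map fun w => T (testElement p w))
    (Ultrafilter.mem_map.2 (univ_mem' fun w =>
      hKT ⟨_, mem_closedBall_zero_iff.2 (norm_testElement_le w), rfl⟩))
  have hlt : ∀ᶠ w : Cn n in (l : Filter (Cn n)), ‖w‖ < 1 :=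
    hl (tendsto_comap.eventually self_mem_nhdsWithin)
  have hval : ∀ w : Cn n, ‖w‖ < 1 →
      (T (testElement p w)).toFun = weightedComp ψ φ (testFun p w) := fun w hw => by
    rw [hT, toFun_testElement hw, weightedComp_indicator hφB]
  -- The norm limit h is also the pointwise limit of T k_w, and ψ(z) k_w(φ(z)) → 0 at each z of the
  -- ball.
  have h0 : h = 0 := by
    refine HardySpace.ext_ball fun z hz => ?_
    have hz1 := mem_ball_zero_iff.1 hz
    refine tendsto_nhds_unique (HardySpace.tendsto_apply hlim hz1) ?_
    have h1 : Tendsto (fun w : Cn n => ψ z * testFun p w (φ z)) l (𝓝 (ψ z * 0)) :=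
      ((tendsto_testFun hp0 (mem_ball_zero_iff.1 (hφB hz))).mono_left hl).const_mul (ψ z)
    rw [mul_zero] at h1
    refine h1.congr' ?_
    filter_upwards [hlt] with w hw
    rw [hval w hw, weightedComp, indicator_of_mem hz]
  have h2 : Tendsto (fun w => ENNReal.ofReal ‖T (testElement p w)‖ ^ q) l (𝓝 0) := by
    have h3 : Tendsto (fun w => ‖T (testElement p w)‖) l (𝓝 ‖h‖) :=
      Tendsto.norm hlim
    have h4 := (ENNReal.continuous_rpow_const (y := q)).continuousAt.tendsto.comp
      (ENNReal.tendsto_ofReal h3)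
    rwa [h0, norm_zero, ENNReal.ofReal_zero, ENNReal.zero_rpow_of_pos hq0] at h4
  refine tendsto_of_tendsto_of_tendsto_of_le_of_le' tendsto_const_nhds h2
    (Eventually.of_forall fun _ => zero_le) ?_
  filter_upwards [hlt] with w hw
  rw [← HardySpace.hardyENorm_eq, hval w hw]
  exact hΩ w hw

/-- A weighted composition operator with small test integrals near the sphere is controlled by the
size of the function away from the sphere. -/
lemma hardyENorm_weightedComp_rpow_le {n : ℕ} [NeZero n] {p q : ℝ} (hp : 1 < p) (hpq : p ≤ q)
    {ψ : Cn n → ℂ} {φ : Cn n → Cn n} (hψ : DifferentiableOn ℂ ψ (unitBall n))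
    (hφ : DifferentiableOn ℂ φ (unitBall n)) (hφB : MapsTo φ (unitBall n) (unitBall n))
    {δ : ℝ} (hδ : δ ∈ Ioo (0 : ℝ) 1) {s₀ : ℝ} (hs₀ : s₀ ∈ Ioo (0 : ℝ) 1) {ε : ℝ≥0∞}
    (h1 : ∀ w : Cn n, ‖w‖ < 1 → 1 - δ < ‖w‖ → ∀ R ∈ Ioo (0 : ℝ) 1,
      hardyMean q (weightedComp ψ φ (testFun p w)) R ≤ ε)
    (h2 : ∀ w : Cn n, ‖w‖ = s₀ → ∀ R ∈ Ioo (0 : ℝ) 1,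
      hardyMean q (weightedComp ψ φ (testFun p w)) R ≤ ε * ENNReal.ofReal ((δ / 2) ^ n) ^ (q / p))
    {f : Cn n → ℂ} (hf : DifferentiableOn ℂ f (unitBall n)) {M : ℝ}
    (hM : ∀ z, ‖z‖ ≤ s₀ → ‖f z‖ ≤ M) :
    hardyENorm q (weightedComp ψ φ f) ^ q ≤
      embeddingConst n p q * (ENNReal.ofReal (49 ^ n) ^ (q / p) * ε * hardyENorm p f ^ q) +
        ENNReal.ofReal M ^ q * hardyENorm q ψ ^ q := by
  have hp0 : 0 < p := by linarith
  have hq1 : 1 ≤ q := by linarith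
  have hq0 : 0 < q := by linarith
  refine hardyENorm_rpow_le hq1 _ fun R hR => ?_
  -- All estimates are made at a fixed radius R with constants independent of R, so φ(R·) stays
  -- inside the open ball.
  set m := (sigma n).withDensity fun ξ : unitSphere n => ‖ψ (R • (ξ : Cn n))‖ₑ ^ q with hm
  have hψc := continuous_dilate hψ hR
  have hψm : Measurable fun ξ : unitSphere n => ‖ψ (R • (ξ : Cn n))‖ₑ ^ q :=
    hψc.measurable.enorm.pow_const q
  have hZm : Measurable fun ξ : unitSphere n => φ (R • (ξ : Cn n)) :=
    (hφ.continuousOn.comp_continuous (by fun_prop) (smul_mem_unitBall hR)).measurable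
  have hZ : ∀ ξ : unitSphere n, ‖φ (R • (ξ : Cn n))‖ < 1 := fun ξ =>
    mem_ball_zero_iff.1 (hφB (smul_mem_unitBall hR ξ))
  have hmul : ∀ g : Cn n → ℂ, ∀ ξ : unitSphere n,
      ‖weightedComp ψ φ g (R • (ξ : Cn n))‖ₑ ^ q =
        ‖ψ (R • (ξ : Cn n))‖ₑ ^ q * ‖g (φ (R • (ξ : Cn n)))‖ₑ ^ q := fun g ξ => by
    rw [weightedComp, indicator_of_mem (smul_mem_unitBall hR ξ), enorm_mul,
      ENNReal.mul_rpow_of_nonneg _ _ hq0.le]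
  have hmean : ∀ g : Cn n → ℂ, DifferentiableOn ℂ g (unitBall n) →
      hardyMean q (weightedComp ψ φ g) R =
        ∫⁻ ξ : unitSphere n, ‖g (φ (R • (ξ : Cn n)))‖ₑ ^ q ∂m := by
    intro g hg
    have hgm : Measurable fun ξ : unitSphere n => ‖g (φ (R • (ξ : Cn n)))‖ₑ ^ q :=
      (continuous_dilate (hg.comp hφ hφB) hR).measurable.enorm.pow_const q
    rw [hm, lintegral_withDensity_eq_lintegral_mul _ hψm hgm]
    exact lintegral_congr fun ξ => hmul g ξ
  have htest : ∀ w : Cn n, ‖w‖ < 1 → hardyMean q (weightedComp ψ φ (testFun p w)) R =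
      ∫⁻ ξ : unitSphere n, ENNReal.ofReal (poissonKernel w (φ (R • (ξ : Cn n)))) ^ (q / p) ∂m := by
    intro w hw
    rw [hmean _ (differentiableOn_testFun p hw)]
    exact lintegral_congr fun ξ => enorm_testFun_rpow hp0 q hw _
  have houter := vanishing_embedding m hZm hZ hp hpq hδ hs₀ (ε := ε)
    (fun w hw hw' => (htest w hw) ▸ h1 w hw hw' R hR)
    (fun w hw => (htest w (hw.trans_lt hs₀.2)) ▸ h2 w hw R hR) hf
  have hS : MeasurableSet {ξ : unitSphere n | s₀ ≤ ‖φ (R • (ξ : Cn n))‖} :=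
    measurableSet_le measurable_const hZm.norm
  rw [hmean f hf, ← lintegral_add_compl _ hS]
  refine add_le_add houter ?_
  calc ∫⁻ ξ in {ξ : unitSphere n | s₀ ≤ ‖φ (R • (ξ : Cn n))‖}ᶜ, ‖f (φ (R • (ξ : Cn n)))‖ₑ ^ q ∂m
      ≤ ∫⁻ _ in {ξ : unitSphere n | s₀ ≤ ‖φ (R • (ξ : Cn n))‖}ᶜ, ENNReal.ofReal M ^ q ∂m := by
        refine setLIntegral_mono' hS.compl fun ξ hξ => ENNReal.rpow_le_rpow ?_ hq0.le
        rw [← ofReal_norm]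
        exact ENNReal.ofReal_le_ofReal (hM _ (le_of_not_ge fun h => hξ h))
    _ ≤ ENNReal.ofReal M ^ q * m univ := by
        rw [setLIntegral_const]
        gcongr
        exact subset_univ _
    _ ≤ ENNReal.ofReal M ^ q * hardyENorm q ψ ^ q := by
        gcongr
        rw [hm, withDensity_apply _ MeasurableSet.univ, setLIntegral_univ]
        exact hardyMean_le hq1 ψ hR

/-- Small test integrals near the sphere make a weighted composition operator compact. -/
theorem isCompactOperator_of_tendsto {n : ℕ} [NeZero n] {p q : ℝ} [Fact (1 ≤ p)]
    [Fact (1 ≤ q)] (hp : 1 < p) (hpq : p ≤ q) {ψ : Cn n → ℂ} {φ : Cn n → Cn n}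
    (hψ : DifferentiableOn ℂ ψ (unitBall n)) (hψq : hardyENorm q ψ < ∞)
    (hφ : DifferentiableOn ℂ φ (unitBall n)) (hφB : MapsTo φ (unitBall n) (unitBall n))
    {T : HardySpace n p →L[ℂ] HardySpace n q}
    (hT : ∀ f : HardySpace n p, (T f).toFun = weightedComp ψ φ f.toFun) {Ω : Cn n → ℝ≥0∞}
    (hΩ : ∀ w, ‖w‖ < 1 → ∀ R ∈ Ioo (0 : ℝ) 1,
      hardyMean q (weightedComp ψ φ (testFun p w)) R ≤ Ω w)
    (hlim : Tendsto Ω (comap (fun w : Cn n => ‖w‖) (𝓝[<] 1)) (𝓝 0)) :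
    IsCompactOperator T := by
  have hp0 : 0 < p := by linarith
  have hq0 : 0 < q := by linarith
  have hsmall : ∀ ε : ℝ≥0∞, 0 < ε → ∃ δ ∈ Ioo (0 : ℝ) 1, ∀ w, ‖w‖ < 1 → 1 - δ < ‖w‖ → Ω w ≤ ε := by
    intro ε hε
    have h1 := eventually_comap.1 (ENNReal.tendsto_nhds_zero.1 hlim ε hε)
    obtain ⟨a, ha, haS⟩ := (mem_nhdsLT_iff_exists_Ioo_subset).1 h1
    refine ⟨min (1 - a) (1 / 2), ⟨lt_min (sub_pos.2 ha) (by norm_num),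
      (min_le_right _ _).trans_lt (by norm_num)⟩, fun w hw hw' => haS ⟨?_, hw⟩ w rfl⟩
    have := min_le_left (1 - a) (1 / 2)
    linarith
  refine ⟨T '' Metric.closedBall 0 1, isCompact_iff_ultrafilter_le_nhds.2 fun u hu => ?_,
    mem_of_superset (Metric.closedBall_mem_nhds 0 one_pos) (subset_preimage_image T _)⟩
  have hu' : T '' Metric.closedBall 0 1 ∈ u := le_principal_iff.1 hu
  -- The ultrafilter on the image is lifted to one on the unit ball of H^p. Montel's theorem gives
  -- it a limit g there, and the image of the closed ball is shown to be compact itself.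
  set l := Ultrafilter.ofComapInfPrincipal hu' with hl
  have hlmem : Metric.closedBall (0 : HardySpace n p) 1 ∈ l :=
    Ultrafilter.ofComapInfPrincipal_mem hu'
  have hlmap : l.map T = u := Ultrafilter.ofComapInfPrincipal_eq_of_map hu'
  have hlb : ∀ᶠ f : HardySpace n p in (l : Filter (HardySpace n p)), ‖f‖ ≤ 1 := by
    filter_upwards [hlmem] with f hf using mem_closedBall_zero_iff.1 hf
  obtain ⟨g, hg⟩ := exists_tendstoLocallyUniformlyOn_of_bounded l (f := HardySpace.toFun)
    (Metric.isOpen_ball (x := (0 : Cn n)) (ε := 1)) HardySpace.differentiableOn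
    (fun K hK hKc => by
      rcases K.eq_empty_or_nonempty with rfl | hne
      · exact ⟨0, Eventually.of_forall fun f z hz => absurd hz (notMem_empty z)⟩
      · obtain ⟨x, hx, hmax⟩ := hKc.exists_isMaxOn hne continuous_norm.continuousOn
        refine ⟨((4 / (1 - ‖x‖)) ^ n) ^ (1 / p), hlb.mono fun f hf z hz => ?_⟩
        have hx1 : ‖x‖ < 1 := mem_ball_zero_iff.1 (hK hx)
        have hzx : ‖z‖ ≤ ‖x‖ := hmax hz
        have h0 : 0 < 1 - ‖x‖ := by linarith
        have h0' : 0 < 1 - ‖z‖ := by linarith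
        refine (f.norm_apply_le (hzx.trans_lt hx1)).trans ?_
        refine (mul_le_of_le_one_right (by positivity) hf).trans ?_
        gcongr)
  have hgd : DifferentiableOn ℂ g (unitBall n) :=
    differentiableOn_of_tendstoLocallyUniformlyOn Metric.isOpen_ball HardySpace.differentiableOn hg
  have hunif : ∀ s < 1, TendstoUniformlyOn HardySpace.toFun g
      (l : Filter (HardySpace n p)) (Metric.closedBall (0 : Cn n) s) :=
    fun s hs => (tendstoLocallyUniformlyOn_iff_forall_isCompact Metric.isOpen_ball).1 hg _
      (Metric.closedBall_subset_ball hs) (isCompact_closedBall _ _)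
  have hg1 : hardyENorm p ((unitBall n).indicator g) ≤ 1 := by
    rw [hardyENorm_congr (g := g) fun z hz => indicator_of_mem hz g]
    refine iSup₂_le fun r hr => ENNReal.le_of_forall_pos_le_add fun ε hε _ => ?_
    obtain ⟨f, hf, hfg⟩ := (hlb.and (Metric.tendstoUniformlyOn_iff.1 (hunif r hr.2) ε hε)).exists
    have h1 : (fun ξ : unitSphere n => g (r • (ξ : Cn n))) =
        (fun ξ : unitSphere n => f.toFun (r • (ξ : Cn n))) +
          fun ξ : unitSphere n => (g - f.toFun) (r • (ξ : Cn n)) := by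
      funext ξ
      simp
    rw [h1]
    refine (eLpNorm_add_le (aesm_dilate f.differentiableOn hr)
      (aesm_dilate (hgd.sub f.differentiableOn) hr) (by simpa using hp.le)).trans ?_
    refine add_le_add ?_ ?_
    · have h2 : hardyENorm p f.toFun ≤ 1 := by
        rw [f.hardyENorm_eq]
        exact ENNReal.ofReal_le_one.2 hf
      exact (le_iSup₂_of_le r hr le_rfl).trans h2
    · refine (eLpNorm_le_of_ae_bound (C := ε) (Eventually.of_forall fun ξ => ?_)).trans_eq ?_
      · have := hfg (r • (ξ : Cn n)) (mem_closedBall_zero_iff.2 (norm_smul_sphere hr.1.le ξ).le)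
        rw [dist_eq_norm] at this
        exact this.le
      · simp
  set g₀ : HardySpace n p := HardySpace.ofFun g hgd (hg1.trans_lt ENNReal.one_lt_top) with hg₀
  have hg₀1 : ‖g₀‖ ≤ 1 := by
    rw [HardySpace.norm_def]
    exact ENNReal.toReal_le_of_le_ofReal zero_le_one (by rw [ENNReal.ofReal_one]; exact hg1)
  have hpow : Tendsto (fun f => ENNReal.ofReal ‖T f - T g₀‖ ^ q) l (𝓝 0) := by
    refine ENNReal.tendsto_nhds_zero.2 fun η hη => ?_
    have hη2 : η / 2 ≠ 0 := (ENNReal.half_pos hη.ne').ne'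
    -- The factor 2^q accounts for ‖f - g₀‖ ≤ 2. With test bound η/(2C) the shell contributes at
    -- most η/2.
    set C : ℝ≥0∞ := embeddingConst n p q * ENNReal.ofReal (49 ^ n) ^ (q / p) *
      ENNReal.ofReal 2 ^ q with hC
    have hCtop : C ≠ ∞ := ENNReal.mul_ne_top (ENNReal.mul_ne_top (embeddingConst_ne_top n hp hpq)
      (ENNReal.rpow_ne_top_of_nonneg (by positivity) ENNReal.ofReal_ne_top))
      (ENNReal.rpow_ne_top_of_nonneg hq0.le ENNReal.ofReal_ne_top)
    have hε : 0 < η / 2 / C := ENNReal.div_pos hη2 hCtop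
    obtain ⟨δ, hδ, hδΩ⟩ := hsmall _ hε
    have hδ' : 0 < ENNReal.ofReal ((δ / 2) ^ n) ^ (q / p) := by
      have := hδ.1
      exact ENNReal.rpow_pos (ENNReal.ofReal_pos.2 (by positivity)) ENNReal.ofReal_ne_top
    -- The shell radius depends on δ: at |w| = s₀ the tests must beat the additional factor
    -- (δ/2)^(nq/p).
    obtain ⟨δ', hδ'1, hδ'Ω⟩ := hsmall _ (ENNReal.mul_pos hε.ne' hδ'.ne')
    have hs₀ : 1 - δ' / 2 ∈ Ioo (0 : ℝ) 1 := ⟨by linarith [hδ'1.2], by linarith [hδ'1.1]⟩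
    have hMt : Tendsto (fun M : ℝ => ENNReal.ofReal M ^ q * hardyENorm q ψ ^ q) (𝓝[>] 0)
        (𝓝 0) := by
      have h1 : Tendsto (fun M : ℝ => ENNReal.ofReal M ^ q) (𝓝[>] 0) (𝓝 0) := by
        have := ((ENNReal.continuous_rpow_const (y := q)).comp
          ENNReal.continuous_ofReal).tendsto 0
        simp only [Function.comp_apply, ENNReal.ofReal_zero, ENNReal.zero_rpow_of_pos hq0] at this
        exact this.mono_left nhdsWithin_le_nhds
      have h2 := ENNReal.Tendsto.mul_const h1 (b := hardyENorm q ψ ^ q)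
        (Or.inr (ENNReal.rpow_ne_top_of_nonneg hq0.le hψq.ne))
      rwa [zero_mul] at h2
    obtain ⟨M, hMη, hM⟩ := ((ENNReal.tendsto_nhds_zero.1 hMt _ (pos_iff_ne_zero.2 hη2)).and
      self_mem_nhdsWithin).exists
    filter_upwards [hlb, Metric.tendstoUniformlyOn_iff.1 (hunif _ hs₀.2) M hM] with f hf hfg
    have hbound := hardyENorm_weightedComp_rpow_le hp hpq hψ hφ hφB hδ hs₀
      (fun w hw hw' R hR => (hΩ w hw R hR).trans (hδΩ w hw hw'))
      (fun w hw R hR => (hΩ w (hw.trans_lt hs₀.2) R hR).trans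
        (hδ'Ω w (hw.trans_lt hs₀.2) (by rw [hw]; linarith [hδ'1.1])))
      (f - g₀).differentiableOn (M := M) (fun z hz => by
        have h1 := hfg z (mem_closedBall_zero_iff.2 hz)
        rw [HardySpace.toFun_sub, Pi.sub_apply, hg₀, HardySpace.toFun_ofFun,
          indicator_of_mem (mem_ball_zero_iff.2 (hz.trans_lt hs₀.2)), norm_sub_rev, ← dist_eq_norm]
        exact h1.le)
    rw [← hT, HardySpace.hardyENorm_eq, HardySpace.hardyENorm_eq, map_sub] at hbound
    refine hbound.trans ?_
    have h2 : ENNReal.ofReal ‖f - g₀‖ ^ q ≤ ENNReal.ofReal 2 ^ q := by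
      refine ENNReal.rpow_le_rpow (ENNReal.ofReal_le_ofReal ?_) hq0.le
      linarith [norm_sub_le f g₀]
    calc _ ≤ embeddingConst n p q * (ENNReal.ofReal (49 ^ n) ^ (q / p) * (η / 2 / C) *
          ENNReal.ofReal 2 ^ q) + η / 2 := by gcongr
      _ = C * (η / 2 / C) + η / 2 := by rw [hC]; ring
      _ ≤ η / 2 + η / 2 := by gcongr; exact ENNReal.mul_div_le
      _ = η := ENNReal.add_halves η
  have hlimT : Tendsto T l (𝓝 (T g₀)) := by
    rw [tendsto_iff_norm_sub_tendsto_zero]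
    have h1 := ((ENNReal.continuous_rpow_const (y := 1 / q)).tendsto 0).comp hpow
    rw [ENNReal.zero_rpow_of_pos (by positivity)] at h1
    have h2 := (ENNReal.tendsto_toReal ENNReal.zero_ne_top).comp h1
    refine h2.congr fun f => ?_
    rw [Function.comp_apply, Function.comp_apply, ← ENNReal.rpow_mul, mul_one_div_cancel hq0.ne',
      ENNReal.rpow_one, ENNReal.toReal_ofReal (norm_nonneg _)]
  refine ⟨T g₀, ⟨g₀, mem_closedBall_zero_iff.2 hg₀1, rfl⟩, ?_⟩
  rw [← hlmap]
  exact hlimT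

end WeightedComp

end

/-- `T` is the bounded operator `f ↦ ψ · (f ∘ φ)` from `H^p` to `H^q`. -/
theorem theorem6p3 (n : ℕ) [NeZero n] (p q : ℝ) [Fact (1 ≤ p)] [Fact (1 ≤ q)]
    (hp : 1 < p) (hpq : p ≤ q)
    (ψ : WeightedComp.Cn n → ℂ) (hψ : DifferentiableOn ℂ ψ (WeightedComp.unitBall n))
    (φ : WeightedComp.Cn n → WeightedComp.Cn n)
    (hφ : DifferentiableOn ℂ φ (WeightedComp.unitBall n))
    (hφB : MapsTo φ (WeightedComp.unitBall n) (WeightedComp.unitBall n))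
    (T : WeightedComp.HardySpace n p →L[ℂ] WeightedComp.HardySpace n q)
    (hT : ∀ f : WeightedComp.HardySpace n p,
      (T f).toFun = WeightedComp.weightedComp ψ φ f.toFun) :
    IsCompactOperator T ↔
      Tendsto
        (fun w : WeightedComp.Cn n =>
          ∫⁻ z in Metric.closedBall (0 : WeightedComp.Cn n) 1,
            ENNReal.ofReal ((1 - ‖w‖ ^ 2) ^ ((n : ℝ) * q / p) /
              ‖1 - inner ℂ w z‖ ^ (2 * (n : ℝ) * q / p))
            ∂(WeightedComp.pullMeasure ψ φ q))
        (comap (fun w : WeightedComp.Cn n => ‖w‖) (𝓝[<] 1)) (𝓝 0) := by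
  have hp0 : 0 < p := by linarith
  have hq1 : 1 < q := by linarith
  have hq0 : 0 < q := by linarith
  have hval (f : WeightedComp.Cn n → ℂ) (hf : DifferentiableOn ℂ f (WeightedComp.unitBall n))
      (hfp : WeightedComp.hardyENorm p ((WeightedComp.unitBall n).indicator f) < ∞) :
      (T (WeightedComp.HardySpace.ofFun f hf hfp)).toFun = WeightedComp.weightedComp ψ φ f := by
    rw [hT, WeightedComp.HardySpace.toFun_ofFun, WeightedComp.weightedComp_indicator hφB]
  -- ψ is the image of the constant function 1.
  have hψq : WeightedComp.hardyENorm q ψ < ∞ := by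
    have h1 : WeightedComp.hardyENorm p
        ((WeightedComp.unitBall n).indicator fun _ : WeightedComp.Cn n => (1 : ℂ)) < ∞ :=
      WeightedComp.hardyENorm_lt_top_of_bounded hp.le (C := 1) fun z hz => by
        simp [indicator_of_mem hz]
    have h2 := hval (fun _ => 1) (differentiableOn_const 1) h1
    have h3 := (T (WeightedComp.HardySpace.ofFun _ (differentiableOn_const 1) h1)).2.2.2
    change WeightedComp.hardyENorm q (WeightedComp.HardySpace.toFun _) < ∞ at h3
    rw [h2] at h3
    refine lt_of_eq_of_lt (WeightedComp.hardyENorm_congr fun z hz => ?_) h3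
    rw [WeightedComp.weightedComp, indicator_of_mem hz, mul_one]
  have hψl := WeightedComp.ae_tendsto_radialLimit hq1 hψ hψq
  have hφl := WeightedComp.ae_tendsto_radialLimit_of_mapsTo hφ hφB
  -- k_w is continuous up to the sphere, so T k_w has radial limits ψ*·k_w(φ*). The test integral is
  -- thus the q-integral of its boundary function, which lies below the Hardy norm (necessity) and
  -- above every integral mean (sufficiency).
  have hlim (w : WeightedComp.Cn n) (hw : ‖w‖ < 1) :
      ∀ᵐ ξ : WeightedComp.unitSphere n ∂(WeightedComp.sigma n),
        Tendsto (fun r : ℝ =>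
          WeightedComp.weightedComp ψ φ (WeightedComp.testFun p w) (r • (ξ : WeightedComp.Cn n)))
          (𝓝[<] 1) (𝓝 (WeightedComp.radialLimit ψ ξ *
            WeightedComp.testFun p w (WeightedComp.radialLimit φ ξ))) := by
    filter_upwards [hψl, hφl] with ξ h1 h2
    exact WeightedComp.tendsto_weightedComp_testFun p hφB hw h1 h2
  have hTw (w : WeightedComp.Cn n) (hw : ‖w‖ < 1) :
      (T (WeightedComp.testElement p w)).toFun =
        WeightedComp.weightedComp ψ φ (WeightedComp.testFun p w) := by
    rw [hT, WeightedComp.toFun_testElement hw, WeightedComp.weightedComp_indicator hφB]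
  constructor
  · intro hK
    refine WeightedComp.tendsto_testIntegral_of_isCompactOperator hφB hT hK fun w hw => ?_
    have hl := hlim w hw
    rw [← hTw w hw] at hl
    rw [WeightedComp.lintegral_pullMeasure hp0 hq0 hψ hφ hφB hψl hw, ← hTw w hw]
    exact WeightedComp.lintegral_boundary_le hq1.le (T (WeightedComp.testElement p w)).differentiableOn
      hl
  · refine WeightedComp.isCompactOperator_of_tendsto hp hpq hψ hψq hφ hφB hT fun w hw R hR => ?_
    have hl := hlim w hw
    rw [← hTw w hw] at hl
    rw [WeightedComp.lintegral_pullMeasure hp0 hq0 hψ hφ hφB hψl hw, ← hTw w hw]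
    exact WeightedComp.hardyMean_le_boundary hq1 (T (WeightedComp.testElement p w)).differentiableOn
      (T (WeightedComp.testElement p w)).2.2.2 hl hR
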